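/- Let $R=[0,W]\times[-1,0]$, $W>0$, be a rectangle of unit height. The cost per unit length is $\alpha$, with $0<\alpha<\sqrt2$, in the interior of $R$, $1$ outside $R$, and $\min\{1,\alpha\}$ on the boundary of $R$; the weighted length of a rectifiable path is the integral of this cost along the path, and a shortest path from $s$ to $t$ is one of minimum weighted length $d(s,t)$ among all rectifiable paths from $s$ to $t$. Let $s=(s_x,0)$ with $0\le s_x\le W$ be on the top side of $R$ and let $t=(t_x,t_y)$ be any point of the plane, where we assume that $s_x>0$ and $t_x\le s_x$, or, symmetrically, that $s_x<W$ and $t_x\ge s_x$. Consider the following 13 types of polygonal paths from $s$ to $t$, in which $b,b_1,b_2,b_3$ are real numbers. * Type 1: $s,t$, with $t_y>0$. * Type 2: $s,(b,0),t$, with $\alpha<1$, $t_y>0$, $0<b<s_x$. * Type 3: $s,(0,0),t$, with $\alpha<1$, $t_x<0$, $t_y\ge0$. * Type 4: $s,(0,0),t$, with $\alpha\ge1$, $t_x<0$, $t_y\le0$. * Type 5: $s,(b_1,0),(0,b_2),t$, with $\alpha>1$, $t_x<0$, $0<b_1<s_x$, $-1<b_2<0$. * Type 6: $s,(0,b),t$,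 with $t_x<0$, $-1<b<0$. * Type 7: $s,(0,b),(0,-1),t$, with $\alpha>1$, $t_x\ge0$, $t_y<-1$, $-1<b<0$. * Type 8: $s,(0,b_1),(0,b_2),(b_3,-1),t$, with $\alpha>1$, $t_y<-1$, $-1<b_2<b_1<0$, $0<b_3<W$. * Type 9: $s,(0,-1),t$, with $\alpha\le1$, $t_x\le0$, $t_y\le-1$, $t\notin R$. * Type 10: $s,(b,-1),t$, with $t_x\le s_x$, $t_y<-1$, $0<b<W$. * Type 11: $s,(b,0),t$, with $\alpha>1$, $t\in R$, $0<b<s_x$. * Type 12: $s,t$, with $t\in R$, and $\alpha\le1$ or $t=s$ or the open segment $st$ in the interior of $R$. * Type 13: $s,(0,b_1),(0,b_2),t$, with $\alpha>1$, $t\in R$, $-1<b_2<b_1<0$. Then the following holds. (i) There is a shortest path from $s$ to $t$ that is of one of the 13 types, possibly after the reflection $(x,y)\mapsto(W-x,y)$ of the whole configuration. (ii) If some shortest path from $s$ to $t$ is of type $i$, then $d(s,t)=d_i(s,t)$, where $$\begin{aligned} d_1&=\sqrt{(s_x-t_x)^2+t_y^2}, & d_2&=\alpha(s_x-t_x)+\sqrt{1-\alpha^2}\,t_y,\\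 d_3&=\alpha s_x+\sqrt{t_x^2+t_y^2}, & d_4&=s_x+\sqrt{t_x^2+t_y^2},\\ d_5&=s_x-\sqrt{2-\alpha^2}\,t_x-\sqrt{\alpha^2-1}\,t_y, & d_6&=\alpha\sqrt{s_x^2+w_1^2}+\sqrt{t_x^2+(t_y-w_1)^2},\\ d_7&=\sqrt{\alpha^2-1}\,s_x+1+\sqrt{t_x^2+(t_y+1)^2}, & d_8&=\sqrt{\alpha^2-1}(s_x+t_x)-\sqrt{2-\alpha^2}(1+t_y)+1,\\ d_9&=\alpha\sqrt{s_x^2+1}+\sqrt{t_x^2+(t_y+1)^2}, & d_{10}&=\alpha\sqrt{(s_x-w_2)^2+1}+\sqrt{(t_x-w_2)^2+(t_y+1)^2},\\ d_{11}&=s_x-t_x-\sqrt{\alpha^2-1}\,t_y, & d_{12}&=\alpha\sqrt{(s_x-t_x)^2+t_y^2},\\ d_{13}&=\sqrt{\alpha^2-1}(s_x+t_x)-t_y. \end{aligned}$$ If it is of type $i$ after the reflection, then $d(s,t)$ is given by $d_i$ with $s_x,t_x$ replaced by $W-s_x,W-t_x$. Here, with $\beta=\alpha^2-1$, $w_1$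 is the unique real solution in the interval $(t_y,0)$ (which exists if a shortest path is of type 6) of $$\beta w^4-2t_y\beta w^3+[\alpha^2t_x^2+\beta t_y^2-s_x^2]w^2+2s_x^2t_yw-s_x^2t_y^2=0,$$ and $w_2$ is the unique real solution in the interval $(t_x,s_x)$ (which exists if a shortest path is of type 10 and $t_x\neq s_x$; if $t_x=s_x$, then $w_2=s_x$) of $$\begin{aligned}&\beta w^4-2\beta(t_x+s_x)w^3+[\beta(s_x^2+t_x^2+4s_xt_x)+\alpha^2(1+t_y)^2-1]w^2\\&-2[\beta(t_xs_x^2+t_x^2s_x)+\alpha^2(1+t_y)^2s_x-t_x]w+\beta t_x^2s_x^2+\alpha^2(1+t_y)^2s_x^2-t_x^2=0.\end{aligned}$$ (iii) A shortest path of one of the 13 types (up to the reflection) and its length can be computed in $O(1)$ time in the algebraic computation model over $\mathbb Q$: there are one program and one constant $C$ such that for all $\alpha,W,s_x,t_x,t_y$ as above the program, given these five numbers, performs at most $C$ steps and returns the type, whether the reflection is used, the coordinates of the intermediate vertices of a shortest path of this type, and its weighted length. A step introduces a rational constant, applies one of $+,-,\times,\div$ (with nonzero divisor) or a $k$-th root,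 $k\ge2$, to numbers computed before, compares two of them and branches, or halts. Numbers are exact; intermediate results may be complex, with principal roots, and the test is whether $y-x$ is a nonnegative real number. -/

import Mathlib

open Set

noncomputable section

namespace WeightedRectangle

/-! ### The weighted plane and its paths -/

/-- The Euclidean plane. -/
abbrev Plane : Type := EuclideanSpace ℝ (Fin 2)

/-- The point with coordinates `(x, y)`. -/
def pt (x y : ℝ) : Plane := !₂[x, y]

/-- The closed rectangle of width `W` and unit height whose top-left corner is the origin. -/
def rect (W : ℝ) : Set Plane := {p | 0 ≤ p 0 ∧ p 0 ≤ W ∧ -1 ≤ p 1 ∧ p 1 ≤ 0}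

/-- The open rectangle of width `W` and unit height whose top-left corner is the origin. -/
def openRect (W : ℝ) : Set Plane := {p | 0 < p 0 ∧ p 0 < W ∧ -1 < p 1 ∧ p 1 < 0}

open Classical in
/-- The cost per unit length: `α` inside the rectangle, `1` outside, and the cheaper of the two on
its boundary. -/
def weight (α W : ℝ) (p : Plane) : ℝ :=
  if p ∈ openRect W then α else if p ∈ rect W then min 1 α else 1

/-- `γ`, restricted to `[0,1]`, is a (rectifiable) path from `s` to `t`. -/
def IsPath (γ : ℝ → Plane) (s t : Plane) : Prop :=
  (∃ K : NNReal, LipschitzOnWith K γ (Icc 0 1)) ∧ γ 0 = s ∧ γ 1 = t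

/-- The weighted length of the path `γ`, restricted to `[0,1]`. -/
def weightedLength (α W : ℝ) (γ : ℝ → Plane) : ℝ :=
  ∫ u in (0 : ℝ)..1, weight α W (γ u) * ‖deriv γ u‖

/-- `γ` is a shortest path from `s` to `t`, among all paths from `s` to `t`. -/
def IsShortestPath (α W : ℝ) (γ : ℝ → Plane) (s t : Plane) : Prop :=
  IsPath γ s t ∧ ∀ δ : ℝ → Plane, IsPath δ s t → weightedLength α W γ ≤ weightedLength α W δ

/-- The polygonal chain that starts at the given point and visits the points of the list in order,
parametrized by `[0,1]`. -/
def chain : Plane → List Plane → ℝ → Plane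
  | p, [], _ => p
  | p, q :: l, u => if u ≤ 1 / 2 then AffineMap.lineMap p q (2 * u) else chain q l (2 * u - 1)

/-! ### Instances of the problem -/

/-- The data of the problem: the weight `α` and the width `W` of the rectangle, the source
`(sx, 0)` and the target `(tx, ty)`. -/
structure Instance where
  α : ℝ
  W : ℝ
  sx : ℝ
  tx : ℝ
  ty : ℝ

namespace Instance

/-- The source. -/
def s (c : Instance) : Plane := pt c.sx 0

/-- The target. -/
def t (c : Instance) : Plane := pt c.tx c.ty

/-- The weight is in `(0, √2)`, and the source is on the top side of the rectangle; if the target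
is to the left of the vertical line through the source (or on it), the source is not the left
corner, or symmetrically. -/
def Admissible (c : Instance) : Prop :=
  0 < c.α ∧ c.α < √2 ∧ 0 < c.W ∧ 0 ≤ c.sx ∧ c.sx ≤ c.W ∧
    ((0 < c.sx ∧ c.tx ≤ c.sx) ∨ (c.sx < c.W ∧ c.sx ≤ c.tx))

/-- The mirror image of an instance in the vertical axis of the rectangle (if the flag is set). -/
def mirror (c : Instance) : Bool → Instance
  | false => c
  | true => { c with sx := c.W - c.sx, tx := c.W - c.tx }

/-- The mirror image of a point in the vertical axis of the rectangle (if the flag is set). -/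
def mirrorPt (c : Instance) : Bool → Plane → Plane
  | false, p => p
  | true, p => pt (c.W - p 0) (p 1)

/-- The polygonal chain from source to target with the given intermediate vertices. -/
def path (c : Instance) (vs : List Plane) : ℝ → Plane := chain c.s (vs ++ [c.t])

/-- The polygonal chain with the given intermediate vertices is a shortest path from source to
target. -/
def IsShortest (c : Instance) (vs : List Plane) : Prop :=
  IsShortestPath c.α c.W (c.path vs) c.s c.t

/-- The weighted length of the polygonal chain with the given intermediate vertices. -/
def len (c : Instance) (vs : List Plane) : ℝ := weightedLength c.α c.W (c.path vs)

end Instance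

/-! ### The thirteen combinatorial types -/

/-- The names of the thirteen types. -/
inductive PathType
  | p1 | p2 | p3 | p4 | p5 | p6 | p7 | p8 | p9 | p10 | p11 | p12 | p13

/-- The path from source to target with intermediate vertices `vs` is of the given type. The types
`p1` to `p10` are for targets outside the rectangle, `p11` to `p13` for targets in it.
* `p1`: directly, above the rectangle;
* `p2`: along the top side, leaving it upwards before the left corner;
* `p3`, `p4`: along the top side up to its left corner (for `α < 1` and `1 ≤ α`);
* `p5`: along the top side, then through the rectangle to the left side;
* `p6`: through the rectangle to the left side;
* `p7`: through the rectangle to the left side, then along it to the bottom-left corner;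
* `p8`: through the rectangle to the left side, along it, through the rectangle again to the bottom;
* `p9`: through the rectangle to the bottom-left corner;
* `p10`: through the rectangle to the bottom side;
* `p11`: along the top side, then into the rectangle;
* `p12`: directly, through the rectangle;
* `p13`: through the rectangle to the left side, along it, then into the rectangle again. -/
def HasType (c : Instance) (vs : List Plane) : PathType → Prop
  | .p1 => vs = [] ∧ 0 < c.ty
  | .p2 => c.α < 1 ∧ 0 < c.ty ∧ ∃ b, 0 < b ∧ b < c.sx ∧ vs = [pt b 0]
  | .p3 => c.α < 1 ∧ c.tx < 0 ∧ 0 ≤ c.ty ∧ vs = [pt 0 0]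
  | .p4 => 1 ≤ c.α ∧ c.tx < 0 ∧ c.ty ≤ 0 ∧ vs = [pt 0 0]
  | .p5 => 1 < c.α ∧ c.tx < 0 ∧
      ∃ b₁ b₂, 0 < b₁ ∧ b₁ < c.sx ∧ -1 < b₂ ∧ b₂ < 0 ∧ vs = [pt b₁ 0, pt 0 b₂]
  | .p6 => c.tx < 0 ∧ ∃ b, -1 < b ∧ b < 0 ∧ vs = [pt 0 b]
  | .p7 => 1 < c.α ∧ 0 ≤ c.tx ∧ c.ty < -1 ∧ ∃ b, -1 < b ∧ b < 0 ∧ vs = [pt 0 b, pt 0 (-1)]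
  | .p8 => 1 < c.α ∧ c.ty < -1 ∧ ∃ b₁ b₂ b₃, -1 < b₂ ∧ b₂ < b₁ ∧ b₁ < 0 ∧ 0 < b₃ ∧ b₃ < c.W ∧
      vs = [pt 0 b₁, pt 0 b₂, pt b₃ (-1)]
  | .p9 => c.α ≤ 1 ∧ c.tx ≤ 0 ∧ c.ty ≤ -1 ∧ c.t ∉ rect c.W ∧ vs = [pt 0 (-1)]
  | .p10 => c.tx ≤ c.sx ∧ c.ty < -1 ∧ ∃ b, 0 < b ∧ b < c.W ∧ vs = [pt b (-1)]
  | .p11 => 1 < c.α ∧ c.t ∈ rect c.W ∧ ∃ b, 0 < b ∧ b < c.sx ∧ vs = [pt b 0]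
  | .p12 => c.t ∈ rect c.W ∧ vs = [] ∧
      (c.α ≤ 1 ∨ c.t = c.s ∨ openSegment ℝ c.s c.t ⊆ openRect c.W)
  | .p13 => 1 < c.α ∧ c.t ∈ rect c.W ∧
      ∃ b₁ b₂, -1 < b₂ ∧ b₂ < b₁ ∧ b₁ < 0 ∧ vs = [pt 0 b₁, pt 0 b₂]

/-! ### The length formulas -/

/-- `w` is the unique zero of `f` in the open interval `(a, b)`. -/
def IsUniqueZero (f : ℝ → ℝ) (a b w : ℝ) : Prop :=
  w ∈ Ioo a b ∧ f w = 0 ∧ ∀ v ∈ Ioo a b, f v = 0 → v = w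

/-- The quartic for the point where a path of type `p6` leaves the left side. -/
def quartic₁ (c : Instance) (w : ℝ) : ℝ :=
  let β := c.α ^ 2 - 1
  β * w ^ 4 - 2 * c.ty * β * w ^ 3 + (c.α ^ 2 * c.tx ^ 2 + β * c.ty ^ 2 - c.sx ^ 2) * w ^ 2
    + 2 * c.sx ^ 2 * c.ty * w - c.sx ^ 2 * c.ty ^ 2

/-- The quartic for the point where a path of type `p10` leaves the bottom side. -/
def quartic₂ (c : Instance) (w : ℝ) : ℝ :=
  let β := c.α ^ 2 - 1
  β * w ^ 4 - 2 * β * (c.tx + c.sx) * w ^ 3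
    + (β * (c.sx ^ 2 + c.tx ^ 2 + 4 * c.sx * c.tx) + c.α ^ 2 * (1 + c.ty) ^ 2 - 1) * w ^ 2
    - 2 * (β * (c.tx * c.sx ^ 2 + c.tx ^ 2 * c.sx) + c.α ^ 2 * (1 + c.ty) ^ 2 * c.sx - c.tx) * w
    + β * c.tx ^ 2 * c.sx ^ 2 + c.α ^ 2 * (1 + c.ty) ^ 2 * c.sx ^ 2 - c.tx ^ 2

/-- `d` is the length given by the formula for the given type. In the formula for `p10`, the
interval is empty if the target is vertically below the source; then `w` is `sx`. -/
def IsFormula (c : Instance) (d : ℝ) : PathType → Prop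
  | .p1 => d = √((c.sx - c.tx) ^ 2 + c.ty ^ 2)
  | .p2 => d = c.α * (c.sx - c.tx) + √(1 - c.α ^ 2) * c.ty
  | .p3 => d = c.α * c.sx + √(c.tx ^ 2 + c.ty ^ 2)
  | .p4 => d = c.sx + √(c.tx ^ 2 + c.ty ^ 2)
  | .p5 => d = c.sx - √(2 - c.α ^ 2) * c.tx - √(c.α ^ 2 - 1) * c.ty
  | .p6 => ∃ w, IsUniqueZero (quartic₁ c) c.ty 0 w ∧
      d = c.α * √(c.sx ^ 2 + w ^ 2) + √(c.tx ^ 2 + (c.ty - w) ^ 2)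
  | .p7 => d = √(c.α ^ 2 - 1) * c.sx + 1 + √(c.tx ^ 2 + (c.ty + 1) ^ 2)
  | .p8 => d = √(c.α ^ 2 - 1) * (c.sx + c.tx) - √(2 - c.α ^ 2) * (1 + c.ty) + 1
  | .p9 => d = c.α * √(c.sx ^ 2 + 1) + √(c.tx ^ 2 + (c.ty + 1) ^ 2)
  | .p10 => ∃ w, (IsUniqueZero (quartic₂ c) c.tx c.sx w ∨ c.tx = c.sx ∧ w = c.sx) ∧
      d = c.α * √((c.sx - w) ^ 2 + 1) + √((c.tx - w) ^ 2 + (c.ty + 1) ^ 2)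
  | .p11 => d = c.sx - c.tx - √(c.α ^ 2 - 1) * c.ty
  | .p12 => d = c.α * √((c.sx - c.tx) ^ 2 + c.ty ^ 2)
  | .p13 => d = √(c.α ^ 2 - 1) * (c.sx + c.tx) - c.ty

/-! ### The algebraic computation model over the rational numbers -/

/-- The instructions of the machine: rational constants, the four arithmetic operations on earlier
registers, and `k`-th roots of earlier registers. -/
inductive Instr
  | const (q : ℚ)
  | add (i j : ℕ)
  | sub (i j : ℕ)
  | mul (i j : ℕ)
  | div (i j : ℕ)
  | root (k i : ℕ)

open Classical in
/-- The value of an instruction, for given contents of the registers, if there is one: registers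
have to exist, divisors must not vanish, and roots have degree at least two. Registers hold exact
complex numbers (solutions of quartics by radicals need roots of complex numbers even when they are
real), and the root is the principal one: the usual one for nonnegative reals. -/
def Instr.eval (r : List ℂ) : Instr → Option ℂ
  | .const q => some (q : ℂ)
  | .add i j => do return (← r[i]?) + (← r[j]?)
  | .sub i j => do return (← r[i]?) - (← r[j]?)
  | .mul i j => do return (← r[i]?) * (← r[j]?)
  | .div i j => do
      let x ← r[i]?
      let y ← r[j]?
      if y = 0 then none else some (x / y)
  | .root k i => do
      let x ← r[i]?
      if 2 ≤ k then some (x ^ (1 / (k : ℂ))) else none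

/-- A program: it appends the value of an instruction to the registers and continues, or compares
two registers and branches, or halts with a label and the contents of some registers as output. -/
inductive Program (Λ : Type) : Type
  | op (I : Instr) (next : Program Λ)
  | ifLE (i j : ℕ) (yes no : Program Λ)
  | halt (label : Λ) (out : List ℕ)

open Classical in
/-- Running a program on given contents of the registers; the result, if there is one, consists of
the output (label and numbers) and the number of executed steps. The test on registers `i`, `j` is
whether the difference of the second and the first number is a nonnegative real number. -/
def Program.run {Λ : Type} : Program Λ → List ℂ → Option ((Λ × List ℂ) × ℕ)
  | .op I next, r => do
      let x ← I.eval r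
      let (o, n) ← next.run (r ++ [x])
      return (o, n + 1)
  | .ifLE i j yes no, r => do
      let x ← r[i]?
      let y ← r[j]?
      let (o, n) ← if (y - x).im = 0 ∧ 0 ≤ (y - x).re then yes.run r else no.run r
      return (o, n + 1)
  | .halt label out, r => do
      let xs ← out.mapM (fun i => r[i]?)
      return ((label, xs), 1)

/-- The input registers for an instance. -/
def Instance.input (c : Instance) : List ℂ := [c.α, c.W, c.sx, c.tx, c.ty].map (fun x : ℝ => (x : ℂ))

/-- The output numbers that describe a path by its intermediate vertices and its length. -/
def encode (vs : List Plane) (d : ℝ) : List ℂ :=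
  (vs.flatMap (fun p => [p 0, p 1]) ++ [d]).map (fun x : ℝ => (x : ℂ))

end WeightedRectangle

end

noncomputable section

namespace WeightedRectangle

open MeasureTheory Filter Topology

/-! ### Coordinates of the plane -/

/-! Lower bound. By reflection let the target not be to the right of the source. Clamping a path to
the bounding box of the rectangle and the target increases neither weight nor speed
(`cost_clamp_le`); afterwards the last point in the rectangle is the target itself or lies on a side
that faces the target (`IsExit`). From there on the weight is one, so the rest costs at least the
Euclidean distance. The part before it costs at least `innerDist`. For `α ≤ 1` this is `α` times the
Euclidean distance, since no weight is below `α`. For `α > 1` it comes from a calibration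
(`linear_le_cost_of_rect`): a constant covector of norm at most `α` with both components in `[-1,
1]` grows along a path in the rectangle no faster than the weighted length, because on a side the
normal velocity vanishes. Optimizing the covector gives the support function of a disc of radius
`α`, truncated in one direction (`slabNorm`) or in both (`boxNorm`). The corners of the truncated
disc encode the critical angles, with `k = √(α² - 1)`. A path that touches a vertical side is
unfolded there (`innerDist_le_cost`).

Existence. Every path is thus at least as long as the minimum of `exitLen` over the compact set of
exits. At a minimizing exit, one-sided derivatives exclude all positions that belong to no type, and
in the remaining ones an explicit path of some type has length at most `exitLen`
(`reaches_of_le_one`, `reaches_rect`, `reaches_left`, `reaches_bottom`). So a shortest path exists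
and has a type, without any compactness argument for spaces of paths.

Formulas. A shortest path of a given type is stationary under moving a vertex along its side, which
is Snell's law. Where the path joins a side to run along it or leaves such a run, the angle is
critical and everything is explicit; for `p6` and `p10` the squared law is the quartic, and the
monotonicity of both sines makes its zero in the interval unique (`ratio_unique`). So each type has
canonical vertices that depend only on the input and are at least as good as any shortest path of
the type (`determined`).

Computation. The canonical vertices are algebraic functions of the input; zeros of quartics are
selected from the finitely many values of the Cardano and Ferrari formulas (`exists_ralg_zero`), and
such functions compile to branching programs (`Alg.solves`). Among the canonical paths of the 13
types and their reflections, the program selects a shortest one that really is of its type. By the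
first parts some candidate is a shortest path, hence so is the selected one. -/

@[simp] lemma pt_zero (x y : ℝ) : pt x y 0 = x := by simp [pt]

@[simp] lemma pt_one (x y : ℝ) : pt x y 1 = y := by simp [pt]

lemma plane_ext {p q : Plane} (h0 : p 0 = q 0) (h1 : p 1 = q 1) : p = q := by
  ext i; fin_cases i <;> assumption

lemma pt_eta (p : Plane) : pt (p 0) (p 1) = p := plane_ext (by simp) (by simp)

lemma norm_plane (v : Plane) : ‖v‖ = √(v 0 ^ 2 + v 1 ^ 2) := by
  rw [EuclideanSpace.norm_eq]; simp [Fin.sum_univ_two]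

lemma abs_coord_le (v : Plane) (i : Fin 2) : |v i| ≤ ‖v‖ := by
  simpa using PiLp.norm_apply_le v i

lemma linear_le (a b m : ℝ) (hm : 0 ≤ m) (h : a ^ 2 + b ^ 2 ≤ m ^ 2) (v : Plane) :
    a * v 0 + b * v 1 ≤ m * ‖v‖ := by
  rw [norm_plane]
  have h1 : 0 ≤ v 0 ^ 2 + v 1 ^ 2 := by positivity
  have h2 : m * √(v 0 ^ 2 + v 1 ^ 2) = √(m ^ 2 * (v 0 ^ 2 + v 1 ^ 2)) := by
    rw [Real.sqrt_mul (by positivity), Real.sqrt_sq hm]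
  rw [h2]
  apply Real.le_sqrt_of_sq_le
  nlinarith [sq_nonneg (a * v 1 - b * v 0)]

lemma continuous_coord (i : Fin 2) : Continuous fun p : Plane => p i :=
  (EuclideanSpace.proj (𝕜 := ℝ) i).continuous

lemma hasDerivAt_coord {γ : ℝ → Plane} {v : Plane} {u : ℝ} (h : HasDerivAt γ v u) (i : Fin 2) :
    HasDerivAt (fun x => γ x i) (v i) u :=
  ((EuclideanSpace.proj (𝕜 := ℝ) i).hasFDerivAt.comp_hasDerivAt u h)

/-! ### The weight -/

lemma isClosed_rect (W : ℝ) : IsClosed (rect W) := by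
  have h0 := continuous_coord 0
  have h1 := continuous_coord 1
  exact (isClosed_le continuous_const h0).inter ((isClosed_le h0 continuous_const).inter
    ((isClosed_le continuous_const h1).inter (isClosed_le h1 continuous_const)))

lemma isOpen_openRect (W : ℝ) : IsOpen (openRect W) := by
  have h0 := continuous_coord 0
  have h1 := continuous_coord 1
  exact (isOpen_lt continuous_const h0).inter ((isOpen_lt h0 continuous_const).inter
    ((isOpen_lt continuous_const h1).inter (isOpen_lt h1 continuous_const)))

lemma openRect_subset_rect (W : ℝ) : openRect W ⊆ rect W := by
  rintro p ⟨h1, h2, h3, h4⟩; exact ⟨h1.le, h2.le, h3.le, h4.le⟩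

lemma measurable_weight (α W : ℝ) : Measurable (weight α W) := by
  classical
  unfold weight
  exact Measurable.ite (isOpen_openRect W).measurableSet measurable_const
    (Measurable.ite (isClosed_rect W).measurableSet measurable_const measurable_const)

lemma weight_of_mem_openRect {α W : ℝ} {p : Plane} (h : p ∈ openRect W) : weight α W p = α := by
  simp [weight, h]

lemma weight_of_boundary {α W : ℝ} {p : Plane} (h : p ∉ openRect W) (h' : p ∈ rect W) :
    weight α W p = min 1 α := by
  simp [weight, h, h']

lemma weight_of_notMem {α W : ℝ} {p : Plane} (h : p ∉ rect W) : weight α W p = 1 := by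
  have h' : p ∉ openRect W := fun h' => h (openRect_subset_rect W h')
  simp [weight, h, h']

lemma weight_of_le_one {α W : ℝ} (hα : α ≤ 1) {p : Plane} (h : p ∈ rect W) :
    weight α W p = α := by
  by_cases h' : p ∈ openRect W
  · exact weight_of_mem_openRect h'
  · rw [weight_of_boundary h' h, min_eq_right hα]

lemma weight_of_one_le {α W : ℝ} (hα : 1 ≤ α) {p : Plane} (h : p ∉ openRect W) :
    weight α W p = 1 := by
  by_cases h' : p ∈ rect W
  · rw [weight_of_boundary h h', min_eq_left hα]
  · exact weight_of_notMem h'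

lemma min_le_weight (α W : ℝ) (p : Plane) : min 1 α ≤ weight α W p := by
  unfold weight; split_ifs <;> simp

lemma weight_nonneg {α : ℝ} (hα : 0 < α) (W : ℝ) (p : Plane) : 0 ≤ weight α W p :=
  (le_min zero_le_one hα.le).trans (min_le_weight α W p)

lemma weight_le (α W : ℝ) (p : Plane) : weight α W p ≤ max 1 α := by
  unfold weight
  split_ifs
  · exact le_max_right _ _
  · exact (min_le_left _ _).trans (le_max_left _ _)
  · exact le_max_left _ _

/-! ### The weighted length of a part of a path -/

/-- The weighted length of the part of `γ` between the times `a` and `b`. -/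
def cost (α W : ℝ) (γ : ℝ → Plane) (a b : ℝ) : ℝ :=
  ∫ u in a..b, weight α W (γ u) * ‖deriv γ u‖

lemma intervalIntegrable_of_continuous {α W : ℝ} (hα : 0 < α) {γ : ℝ → Plane} {K a b : ℝ}
    (hγ : ContinuousOn γ (uIcc a b)) (hK : ∀ᵐ u, u ∈ uIoc a b → ‖deriv γ u‖ ≤ K) :
    IntervalIntegrable (fun u => weight α W (γ u) * ‖deriv γ u‖) volume a b := by
  rw [intervalIntegrable_iff]
  have hc : IntegrableOn (fun _ : ℝ => max 1 α * K) (uIoc a b) volume :=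
    integrableOn_const (by simp)
  refine Integrable.mono' hc ?_ ?_
  · have : AEMeasurable γ (volume.restrict (uIoc a b)) :=
      (hγ.mono uIoc_subset_uIcc).aemeasurable measurableSet_uIoc
    have h1 : AEStronglyMeasurable (fun u => weight α W (γ u)) (volume.restrict (uIoc a b)) :=
      ((measurable_weight α W).comp_aemeasurable this).aestronglyMeasurable
    exact h1.mul (stronglyMeasurable_deriv γ).norm.aestronglyMeasurable
  · rw [ae_restrict_iff' measurableSet_uIoc]
    filter_upwards [hK] with u hu hmem
    rw [norm_mul, norm_norm, Real.norm_of_nonneg (weight_nonneg hα W _)]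
    exact mul_le_mul (weight_le α W _) (hu hmem) (norm_nonneg _) (le_max_of_le_left zero_le_one)

section Lipschitz

variable {α W : ℝ} {K : NNReal} {γ : ℝ → Plane}

lemma cost_integrable (hα : 0 < α) (hγ : LipschitzWith K γ) (a b : ℝ) :
    IntervalIntegrable (fun u => weight α W (γ u) * ‖deriv γ u‖) volume a b :=
  intervalIntegrable_of_continuous (K := K) hα hγ.continuous.continuousOn
    (Eventually.of_forall fun _ _ => norm_deriv_le_of_lipschitz hγ)

lemma cost_add (hα : 0 < α) (hγ : LipschitzWith K γ) (a b c : ℝ) :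
    cost α W γ a b + cost α W γ b c = cost α W γ a c :=
  intervalIntegral.integral_add_adjacent_intervals (cost_integrable hα hγ a b)
    (cost_integrable hα hγ b c)

/-- A linear functional that grows at most as fast as the weighted length is a lower bound. -/
lemma linear_le_cost (hα : 0 < α) (hγ : LipschitzWith K γ) {a b : ℝ} (hab : a ≤ b) (p q : ℝ)
    (h : ∀ u ∈ Ioo a b, DifferentiableAt ℝ γ u →
      p * deriv γ u 0 + q * deriv γ u 1 ≤ weight α W (γ u) * ‖deriv γ u‖) :
    p * (γ b 0 - γ a 0) + q * (γ b 1 - γ a 1) ≤ cost α W γ a b := by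
  set L : Plane →L[ℝ] ℝ := p • EuclideanSpace.proj (𝕜 := ℝ) 0 + q • EuclideanSpace.proj (𝕜 := ℝ) 1
    with hL
  have hLv : ∀ v : Plane, L v = p * v 0 + q * v 1 := fun v => by simp [hL]
  have hlip : LipschitzWith (‖L‖₊ * K) (fun u => L (γ u)) := L.lipschitz.comp hγ
  -- A Lipschitz function is absolutely continuous, so its increment is the integral of its
  -- derivative even though the derivative exists only almost everywhere.
  have hac := (hlip.lipschitzOnWith (s := uIcc a b)).absolutelyContinuousOnInterval
  have hftc := hac.integral_deriv_eq_sub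
  have hd : ∀ᵐ u : ℝ, u ∈ Ioo a b → deriv (fun u => L (γ u)) u ≤ weight α W (γ u) * ‖deriv γ u‖ := by
    filter_upwards [hγ.ae_differentiableAt_real] with u hu hmem
    have : HasDerivAt (fun u => L (γ u)) (L (deriv γ u)) u :=
      L.hasFDerivAt.comp_hasDerivAt u hu.hasDerivAt
    rw [this.deriv, hLv]
    exact h u hmem hu
  have : ∫ u in a..b, deriv (fun u => L (γ u)) u ≤ cost α W γ a b := by
    refine intervalIntegral.integral_mono_ae_restrict hab hac.intervalIntegrable_deriv
      (cost_integrable hα hγ a b) ?_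
    rw [← restrict_Ioo_eq_restrict_Icc]
    rw [EventuallyLE, ae_restrict_iff' measurableSet_Ioo]
    exact hd
  rw [hftc, hLv, hLv] at this
  linarith

/-- The covector to use is `m` times the unit vector of the displacement; its norm is `m`, and its
value on the displacement is `m` times the distance. Coinciding endpoints have no direction and only
need nonnegativity. -/
lemma mul_norm_le_cost (hα : 0 < α) (hγ : LipschitzWith K γ) {a b : ℝ} (hab : a ≤ b) {m : ℝ}
    (hm : 0 ≤ m) (h : ∀ u ∈ Ioo a b, m ≤ weight α W (γ u)) :
    m * √((γ b 0 - γ a 0) ^ 2 + (γ b 1 - γ a 1) ^ 2) ≤ cost α W γ a b := by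
  set x := γ b 0 - γ a 0 with hx
  set y := γ b 1 - γ a 1 with hy
  set r := √(x ^ 2 + y ^ 2) with hr
  have hrr : r ^ 2 = x ^ 2 + y ^ 2 := Real.sq_sqrt (by positivity)
  rcases eq_or_lt_of_le (Real.sqrt_nonneg (x ^ 2 + y ^ 2)) with h0 | h0
  · rw [← hr] at h0
    rw [← h0, mul_zero]
    exact intervalIntegral.integral_nonneg hab fun u _ =>
      mul_nonneg (weight_nonneg hα W _) (norm_nonneg _)
  · rw [← hr] at h0
    have := linear_le_cost (W := W) hα hγ hab (m * (x / r)) (m * (y / r)) (fun u hu _ => by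
      refine (linear_le _ _ m hm (le_of_eq ?_) _).trans
        (mul_le_mul_of_nonneg_right (h u hu) (norm_nonneg _))
      field_simp
      rw [hrr])
    refine le_trans (le_of_eq ?_) this
    rw [← hx, ← hy]
    field_simp
    rw [hrr]

end Lipschitz

/-! ### Clamping a path to a box -/

/-- The nearest point of the box `[x₀, x₁] × [y₀, y₁]`. -/
def clamp (x₀ x₁ y₀ y₁ : ℝ) (p : Plane) : Plane :=
  pt (max x₀ (min x₁ (p 0))) (max y₀ (min y₁ (p 1)))

lemma norm_clamp_sub_le (x₀ x₁ y₀ y₁ : ℝ) (p q : Plane) :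
    ‖clamp x₀ x₁ y₀ y₁ p - clamp x₀ x₁ y₀ y₁ q‖ ≤ ‖p - q‖ := by
  have key : ∀ a b x y : ℝ, (max a (min b x) - max a (min b y)) ^ 2 ≤ (x - y) ^ 2 := by
    intro a b x y
    refine sq_le_sq.2 ((abs_max_sub_max_le_max a _ a _).trans ?_)
    rw [sub_self, abs_zero]
    refine max_le (abs_nonneg _) ((abs_min_sub_min_le_max b x b y).trans ?_)
    rw [sub_self, abs_zero]
    exact max_le (abs_nonneg _) le_rfl
  rw [norm_plane, norm_plane]
  refine Real.sqrt_le_sqrt ?_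
  simp only [PiLp.sub_apply, clamp, pt_zero, pt_one]
  exact add_le_add (key _ _ _ _) (key _ _ _ _)

/-- Compare difference quotients. This serves for clamping and for reflection, so that neither needs
an explicit derivative. -/
lemma norm_deriv_le_of_norm_sub_le {E F : Type*} [NormedAddCommGroup E] [NormedSpace ℝ E]
    [NormedAddCommGroup F] [NormedSpace ℝ F] {f : ℝ → E} {g : ℝ → F} {u : ℝ}
    (h : ∀ x, ‖f x - f u‖ ≤ ‖g x - g u‖) (hf : DifferentiableAt ℝ f u)
    (hg : DifferentiableAt ℝ g u) : ‖deriv f u‖ ≤ ‖deriv g u‖ := by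
  have h1 := (hasDerivAt_iff_tendsto_slope.1 hf.hasDerivAt).norm
  have h2 := (hasDerivAt_iff_tendsto_slope.1 hg.hasDerivAt).norm
  refine le_of_tendsto_of_tendsto' h1 h2 fun x => ?_
  simp only [slope, vsub_eq_sub, norm_smul]
  exact mul_le_mul_of_nonneg_left (h x) (norm_nonneg _)

lemma clamp_lipschitz {K : NNReal} {γ : ℝ → Plane} (hγ : LipschitzWith K γ) (x₀ x₁ y₀ y₁ : ℝ) :
    LipschitzWith K (clamp x₀ x₁ y₀ y₁ ∘ γ) := by
  refine LipschitzWith.of_dist_le_mul fun a b => ?_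
  rw [dist_eq_norm]
  refine (norm_clamp_sub_le _ _ _ _ _ _).trans ?_
  rw [← dist_eq_norm]
  exact hγ.dist_le_mul a b

lemma clamp_of_mem {x₀ x₁ y₀ y₁ : ℝ} {p : Plane} (h1 : x₀ ≤ p 0) (h2 : p 0 ≤ x₁) (h3 : y₀ ≤ p 1)
    (h4 : p 1 ≤ y₁) : clamp x₀ x₁ y₀ y₁ p = p := by
  apply plane_ext <;> simp [clamp, *]

/-- Clamping to a box that contains the rectangle does not increase the weight. -/
lemma weight_clamp_le {α W x₀ x₁ y₀ y₁ : ℝ} (hx₀ : x₀ ≤ 0) (hx₁ : W ≤ x₁) (hy₀ : y₀ ≤ -1)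
    (hy₁ : 0 ≤ y₁) (p : Plane) :
    weight α W (clamp x₀ x₁ y₀ y₁ p) ≤ weight α W p := by
  by_cases hp : p ∈ rect W
  · obtain ⟨h1, h2, h3, h4⟩ := hp
    rw [clamp_of_mem (hx₀.trans h1) (h2.trans hx₁) (hy₀.trans h3) (h4.trans hy₁)]
  · rw [weight_of_notMem hp]
    -- A coordinate strictly inside the range of the box was not changed by clamping, so only points
    -- of the rectangle are clamped into the open rectangle.
    have : clamp x₀ x₁ y₀ y₁ p ∉ openRect W := by
      rintro ⟨h1, h2, h3, h4⟩
      simp only [clamp, pt_zero, pt_one, max_lt_iff, lt_max_iff, lt_min_iff, min_lt_iff] at h1 h2 h3 h4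
      apply hp
      refine ⟨?_, ?_, ?_, ?_⟩ <;> by_contra! <;> grind
    by_cases h' : clamp x₀ x₁ y₀ y₁ p ∈ rect W
    · rw [weight_of_boundary this h']; exact min_le_left _ _
    · rw [weight_of_notMem h']

lemma cost_clamp_le {α W x₀ x₁ y₀ y₁ : ℝ} (hα : 0 < α) (hx₀ : x₀ ≤ 0) (hx₁ : W ≤ x₁) (hy₀ : y₀ ≤ -1)
    (hy₁ : 0 ≤ y₁) {K : NNReal} {γ : ℝ → Plane} (hγ : LipschitzWith K γ) {a b : ℝ} (hab : a ≤ b) :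
    cost α W (clamp x₀ x₁ y₀ y₁ ∘ γ) a b ≤ cost α W γ a b := by
  have hc := clamp_lipschitz hγ x₀ x₁ y₀ y₁
  refine intervalIntegral.integral_mono_ae hab (cost_integrable hα hc a b)
    (cost_integrable hα hγ a b) ?_
  filter_upwards [hγ.ae_differentiableAt_real, hc.ae_differentiableAt_real] with u h1 h2
  exact mul_le_mul (weight_clamp_le hx₀ hx₁ hy₀ hy₁ _)
    (norm_deriv_le_of_norm_sub_le (fun x => norm_clamp_sub_le _ _ _ _ _ _) h2 h1)
    (norm_nonneg _) (weight_nonneg hα W _)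

/-! ### Extending a path to the real line -/

/-- Paths are only controlled on `[0,1]`. The extension by constants is Lipschitz on the whole line,
so that Rademacher's theorem and derivative bounds apply everywhere; it agrees with the path near
every time in `(0,1)`, hence has the same derivative there. -/
lemma exists_lipschitz_extension {α W : ℝ} {γ : ℝ → Plane} {s t : Plane} (h : IsPath γ s t) :
    ∃ (K : NNReal) (γ' : ℝ → Plane), LipschitzWith K γ' ∧ γ' 0 = s ∧ γ' 1 = t ∧
      weightedLength α W γ = cost α W γ' 0 1 := by
  obtain ⟨⟨K, hK⟩, h0, h1⟩ := h
  have hz : (0 : ℝ) ≤ 1 := zero_le_one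
  refine ⟨K, Set.IccExtend hz (Set.domRestrict (Icc 0 1) γ), ?_, ?_, ?_, ?_⟩
  · have := (LipschitzOnWith.to_restrict hK).comp (LipschitzWith.projIcc hz)
    simpa [Set.IccExtend] using this
  · rw [IccExtend_of_mem _ _ (left_mem_Icc.2 hz)]; exact h0
  · rw [IccExtend_of_mem _ _ (right_mem_Icc.2 hz)]; exact h1
  · refine intervalIntegral.integral_congr_ae ?_
    have : ∀ᵐ u : ℝ, u ≠ 1 := by simp [ae_iff]
    filter_upwards [this] with u hu hmem
    rw [uIoc_of_le hz] at hmem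
    have hI : u ∈ Ioo (0 : ℝ) 1 := ⟨hmem.1, lt_of_le_of_ne hmem.2 hu⟩
    have he : γ =ᶠ[𝓝 u] Set.IccExtend hz (Set.domRestrict (Icc 0 1) γ) := by
      filter_upwards [isOpen_Ioo.mem_nhds hI] with x hx
      rw [IccExtend_of_mem _ _ (Ioo_subset_Icc_self hx)]; rfl
    rw [he.deriv_eq, he.eq_of_nhds]

end WeightedRectangle
end

noncomputable section

namespace WeightedRectangle

open MeasureTheory Filter Topology

/-! ### Distances inside the rectangle -/

/-- The cost of a displacement `(D, y)` if horizontal motion is possible at unit cost, and any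
motion at cost `α`. -/
def slabNorm (α D y : ℝ) : ℝ :=
  if y ≤ √(α ^ 2 - 1) * D then D + √(α ^ 2 - 1) * y else α * √(D ^ 2 + y ^ 2)

/-- The cost of a displacement `(D, y)` if horizontal and vertical motion are possible at unit cost,
and any motion at cost `α`. -/
def boxNorm (α D y : ℝ) : ℝ :=
  if D ≤ √(α ^ 2 - 1) * y then √(α ^ 2 - 1) * D + y else slabNorm α D y

/-! ### Support functions of truncated discs -/

section norms

variable {α D y : ℝ}

lemma crit_sq (hα : 1 < α) : √(α ^ 2 - 1) ^ 2 = α ^ 2 - 1 := Real.sq_sqrt (by nlinarith)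

lemma crit_pos (hα : 1 < α) : 0 < √(α ^ 2 - 1) := Real.sqrt_pos.2 (by nlinarith)

lemma sq_lt_two (h0 : 0 < α) (h2 : α < √2) : α ^ 2 < 2 := by
  have := Real.sq_sqrt (show (0 : ℝ) ≤ 2 by norm_num)
  nlinarith [Real.sqrt_nonneg 2]

lemma crit_lt_one (hα : 1 < α) (h2 : α < √2) : √(α ^ 2 - 1) < 1 := by
  have := sq_lt_two (by linarith) h2
  rw [Real.sqrt_lt' one_pos]; linarith

/-- Equality case of the Cauchy–Schwarz inequality: `(a, b)` is the point of the circle of radius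
`α` in the direction `(D, y)`. -/
lemma exists_direction (hα : 0 < α) (hD : 0 ≤ D) (hy : 0 ≤ y) (h : 0 < D ∨ 0 < y) :
    ∃ a b : ℝ, 0 ≤ a ∧ 0 ≤ b ∧ a ^ 2 + b ^ 2 = α ^ 2 ∧ α * √(D ^ 2 + y ^ 2) = a * D + b * y ∧
      a * y = b * D := by
  set r := √(D ^ 2 + y ^ 2) with hr
  have hrr : r ^ 2 = D ^ 2 + y ^ 2 := Real.sq_sqrt (by positivity)
  have h0 : 0 < r := Real.sqrt_pos.2 (by rcases h with h | h <;> positivity)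
  refine ⟨α * D / r, α * y / r, by positivity, by positivity, ?_, ?_, ?_⟩
  · field_simp; rw [hrr]
  · field_simp; rw [hrr]
  · field_simp

/-- For nonnegative arguments, `slabNorm` is the support function of the disc of radius `α` cut off
at `a ≤ 1`; this is the maximizer, and `le_slabNorm` is the inequality. The maximizer is the corner
`(1, k)` for flat directions and the radial point of the circle for steep ones. -/
lemma slabNorm_attained (hα : 1 < α) (hD : 0 ≤ D) (hy : 0 ≤ y) :
    ∃ a b : ℝ, 0 ≤ a ∧ a ≤ 1 ∧ 0 ≤ b ∧ a ^ 2 + b ^ 2 ≤ α ^ 2 ∧ slabNorm α D y = a * D + b * y := by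
  have hk := crit_sq hα
  have hk0 := crit_pos hα
  unfold slabNorm
  set k := √(α ^ 2 - 1)
  split_ifs with h
  · exact ⟨1, k, by norm_num, le_rfl, hk0.le, by linarith, by ring⟩
  · push Not at h
    obtain ⟨a, b, ha, hb, hab, e, e'⟩ := exists_direction (α := α) (by linarith) hD hy
      (Or.inr (lt_of_le_of_lt (by positivity) h))
    refine ⟨a, b, ha, ?_, hb, hab.le, e⟩
    -- A point of the circle with `a > 1` has `b < k`, hence a slope below `k`, but the displacement
    -- is steeper than that.
    by_contra! h1
    have hbk : b < k := by nlinarith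
    rcases eq_or_lt_of_le hD with h0 | h0
    · have : a * y = 0 := by rw [e', ← h0]; ring
      have : 0 < y := by rw [← h0] at h; linarith
      nlinarith
    · nlinarith

/-- For flat directions, `h1` is the tangent inequality of the disc at the corner `(1, k)`. Since `1
+ k² = α²`, it reads `k (b - k) ≤ 1 - a`, and `y ≤ k D` turns it into the claim. For steep
directions the Cauchy–Schwarz inequality suffices. -/
lemma le_slabNorm (hα : 1 < α) (hD : 0 ≤ D) (hy : 0 ≤ y) {a b : ℝ} (ha : a ≤ 1)
    (hab : a ^ 2 + b ^ 2 ≤ α ^ 2) : a * D + b * y ≤ slabNorm α D y := by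
  have hk := crit_sq hα
  have hk0 := crit_pos hα
  unfold slabNorm
  set k := √(α ^ 2 - 1)
  split_ifs with h
  · have h1 : a + k * b ≤ α ^ 2 := by
      nlinarith [sq_nonneg (k * a - b), sq_nonneg (a + k * b - α ^ 2), sq_nonneg (a - 1),
        sq_nonneg (b - k)]
    have h2 : k * (b - k) ≤ 1 - a := by nlinarith
    have h3 : (b - k) * y ≤ (1 - a) * D := by
      rcases le_or_gt (b - k) 0 with h4 | h4
      · exact (mul_nonpos_of_nonpos_of_nonneg h4 hy).trans (mul_nonneg (by linarith) hD)
      · calc (b - k) * y ≤ (b - k) * (k * D) := mul_le_mul_of_nonneg_left h h4.le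
          _ = k * (b - k) * D := by ring
          _ ≤ _ := mul_le_mul_of_nonneg_right h2 hD
    linarith
  · have e : α * √(D ^ 2 + y ^ 2) = √(α ^ 2 * (D ^ 2 + y ^ 2)) := by
      rw [Real.sqrt_mul (by positivity), Real.sqrt_sq (by linarith)]
    rw [e]
    apply Real.le_sqrt_of_sq_le
    nlinarith [sq_nonneg (a * y - b * D), sq_nonneg D, sq_nonneg y]

/-- Now the disc is cut off at `a ≤ 1` and at `b ≤ 1`. As `α < √2`, we have `k < 1`, and the cuts
leave an arc between the corners `(1, k)` and `(k, 1)`: these two and the arc are the three kinds of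
maximizers. -/
lemma boxNorm_attained (hα : 1 < α) (h2 : α < √2) (hD : 0 ≤ D) (hy : 0 ≤ y) :
    ∃ a b : ℝ, 0 ≤ a ∧ a ≤ 1 ∧ 0 ≤ b ∧ b ≤ 1 ∧ a ^ 2 + b ^ 2 ≤ α ^ 2 ∧
      boxNorm α D y = a * D + b * y := by
  have hk := crit_sq hα
  have hk0 := crit_pos hα
  have hk1 := crit_lt_one hα h2
  unfold boxNorm slabNorm
  set k := √(α ^ 2 - 1)
  split_ifs with h h'
  · exact ⟨k, 1, hk0.le, hk1.le, by norm_num, le_rfl, by linarith, by ring⟩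
  · exact ⟨1, k, by norm_num, le_rfl, hk0.le, hk1.le, by linarith, by ring⟩
  · push Not at h h'
    obtain ⟨a, b, ha, hb, hab, e, e'⟩ := exists_direction (α := α) (by linarith) hD hy
      (Or.inr (lt_of_le_of_lt (by positivity) h'))
    have hD0 : 0 < D := lt_of_le_of_lt (by positivity) h
    have hy0 : 0 < y := lt_of_le_of_lt (by positivity) h'
    refine ⟨a, b, ha, ?_, hb, ?_, hab.le, e⟩
    · by_contra! h1
      have hbk : b < k := by nlinarith
      nlinarith
    · by_contra! h1
      have hbk : a < k := by nlinarith
      nlinarith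

lemma le_boxNorm (hα : 1 < α) (hD : 0 ≤ D) (hy : 0 ≤ y) {a b : ℝ} (ha : a ≤ 1) (hb : b ≤ 1)
    (hab : a ^ 2 + b ^ 2 ≤ α ^ 2) : a * D + b * y ≤ boxNorm α D y := by
  have hk := crit_sq hα
  have hk0 := crit_pos hα
  by_cases h : D ≤ √(α ^ 2 - 1) * y
  · rw [boxNorm, if_pos h]
    set k := √(α ^ 2 - 1)
    have h1 : b + k * a ≤ α ^ 2 := by
      nlinarith [sq_nonneg (k * b - a), sq_nonneg (b + k * a - α ^ 2), sq_nonneg (b - 1),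
        sq_nonneg (a - k)]
    have h2 : k * (a - k) ≤ 1 - b := by nlinarith
    have h3 : (a - k) * D ≤ (1 - b) * y := by
      rcases le_or_gt (a - k) 0 with h4 | h4
      · exact (mul_nonpos_of_nonpos_of_nonneg h4 hD).trans (mul_nonneg (by linarith) hy)
      · calc (a - k) * D ≤ (a - k) * (k * y) := mul_le_mul_of_nonneg_left h h4.le
          _ = k * (a - k) * y := by ring
          _ ≤ _ := mul_le_mul_of_nonneg_right h2 hy
    linarith
  · rw [boxNorm, if_neg h]
    exact le_slabNorm hα hD hy ha hab

lemma slabNorm_le (hα : 1 < α) (hD : 0 ≤ D) (hy : 0 ≤ y) : slabNorm α D y ≤ α * √(D ^ 2 + y ^ 2) := by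
  obtain ⟨a, b, -, -, -, hab, e⟩ := slabNorm_attained hα hD hy
  rw [e, show α * √(D ^ 2 + y ^ 2) = √(α ^ 2 * (D ^ 2 + y ^ 2)) by
    rw [Real.sqrt_mul (by positivity), Real.sqrt_sq (by linarith)]]
  apply Real.le_sqrt_of_sq_le
  nlinarith [sq_nonneg (a * y - b * D), sq_nonneg D, sq_nonneg y]

lemma boxNorm_le_slabNorm (hα : 1 < α) (h2 : α < √2) (hD : 0 ≤ D) (hy : 0 ≤ y) :
    boxNorm α D y ≤ slabNorm α D y := by
  obtain ⟨a, b, -, ha, -, -, hab, e⟩ := boxNorm_attained hα h2 hD hy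
  rw [e]; exact le_slabNorm hα hD hy ha hab

lemma slabNorm_mono (hα : 1 < α) {D' : ℝ} (hD : 0 ≤ D) (hDD : D ≤ D') (hy : 0 ≤ y) :
    slabNorm α D y ≤ slabNorm α D' y := by
  obtain ⟨a, b, h0, ha, -, hab, e⟩ := slabNorm_attained hα hD hy
  rw [e]
  exact le_trans (by nlinarith) (le_slabNorm hα (hD.trans hDD) hy ha hab)

lemma boxNorm_mono (hα : 1 < α) (h2 : α < √2) {D' : ℝ} (hD : 0 ≤ D) (hDD : D ≤ D') (hy : 0 ≤ y) :
    boxNorm α D y ≤ boxNorm α D' y := by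
  obtain ⟨a, b, h0, ha, -, hb, hab, e⟩ := boxNorm_attained hα h2 hD hy
  rw [e]
  exact le_trans (by nlinarith) (le_boxNorm hα (hD.trans hDD) hy ha hb hab)

/-- With `|D|` in place of `D`, the two branches agree on the whole interface `y = k |D|`: both are
`α² |D|`. -/
lemma slabNorm_continuous (hα : 1 < α) : Continuous fun p : ℝ × ℝ => slabNorm α |p.1| p.2 := by
  have hk := crit_sq hα
  have hk0 := crit_pos hα
  unfold slabNorm
  set k := √(α ^ 2 - 1)
  refine Continuous.if_le (by fun_prop) (by fun_prop) (by fun_prop) (by fun_prop) ?_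
  intro p hp
  rw [hp, show |p.1| ^ 2 + (k * |p.1|) ^ 2 = (α * |p.1|) ^ 2 by rw [mul_pow, hk]; ring,
    Real.sqrt_sq (by positivity)]
  linear_combination |p.1| * hk

lemma boxNorm_continuous (hα : 1 < α) (h2 : α < √2) :
    Continuous fun p : ℝ × ℝ => boxNorm α |p.1| |p.2| := by
  have hk := crit_sq hα
  have hk0 := crit_pos hα
  have hk1 := crit_lt_one hα h2
  have hs : Continuous fun p : ℝ × ℝ => slabNorm α |p.1| |p.2| :=
    (slabNorm_continuous hα).comp (continuous_fst.prodMk (continuous_abs.comp continuous_snd))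
  unfold boxNorm
  refine Continuous.if_le (by fun_prop) hs (by fun_prop) (by fun_prop) ?_
  intro p hp
  unfold slabNorm
  set k := √(α ^ 2 - 1)
  have e : α * √(|p.1| ^ 2 + |p.2| ^ 2) = k * |p.1| + |p.2| := by
    rw [hp, show (k * |p.2|) ^ 2 + |p.2| ^ 2 = (α * |p.2|) ^ 2 by rw [mul_pow, hk]; ring,
      Real.sqrt_sq (by positivity)]
    linear_combination (-|p.2|) * hk
  split_ifs with h
  -- On the interface `|D| = k |y|`, the first branch of `slabNorm` would require `|y| ≤ k² |y|`
  -- with `k < 1`.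
  · have h0 : |p.2| = 0 := by
      rw [hp] at h
      have := abs_nonneg p.2
      by_contra h'
      have : 0 < |p.2| := lt_of_le_of_ne this (Ne.symm h')
      have : k * (k * |p.2|) < |p.2| := by
        rw [← mul_assoc]
        exact mul_lt_of_lt_one_left this (by nlinarith)
      linarith
    rw [hp, h0]; ring
  · exact e.symm

end norms

/-- The weighted distance from the point `(sx, 0)` to the point `(x, y)` inside the rectangle. -/
def innerDist (α W sx x y : ℝ) : ℝ :=
  if α ≤ 1 then α * √((sx - x) ^ 2 + y ^ 2) else
    min (slabNorm α |sx - x| (-y)) (min (boxNorm α (sx + x) (-y)) (boxNorm α (2 * W - sx - x) (-y)))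

/-- The points where a path that stays in the bounding box of the rectangle and its endpoint
`(tx, ty)` can leave the rectangle for the last time. -/
def IsExit (W tx ty x y : ℝ) : Prop :=
  (pt tx ty ∈ rect W ∧ x = tx ∧ y = ty) ∨
    (pt tx ty ∉ rect W ∧ 0 ≤ x ∧ x ≤ W ∧ -1 ≤ y ∧ y ≤ 0 ∧
      ((x = 0 ∧ tx < 0) ∨ (y = -1 ∧ ty < -1) ∨ (y = 0 ∧ 0 < ty)))

/-! ### Lower bounds for the weighted length: calibrations and the last exit -/

section lower_bound

variable {α W : ℝ} {K : NNReal} {γ : ℝ → Plane}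

/-- In the open rectangle this is the Cauchy–Schwarz inequality with weight `α`. At a time on a
side, the coordinate normal to the side has a local extremum because the path stays in the
rectangle; so the normal velocity vanishes, and only the tangential component of the covector has to
be at most one. The bound on `q` matters on vertical sides only, so it may be dropped if they are
never touched. -/
lemma linear_le_cost_of_rect (hα : 1 < α) (hγ : LipschitzWith K γ) {a b p q : ℝ} (hab : a ≤ b)
    (hR : ∀ u ∈ Icc a b, γ u ∈ rect W) (hp : |p| ≤ 1) (hpq : p ^ 2 + q ^ 2 ≤ α ^ 2)
    (hq : |q| ≤ 1 ∨ ∀ u ∈ Icc a b, γ u 0 ≠ 0 ∧ γ u 0 ≠ W) :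
    p * (γ b 0 - γ a 0) + q * (γ b 1 - γ a 1) ≤ cost α W γ a b := by
  refine linear_le_cost (by linarith) hγ hab p q fun u hu hd => ?_
  by_cases ho : γ u ∈ openRect W
  · rw [weight_of_mem_openRect ho]
    exact linear_le p q α (by linarith) hpq _
  · rw [weight_of_one_le hα.le ho, one_mul]
    have hd' := hd.hasDerivAt
    set v := deriv γ u
    have hn : Icc a b ∈ 𝓝 u := Icc_mem_nhds hu.1 hu.2
    have hmin : ∀ (i : Fin 2) (c : ℝ), γ u i = c → (∀ x ∈ Icc a b, c ≤ γ x i) → v i = 0 := by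
      intro i c hc hm
      have : IsLocalMin (fun x => γ x i) u := by
        filter_upwards [hn] with x hx
        rw [hc]; exact hm x hx
      exact this.hasDerivAt_eq_zero (hasDerivAt_coord hd' i)
    have hmax : ∀ (i : Fin 2) (c : ℝ), γ u i = c → (∀ x ∈ Icc a b, γ x i ≤ c) → v i = 0 := by
      intro i c hc hm
      have : IsLocalMax (fun x => γ x i) u := by
        filter_upwards [hn] with x hx
        rw [hc]; exact hm x hx
      exact this.hasDerivAt_eq_zero (hasDerivAt_coord hd' i)
    have hone : ∀ (c : ℝ) (i : Fin 2), |c| ≤ 1 → c * v i ≤ ‖v‖ := by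
      intro c i hc
      calc c * v i ≤ |c * v i| := le_abs_self _
        _ = |c| * |v i| := abs_mul _ _
        _ ≤ 1 * ‖v‖ := mul_le_mul hc (abs_coord_le v i) (abs_nonneg _) zero_le_one
        _ = ‖v‖ := one_mul _
    have huI := Ioo_subset_Icc_self hu
    have hvert : v 0 = 0 → |q| ≤ 1 → p * v 0 + q * v 1 ≤ ‖v‖ := by
      intro h0 h1; rw [h0, mul_zero, zero_add]; exact hone q 1 h1
    have hhor : v 1 = 0 → p * v 0 + q * v 1 ≤ ‖v‖ := by
      intro h0; rw [h0, mul_zero, add_zero]; exact hone p 0 hp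
    obtain ⟨r1, r2, r3, r4⟩ := hR u huI
    by_cases e1 : γ u 0 = 0
    · rcases hq with hq | hq
      · exact hvert (hmin 0 0 e1 fun x hx => (hR x hx).1) hq
      · exact absurd e1 (hq u huI).1
    by_cases e2 : γ u 0 = W
    · rcases hq with hq | hq
      · exact hvert (hmax 0 W e2 fun x hx => (hR x hx).2.1) hq
      · exact absurd e2 (hq u huI).2
    by_cases e3 : γ u 1 = -1
    · exact hhor (hmin 1 (-1) e3 fun x hx => (hR x hx).2.2.1)
    by_cases e4 : γ u 1 = 0
    · exact hhor (hmax 1 0 e4 fun x hx => (hR x hx).2.2.2)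
    exact absurd ⟨lt_of_le_of_ne r1 (Ne.symm e1), lt_of_le_of_ne r2 e2,
      lt_of_le_of_ne r3 (Ne.symm e3), lt_of_le_of_ne r4 e4⟩ ho

/-- If a vertical side is touched, split the path at such a time and flip the sign of the horizontal
component there: this calibrates the path unfolded across that side, whose horizontal displacement
is `sx + x` or `2 W - sx - x`. If none is touched, the vertical component is unconstrained apart
from the disc, which gives the larger bound `slabNorm`. -/
lemma innerDist_le_cost (hα : 1 < α) (h2 : α < √2) (hγ : LipschitzWith K γ) {τ sx x y : ℝ}
    (hτ : 0 ≤ τ) (hR : ∀ u ∈ Icc 0 τ, γ u ∈ rect W) (h0 : γ 0 = pt sx 0) (h1 : γ τ = pt x y) :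
    innerDist α W sx x y ≤ cost α W γ 0 τ := by
  rw [innerDist, if_neg (by linarith)]
  have e00 : γ 0 0 = sx := by rw [h0]; simp
  have e01 : γ 0 1 = 0 := by rw [h0]; simp
  have e10 : γ τ 0 = x := by rw [h1]; simp
  have e11 : γ τ 1 = y := by rw [h1]; simp
  obtain ⟨s1, s2, -, -⟩ := hR 0 (left_mem_Icc.2 hτ)
  obtain ⟨t1, t2, t3, t4⟩ := hR τ (right_mem_Icc.2 hτ)
  rw [e00] at s1 s2
  rw [e10] at t1 t2
  rw [e11] at t3 t4
  by_cases hL : ∃ v ∈ Icc 0 τ, γ v 0 = 0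
  · obtain ⟨v, hv, hv0⟩ := hL
    refine (min_le_right _ _).trans ((min_le_left _ _).trans ?_)
    obtain ⟨a, b, ha0, ha, hb0, hb, hab, e⟩ := boxNorm_attained (D := sx + x) (y := -y) hα h2
      (by linarith) (by linarith)
    -- The signs are such that the horizontal terms `a * sx` before the touching time and `a * x`
    -- after it add up, while the vertical terms telescope.
    have c1 := linear_le_cost_of_rect (W := W) (p := -a) (q := -b) hα hγ hv.1
      (fun u hu => hR u ⟨hu.1, hu.2.trans hv.2⟩) (by rwa [abs_neg, abs_of_nonneg ha0])
      (by simpa using hab) (Or.inl (by rwa [abs_neg, abs_of_nonneg hb0]))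
    have c2 := linear_le_cost_of_rect (W := W) (p := a) (q := -b) hα hγ hv.2
      (fun u hu => hR u ⟨hv.1.trans hu.1, hu.2⟩) (by rwa [abs_of_nonneg ha0])
      (by simpa using hab) (Or.inl (by rwa [abs_neg, abs_of_nonneg hb0]))
    rw [e, ← cost_add (by linarith) hγ 0 v τ]
    rw [hv0, e00, e01] at c1
    rw [hv0, e10, e11] at c2
    linarith
  by_cases hW : ∃ v ∈ Icc 0 τ, γ v 0 = W
  · obtain ⟨v, hv, hv0⟩ := hW
    refine (min_le_right _ _).trans ((min_le_right _ _).trans ?_)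
    obtain ⟨a, b, ha0, ha, hb0, hb, hab, e⟩ := boxNorm_attained (D := 2 * W - sx - x) (y := -y)
      hα h2 (by linarith) (by linarith)
    have c1 := linear_le_cost_of_rect (W := W) (p := a) (q := -b) hα hγ hv.1
      (fun u hu => hR u ⟨hu.1, hu.2.trans hv.2⟩) (by rwa [abs_of_nonneg ha0])
      (by simpa using hab) (Or.inl (by rwa [abs_neg, abs_of_nonneg hb0]))
    have c2 := linear_le_cost_of_rect (W := W) (p := -a) (q := -b) hα hγ hv.2
      (fun u hu => hR u ⟨hv.1.trans hu.1, hu.2⟩) (by rwa [abs_neg, abs_of_nonneg ha0])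
      (by simpa using hab) (Or.inl (by rwa [abs_neg, abs_of_nonneg hb0]))
    rw [e, ← cost_add (by linarith) hγ 0 v τ]
    rw [hv0, e00, e01] at c1
    rw [hv0, e10, e11] at c2
    linarith
  · push Not at hL hW
    refine (min_le_left _ _).trans ?_
    obtain ⟨a, b, ha0, ha, hb0, hab, e⟩ := slabNorm_attained (D := |sx - x|) (y := -y) hα
      (abs_nonneg _) (by linarith)
    have ht : ∀ u ∈ Icc 0 τ, γ u 0 ≠ 0 ∧ γ u 0 ≠ W := fun u hu => ⟨hL u hu, hW u hu⟩
    rw [e]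
    rcases le_total 0 (sx - x) with h | h
    · have c := linear_le_cost_of_rect (W := W) (p := -a) (q := -b) hα hγ hτ hR
        (by rwa [abs_neg, abs_of_nonneg ha0]) (by simpa using hab) (Or.inr ht)
      rw [e00, e01, e10, e11] at c
      rw [abs_of_nonneg h]
      linarith
    · have c := linear_le_cost_of_rect (W := W) (p := a) (q := -b) hα hγ hτ hR
        (by rwa [abs_of_nonneg ha0]) (by simpa using hab) (Or.inr ht)
      rw [e00, e01, e10, e11] at c
      rw [abs_of_nonpos h]
      linarith

lemma mem_rect_clamp (hW : 0 ≤ W) (p : Plane) : clamp 0 W (-1) 0 p ∈ rect W := by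
  refine ⟨?_, ?_, ?_, ?_⟩ <;> simp [clamp, hW]

/-- Every path is at least as long as some path that leaves the rectangle for the last time at an
exit point, and is as short as possible before and after it. -/
theorem exists_exit_le_weightedLength {sx tx ty : ℝ} (hα : 0 < α) (h2 : α < √2) (hW : 0 < W)
    (hs0 : 0 ≤ sx) (hsW : sx ≤ W) (htW : tx ≤ W) {δ : ℝ → Plane}
    (hδ : IsPath δ (pt sx 0) (pt tx ty)) :
    ∃ x y, IsExit W tx ty x y ∧
      innerDist α W sx x y + √((tx - x) ^ 2 + (ty - y) ^ 2) ≤ weightedLength α W δ := by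
  obtain ⟨K, γ₀, hγ₀, g0, g1, hlen⟩ := exists_lipschitz_extension (α := α) (W := W) hδ
  -- This box extends beyond a side of the rectangle only where the target lies beyond it, so the
  -- path cannot pass through any other side. The right side is covered by `tx ≤ W`.
  set γ := clamp (min 0 tx) W (min (-1) ty) (max 0 ty) ∘ γ₀ with hγdef
  have hγ : LipschitzWith K γ := clamp_lipschitz hγ₀ _ _ _ _
  have hγ0 : γ 0 = pt sx 0 := by
    rw [hγdef, Function.comp, g0]
    exact clamp_of_mem (by simp [hs0]) (by simpa using hsW) (by simp) (by simp)
  have hγ1 : γ 1 = pt tx ty := by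
    rw [hγdef, Function.comp, g1]
    exact clamp_of_mem (by simp) (by simpa using htW) (by simp) (by simp)
  have hle : cost α W γ 0 1 ≤ weightedLength α W δ := by
    rw [hlen]
    exact cost_clamp_le hα (min_le_left _ _) le_rfl (min_le_left _ _) (le_max_left _ _) hγ₀
      zero_le_one
  have hcomp : IsCompact (Icc (0 : ℝ) 1 ∩ γ ⁻¹' rect W) :=
    isCompact_Icc.inter_right ((isClosed_rect W).preimage hγ.continuous)
  have hne : (Icc (0 : ℝ) 1 ∩ γ ⁻¹' rect W).Nonempty := by
    refine ⟨0, left_mem_Icc.2 zero_le_one, ?_⟩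
    rw [mem_preimage, hγ0]
    exact ⟨by simpa using hs0, by simpa using hsW, by simp, by simp⟩
  -- `τ` is the last time in the rectangle.
  obtain ⟨τ, ⟨⟨hτ0, hτ1⟩, hτR⟩, hτmax⟩ := hcomp.exists_isGreatest hne
  have hafter : ∀ u ∈ Ioc τ 1, γ u ∉ rect W := fun u hu hmem =>
    absurd (hτmax ⟨⟨hτ0.trans hu.1.le, hu.2⟩, hmem⟩) (not_le.2 hu.1)
  have hbefore : innerDist α W sx (γ τ 0) (γ τ 1) ≤ cost α W γ 0 τ := by
    rcases le_or_gt α 1 with h1 | h1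
    · rw [innerDist, if_pos h1]
      have := mul_norm_le_cost (W := W) hα hγ hτ0 hα.le
        (fun u _ => by simpa [h1] using min_le_weight α W (γ u))
      rw [hγ0, pt_zero, pt_one] at this
      convert this using 3
      ring
    -- Before `τ` the path may leave the rectangle; clamping it to the rectangle itself is not more
    -- expensive and makes the calibration applicable.
    · refine le_trans ?_ (cost_clamp_le (W := W) hα (le_refl 0) le_rfl (le_refl (-1)) (le_refl 0)
        hγ hτ0)
      refine innerDist_le_cost h1 h2 (clamp_lipschitz hγ _ _ _ _) hτ0
        (fun u _ => mem_rect_clamp hW.le _) ?_ ?_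
      · rw [Function.comp, hγ0]
        exact clamp_of_mem (by simpa using hs0) (by simpa using hsW) (by simp) (by simp)
      · obtain ⟨a1, a2, a3, a4⟩ := hτR
        rw [Function.comp, clamp_of_mem a1 a2 a3 a4, pt_eta]
  have hlast : √((tx - γ τ 0) ^ 2 + (ty - γ τ 1) ^ 2) ≤ cost α W γ τ 1 := by
    have := mul_norm_le_cost (W := W) (m := 1) hα hγ hτ1 zero_le_one
      (fun u hu => (weight_of_notMem (hafter u ⟨hu.1, hu.2.le⟩)).ge)
    rwa [hγ1, pt_zero, pt_one, one_mul] at this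
  refine ⟨γ τ 0, γ τ 1, ?_, ?_⟩
  · by_cases ht : pt tx ty ∈ rect W
    · have : τ = 1 := le_antisymm hτ1 (hτmax ⟨⟨zero_le_one, le_rfl⟩, by rwa [mem_preimage, hγ1]⟩)
      left
      rw [this, hγ1]
      exact ⟨ht, by simp, by simp⟩
    · right
      obtain ⟨a1, a2, a3, a4⟩ := hτR
      refine ⟨ht, a1, a2, a3, a4, ?_⟩
      have hτ1' : τ < 1 := lt_of_le_of_ne hτ1 (by
        rintro rfl
        apply ht
        rw [← hγ1]
        exact ⟨a1, a2, a3, a4⟩)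
      -- At a point that is not on a side facing the target, continuity on the facing sides and the
      -- box on the others keep the path in the rectangle for a short time after `τ`.
      by_contra hcon
      push Not at hcon
      obtain ⟨n1, n2, n3⟩ := hcon
      have hcont : ∀ i, Tendsto (fun u => γ u i) (𝓝[>] τ) (𝓝 (γ τ i)) := fun i =>
        (((continuous_coord i).comp hγ.continuous).tendsto τ).mono_left nhdsWithin_le_nhds
      have b1 : ∀ᶠ u in 𝓝[>] τ, 0 ≤ γ u 0 := by
        rcases lt_or_ge tx 0 with h | h
        · have : 0 < γ τ 0 := lt_of_le_of_ne a1 fun e => absurd h (not_lt.2 (n1 e.symm))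
          exact ((hcont 0).eventually_const_lt this).mono fun _ h => h.le
        · refine Eventually.of_forall fun u => ?_
          simp [hγdef, clamp, h]
      have b2 : ∀ u, γ u 0 ≤ W := fun u => by simp [hγdef, clamp, hW.le]
      have b3 : ∀ᶠ u in 𝓝[>] τ, -1 ≤ γ u 1 := by
        rcases lt_or_ge ty (-1) with h | h
        · have : -1 < γ τ 1 := lt_of_le_of_ne a3 fun e => absurd h (not_lt.2 (n2 e.symm))
          exact ((hcont 1).eventually_const_lt this).mono fun _ h => h.le
        · refine Eventually.of_forall fun u => ?_
          simp [hγdef, clamp, h]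
      have b4 : ∀ᶠ u in 𝓝[>] τ, γ u 1 ≤ 0 := by
        rcases lt_or_ge 0 ty with h | h
        · have : γ τ 1 < 0 := lt_of_le_of_ne a4 fun e => absurd h (not_lt.2 (n3 e))
          exact ((hcont 1).eventually_lt_const this).mono fun _ h => h.le
        · refine Eventually.of_forall fun u => ?_
          simp [hγdef, clamp, h]
      obtain ⟨u, ⟨⟨⟨c1, c3⟩, c4⟩, c5⟩⟩ :=
        (((b1.and b3).and b4).and (Ioc_mem_nhdsGT hτ1')).exists
      exact hafter u c5 ⟨c1, b2 u, c3, c4⟩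
  · rw [← cost_add hα hγ 0 τ 1] at hle
    linarith

/-- The Euclidean length is a lower bound if no weight is below one. -/
lemma dist_le_weightedLength (hα : 1 ≤ α) {x₀ y₀ x₁ y₁ : ℝ} {δ : ℝ → Plane}
    (hδ : IsPath δ (pt x₀ y₀) (pt x₁ y₁)) :
    √((x₁ - x₀) ^ 2 + (y₁ - y₀) ^ 2) ≤ weightedLength α W δ := by
  obtain ⟨K, γ, hγ, g0, g1, hlen⟩ := exists_lipschitz_extension (α := α) (W := W) hδ
  have := mul_norm_le_cost (W := W) (α := α) (m := 1) (by linarith) hγ zero_le_one zero_le_one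
    (fun u _ => by simpa [hα] using min_le_weight α W (γ u))
  rwa [g0, g1, pt_zero, pt_one, pt_zero, pt_one, one_mul, ← hlen] at this

end lower_bound

end WeightedRectangle
end

noncomputable section

namespace WeightedRectangle

open MeasureTheory Filter Topology

/-! ### Polygonal chains -/

lemma chain_zero (p : Plane) (l : List Plane) : chain p l 0 = p := by
  cases l <;> simp [chain]

lemma chain_one (p : Plane) (l : List Plane) : chain p l 1 = (p :: l).getLast (by simp) := by
  induction l generalizing p with
  | nil => simp [chain]
  | cons q l ih =>
    have h : ¬ ((1 : ℝ) ≤ 1 / 2) := by norm_num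
    rw [chain, if_neg h, show (2 : ℝ) * 1 - 1 = 1 by norm_num, ih]
    simp

lemma LipschitzOnWith.glue {E : Type*} [PseudoMetricSpace E] {f : ℝ → E} {K : NNReal} {a b c : ℝ}
    (h1 : LipschitzOnWith K f (Icc a b)) (h2 : LipschitzOnWith K f (Icc b c)) :
    LipschitzOnWith K f (Icc a c) := by
  have key : ∀ x ∈ Icc a c, ∀ y ∈ Icc a c, x ≤ y → dist (f x) (f y) ≤ K * dist x y := by
    intro x hx y hy hxy
    rcases le_total y b with hy' | hy'
    · exact h1.dist_le_mul x ⟨hx.1, hxy.trans hy'⟩ y ⟨hy.1, hy'⟩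
    rcases le_total b x with hx' | hx'
    · exact h2.dist_le_mul x ⟨hx', hx.2⟩ y ⟨hy', hy.2⟩
    · have e1 := h1.dist_le_mul x ⟨hx.1, hx'⟩ b ⟨hx.1.trans hx', le_rfl⟩
      have e2 := h2.dist_le_mul b ⟨le_rfl, hy'.trans hy.2⟩ y ⟨hy', hy.2⟩
      have e3 := dist_triangle (f x) (f b) (f y)
      have e4 : dist x y = dist x b + dist b y := by
        rw [Real.dist_eq, Real.dist_eq, Real.dist_eq, abs_of_nonpos, abs_of_nonpos, abs_of_nonpos] <;>
        linarith
      rw [e4, mul_add]; linarith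
  refine LipschitzOnWith.of_dist_le_mul fun x hx y hy => ?_
  rcases le_total x y with h | h
  · exact key x hx y hy h
  · rw [dist_comm, dist_comm x y]; exact key y hy x hx h

lemma chain_lipschitz (p : Plane) (l : List Plane) :
    ∃ K : NNReal, LipschitzOnWith K (chain p l) (Icc 0 1) := by
  induction l generalizing p with
  | nil => exact ⟨0, (LipschitzWith.const p).lipschitzOnWith⟩
  | cons q l ih =>
    obtain ⟨K, hK⟩ := ih q
    set K' : NNReal := 2 * (nndist p q + K) with hK'
    refine ⟨K', LipschitzOnWith.glue (b := 1 / 2) ?_ ?_⟩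
    · refine LipschitzOnWith.of_dist_le_mul fun x hx y hy => ?_
      rw [chain, if_pos hx.2, chain, if_pos hy.2, dist_lineMap_lineMap]
      have : dist (2 * x) (2 * y) = 2 * dist x y := by
        rw [Real.dist_eq, Real.dist_eq, ← mul_sub, abs_mul, abs_two]
      rw [this]
      have h1 : (K' : ℝ) = 2 * (dist p q + K) := by rw [hK']; push_cast; rfl
      rw [h1]
      nlinarith [mul_nonneg (NNReal.coe_nonneg K) (dist_nonneg (x := x) (y := y))]
    · have hval : ∀ x ∈ Icc (1 / 2 : ℝ) 1, chain p (q :: l) x = chain q l (2 * x - 1) := by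
        intro x hx
        rw [chain]
        split_ifs with h
        · have : x = 1 / 2 := le_antisymm h hx.1
          subst this
          rw [show (2 : ℝ) * (1 / 2) - 1 = 0 by norm_num, chain_zero]
          norm_num
        · rfl
      refine LipschitzOnWith.of_dist_le_mul fun x hx y hy => ?_
      rw [hval x hx, hval y hy]
      refine (hK.dist_le_mul _ ⟨by linarith [hx.1], by linarith [hx.2]⟩ _
        ⟨by linarith [hy.1], by linarith [hy.2]⟩).trans ?_
      have : dist (2 * x - 1) (2 * y - 1) = 2 * dist x y := by
        rw [Real.dist_eq, Real.dist_eq, show 2 * x - 1 - (2 * y - 1) = 2 * (x - y) by ring, abs_mul,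
          abs_two]
      rw [this]
      have h1 : (K' : ℝ) = 2 * (dist p q + K) := by rw [hK']; push_cast; rfl
      rw [h1]
      nlinarith [mul_nonneg (dist_nonneg (x := p) (y := q)) (dist_nonneg (x := x) (y := y))]

/-- The weighted length of the line segment from `p` to `q`. -/
def segCost (α W : ℝ) (p q : Plane) : ℝ :=
  ∫ u in (0 : ℝ)..1, weight α W (AffineMap.lineMap p q u) * ‖q - p‖

lemma isPath_integrable {α W : ℝ} (hα : 0 < α) {γ : ℝ → Plane} {K : NNReal}
    (h : LipschitzOnWith K γ (Icc 0 1)) :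
    IntervalIntegrable (fun u => weight α W (γ u) * ‖deriv γ u‖) volume 0 1 := by
  refine intervalIntegrable_of_continuous (K := K) hα ?_ ?_
  · rw [uIcc_of_le zero_le_one]; exact h.continuousOn
  · have : ∀ᵐ u : ℝ, u ≠ 1 := by simp [ae_iff]
    filter_upwards [this] with u hu hmem
    rw [uIoc_of_le zero_le_one] at hmem
    exact norm_deriv_le_of_lipschitzOn
      (Icc_mem_nhds hmem.1 (lt_of_le_of_ne hmem.2 hu)) h

lemma weightedLength_chain_nil (α W : ℝ) (p : Plane) : weightedLength α W (chain p []) = 0 := by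
  have : chain p [] = fun _ => p := by funext u; simp [chain]
  simp [weightedLength, this]

/-- Each half of the parameter interval is rescaled to `[0,1]`; the factor two in the speed cancels
the factor in the substitution. -/
lemma weightedLength_chain_cons {α : ℝ} (W : ℝ) (hα : 0 < α) (p q : Plane) (l : List Plane) :
    weightedLength α W (chain p (q :: l)) = segCost α W p q + weightedLength α W (chain q l) := by
  obtain ⟨K, hK⟩ := chain_lipschitz p (q :: l)
  have hint := isPath_integrable (W := W) hα hK
  have i1 := hint.mono_set (c := 0) (d := 1 / 2) (by
    rw [uIcc_of_le, uIcc_of_le] <;> [apply Icc_subset_Icc; skip; skip] <;> norm_num)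
  have i2 := hint.mono_set (c := 1 / 2) (d := 1) (by
    rw [uIcc_of_le, uIcc_of_le] <;> [apply Icc_subset_Icc; skip; skip] <;> norm_num)
  rw [weightedLength, ← intervalIntegral.integral_add_adjacent_intervals i1 i2]
  congr 1
  · have e1 : ∫ u in (0 : ℝ)..1 / 2, weight α W (chain p (q :: l) u) * ‖deriv (chain p (q :: l)) u‖ =
        ∫ u in (0 : ℝ)..1 / 2, (2 : ℝ) * (weight α W (AffineMap.lineMap p q (2 * u)) * ‖q - p‖) := by
      refine intervalIntegral.integral_congr_ae ?_
      have : ∀ᵐ u : ℝ, u ≠ 1 / 2 := by simp [ae_iff]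
      filter_upwards [this] with u hu hmem
      rw [uIoc_of_le (by norm_num)] at hmem
      have hlt : u < 1 / 2 := lt_of_le_of_ne hmem.2 hu
      have he : chain p (q :: l) =ᶠ[𝓝 u] fun x => AffineMap.lineMap p q (2 * x) := by
        filter_upwards [Iio_mem_nhds hlt] with x hx
        rw [chain, if_pos (le_of_lt hx)]
      have hd : HasDerivAt (fun x : ℝ => AffineMap.lineMap p q (2 * x)) ((2 : ℝ) • (q - p)) u := by
        have h1 : HasDerivAt (fun x : ℝ => 2 * x) 2 u := by
          simpa using (hasDerivAt_id u).const_mul (2 : ℝ)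
        have h2 : HasDerivAt (AffineMap.lineMap p q) (q - p) (2 * u) := AffineMap.hasDerivAt_lineMap
        exact HasDerivAt.scomp u h2 h1
      rw [he.deriv_eq, he.eq_of_nhds, hd.deriv, norm_smul, Real.norm_two]
      ring
    rw [e1, intervalIntegral.integral_const_mul, ← smul_eq_mul,
      intervalIntegral.smul_integral_comp_mul_left
        (fun u => weight α W (AffineMap.lineMap p q u) * ‖q - p‖)]
    norm_num [segCost]
  · have e1 : ∫ u in (1 / 2 : ℝ)..1, weight α W (chain p (q :: l) u) * ‖deriv (chain p (q :: l)) u‖ =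
        ∫ u in (1 / 2 : ℝ)..1, (2 : ℝ) * (weight α W (chain q l (2 * u - 1)) *
          ‖deriv (chain q l) (2 * u - 1)‖) := by
      refine intervalIntegral.integral_congr_ae (Eventually.of_forall fun u hmem => ?_)
      rw [uIoc_of_le (by norm_num)] at hmem
      have he : chain p (q :: l) =ᶠ[𝓝 u] fun x => chain q l (2 * x - 1) := by
        filter_upwards [Ioi_mem_nhds hmem.1] with x hx
        rw [chain, if_neg (not_le.2 hx)]
      have hd : deriv (fun x : ℝ => chain q l (2 * x - 1)) u =
          (2 : ℝ) • deriv (chain q l) (2 * u - 1) := by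
        -- The chain rule for an affine substitution holds for `deriv` without differentiability, so
        -- the corners of the remaining chain need no attention.
        rw [deriv_comp_mul_left (2 : ℝ) (fun y => chain q l (y - 1)) u, deriv_comp_sub_const]
      rw [he.deriv_eq, he.eq_of_nhds, hd, norm_smul, Real.norm_two]
      ring
    rw [e1, intervalIntegral.integral_const_mul, ← smul_eq_mul,
      intervalIntegral.smul_integral_comp_mul_sub
        (fun u => weight α W (chain q l u) * ‖deriv (chain q l) u‖)]
    norm_num [weightedLength]

/-! ### Weighted lengths of segments -/

section segments

variable {α W a b c d : ℝ}

lemma lineMap_pt (a b c d u : ℝ) :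
    AffineMap.lineMap (pt a b) (pt c d) u = pt (a + u * (c - a)) (b + u * (d - b)) := by
  apply plane_ext <;> simp [AffineMap.lineMap_apply] <;> ring

/-- Only the open segment matters: endpoints on the boundary, where the weight may jump, form a null
set. -/
lemma segCost_of_weight {k : ℝ}
    (h : ∀ u ∈ Ioo (0 : ℝ) 1, weight α W (pt (a + u * (c - a)) (b + u * (d - b))) = k) :
    segCost α W (pt a b) (pt c d) = k * √((c - a) ^ 2 + (d - b) ^ 2) := by
  have : segCost α W (pt a b) (pt c d) = ∫ _ in (0 : ℝ)..1, k * ‖pt c d - pt a b‖ := by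
    refine intervalIntegral.integral_congr_ae ?_
    have : ∀ᵐ u : ℝ, u ≠ 1 := by simp [ae_iff]
    filter_upwards [this] with u hu hmem
    rw [uIoc_of_le zero_le_one] at hmem
    rw [lineMap_pt, h u ⟨hmem.1, lt_of_le_of_ne hmem.2 hu⟩]
  rw [this, norm_plane]
  simp

lemma between_nonneg (ha : 0 ≤ a) (hc : 0 ≤ c) {u : ℝ} (hu : u ∈ Ioo (0 : ℝ) 1) :
    0 ≤ a + u * (c - a) := by
  nlinarith [mul_nonneg ha (sub_pos.2 hu.2).le, mul_nonneg hc hu.1.le]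

lemma between_pos (ha : 0 ≤ a) (hc : 0 ≤ c) (hac : 0 < a + c) {u : ℝ} (hu : u ∈ Ioo (0 : ℝ) 1) :
    0 < a + u * (c - a) := by
  rcases eq_or_lt_of_le ha with h | h
  · nlinarith [mul_pos (show 0 < c by linarith) hu.1]
  · nlinarith [mul_pos h (sub_pos.2 hu.2), mul_nonneg hc hu.1.le]

/-- The hypotheses say that both endpoints are in the closed rectangle and do not lie on a common
side; then the open segment is in the open rectangle by convexity. -/
lemma segCost_inside (ha : 0 ≤ a) (hc : 0 ≤ c) (hac : 0 < a + c) (ha' : a ≤ W) (hc' : c ≤ W)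
    (hac' : a + c < 2 * W) (hb : b ≤ 0) (hd : d ≤ 0) (hbd : b + d < 0) (hb' : -1 ≤ b) (hd' : -1 ≤ d)
    (hbd' : -2 < b + d) :
    segCost α W (pt a b) (pt c d) = α * √((c - a) ^ 2 + (d - b) ^ 2) := by
  refine segCost_of_weight fun u hu => weight_of_mem_openRect ⟨?_, ?_, ?_, ?_⟩
  · rw [pt_zero]; exact between_pos ha hc hac hu
  · have := between_pos (a := W - a) (c := W - c) (by linarith) (by linarith) (by linarith) hu
    rw [pt_zero]; linarith
  · have := between_pos (a := b + 1) (c := d + 1) (by linarith) (by linarith) (by linarith) hu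
    rw [pt_one]; linarith
  · have := between_pos (a := -b) (c := -d) (by linarith) (by linarith) (by linarith) hu
    rw [pt_one]; linarith

lemma segCost_of_le_one (hα : α ≤ 1) (h1 : pt a b ∈ rect W) (h2 : pt c d ∈ rect W) :
    segCost α W (pt a b) (pt c d) = α * √((c - a) ^ 2 + (d - b) ^ 2) := by
  obtain ⟨h1, h3, h5, h7⟩ := h1
  obtain ⟨h2, h4, h6, h8⟩ := h2
  simp only [pt_zero, pt_one] at h1 h2 h3 h4 h5 h6 h7 h8
  refine segCost_of_weight fun u hu => weight_of_le_one hα ⟨?_, ?_, ?_, ?_⟩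
  · rw [pt_zero]; exact between_nonneg h1 h2 hu
  · have := between_nonneg (a := W - a) (c := W - c) (by linarith) (by linarith) hu
    rw [pt_zero]; linarith
  · have := between_nonneg (a := b + 1) (c := d + 1) (by linarith) (by linarith) hu
    rw [pt_one]; linarith
  · have := between_nonneg (a := -b) (c := -d) (by linarith) (by linarith) hu
    rw [pt_one]; linarith

lemma segCost_left (ha : a ≤ 0) (hc : c ≤ 0) (h : a + c < 0) :
    segCost α W (pt a b) (pt c d) = √((c - a) ^ 2 + (d - b) ^ 2) := by
  rw [segCost_of_weight (k := 1), one_mul]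
  intro u hu
  have := between_pos (a := -a) (c := -c) (by linarith) (by linarith) (by linarith) hu
  exact weight_of_notMem fun hm => by
    have := hm.1
    rw [pt_zero] at this; linarith

lemma segCost_below (hb : b ≤ -1) (hd : d ≤ -1) (h : b + d < -2) :
    segCost α W (pt a b) (pt c d) = √((c - a) ^ 2 + (d - b) ^ 2) := by
  rw [segCost_of_weight (k := 1), one_mul]
  intro u hu
  have := between_pos (a := -1 - b) (c := -1 - d) (by linarith) (by linarith) (by linarith) hu
  exact weight_of_notMem fun hm => by
    have := hm.2.2.1
    rw [pt_one] at this; linarith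

lemma segCost_above (hb : 0 ≤ b) (hd : 0 ≤ d) (h : 0 < b + d) :
    segCost α W (pt a b) (pt c d) = √((c - a) ^ 2 + (d - b) ^ 2) := by
  rw [segCost_of_weight (k := 1), one_mul]
  intro u hu
  have := between_pos hb hd h hu
  exact weight_of_notMem fun hm => by
    have := hm.2.2.2
    rw [pt_one] at this; linarith

lemma segCost_left_side (hα : 1 ≤ α) : segCost α W (pt 0 b) (pt 0 d) = |b - d| := by
  rw [segCost_of_weight (k := 1), one_mul, sub_self, zero_pow two_ne_zero, zero_add, Real.sqrt_sq_eq_abs,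
    abs_sub_comm]
  intro u hu
  exact weight_of_one_le hα fun hm => by
    have := hm.1
    rw [pt_zero] at this; linarith

lemma segCost_top (hα : 1 ≤ α) : segCost α W (pt a 0) (pt c 0) = |a - c| := by
  rw [segCost_of_weight (k := 1), one_mul, sub_self, zero_pow two_ne_zero, add_zero, Real.sqrt_sq_eq_abs,
    abs_sub_comm]
  intro u hu
  exact weight_of_one_le hα fun hm => by
    have := hm.2.2.2
    rw [pt_one] at this; linarith

end segments

/-! ### Instances: paths and mirror images -/

namespace Instance

lemma isPath_path (c : Instance) (vs : List Plane) : IsPath (c.path vs) c.s c.t :=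
  ⟨chain_lipschitz _ _, chain_zero _ _, by rw [path, chain_one]; simp⟩

lemma IsShortest.len_le {c : Instance} {vs : List Plane} (h : c.IsShortest vs) (vs' : List Plane) :
    c.len vs ≤ c.len vs' := h.2 _ (c.isPath_path vs')

lemma isShortest_of_le {c : Instance} {vs : List Plane} {d : ℝ} (h : c.len vs ≤ d)
    (h' : ∀ δ, IsPath δ c.s c.t → d ≤ weightedLength c.α c.W δ) : c.IsShortest vs :=
  ⟨c.isPath_path vs, fun δ hδ => h.trans (h' δ hδ)⟩

lemma IsShortest.of_len_le {c : Instance} {vs vs' : List Plane} (h : c.IsShortest vs)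
    (h' : c.len vs' ≤ c.len vs) : c.IsShortest vs' :=
  isShortest_of_le h' h.2

variable {c : Instance}

lemma len_nil (hα : 0 < c.α) : c.len [] = segCost c.α c.W c.s c.t := by
  rw [len, path, List.nil_append, weightedLength_chain_cons _ hα, weightedLength_chain_nil, add_zero]

lemma len_one (hα : 0 < c.α) (p : Plane) :
    c.len [p] = segCost c.α c.W c.s p + segCost c.α c.W p c.t := by
  rw [len, path, List.singleton_append, weightedLength_chain_cons _ hα,
    weightedLength_chain_cons _ hα, weightedLength_chain_nil, add_zero]

lemma len_two (hα : 0 < c.α) (p q : Plane) :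
    c.len [p, q] = segCost c.α c.W c.s p + segCost c.α c.W p q + segCost c.α c.W q c.t := by
  rw [len, path, List.cons_append, List.singleton_append, weightedLength_chain_cons _ hα,
    weightedLength_chain_cons _ hα, weightedLength_chain_cons _ hα, weightedLength_chain_nil]
  ring

lemma len_three (hα : 0 < c.α) (p q r : Plane) :
    c.len [p, q, r] = segCost c.α c.W c.s p + segCost c.α c.W p q + segCost c.α c.W q r +
      segCost c.α c.W r c.t := by
  rw [len, path, List.cons_append, List.cons_append, List.singleton_append,
    weightedLength_chain_cons _ hα, weightedLength_chain_cons _ hα, weightedLength_chain_cons _ hα,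
    weightedLength_chain_cons _ hα, weightedLength_chain_nil]
  ring

lemma mirrorPt_mirrorPt (c : Instance) (m : Bool) (p : Plane) :
    c.mirrorPt m (c.mirrorPt m p) = p := by
  cases m
  · rfl
  · apply plane_ext <;> simp [mirrorPt]

lemma mirrorPt_mirror (c : Instance) (m m' : Bool) : (c.mirror m').mirrorPt m = c.mirrorPt m := by
  cases m <;> cases m' <;> rfl

lemma map_mirrorPt_map_mirrorPt (c : Instance) (m : Bool) (vs : List Plane) :
    (vs.map (c.mirrorPt m)).map (c.mirrorPt m) = vs := by
  rw [List.map_map]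
  convert List.map_id vs using 2
  funext p; exact c.mirrorPt_mirrorPt m p

lemma mirror_mirror (c : Instance) : (c.mirror true).mirror true = c := by
  simp [mirror]

lemma Admissible.mirror {c : Instance} (h : c.Admissible) (m : Bool) : (c.mirror m).Admissible := by
  cases m
  · exact h
  · obtain ⟨h1, h2, h3, h4, h5, h6⟩ := h
    refine ⟨h1, h2, h3, ?_, ?_, ?_⟩
    · simp only [Instance.mirror]; linarith
    · simp only [Instance.mirror]; linarith
    · simp only [Instance.mirror]
      rcases h6 with ⟨h6, h7⟩ | ⟨h6, h7⟩
      · exact Or.inr ⟨by linarith, by linarith⟩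
      · exact Or.inl ⟨by linarith, by linarith⟩

lemma weight_mirror (α W : ℝ) (p : Plane) : weight α W (pt (W - p 0) (p 1)) = weight α W p := by
  have h1 : pt (W - p 0) (p 1) ∈ openRect W ↔ p ∈ openRect W := by
    simp only [openRect, mem_ofPred_eq, pt_zero, pt_one]
    constructor <;> rintro ⟨h1, h2, h3, h4⟩ <;> exact ⟨by linarith, by linarith, h3, h4⟩
  have h2 : pt (W - p 0) (p 1) ∈ rect W ↔ p ∈ rect W := by
    simp only [rect, mem_ofPred_eq, pt_zero, pt_one]
    constructor <;> rintro ⟨h1, h2, h3, h4⟩ <;> exact ⟨by linarith, by linarith, h3, h4⟩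
  unfold weight
  split_ifs <;> first | rfl | (exfalso; tauto)

lemma norm_mirror_sub (W : ℝ) (p q : Plane) :
    ‖pt (W - p 0) (p 1) - pt (W - q 0) (q 1)‖ = ‖p - q‖ := by
  rw [norm_plane, norm_plane]
  congr 1
  simp only [PiLp.sub_apply, pt_zero, pt_one]
  ring

lemma differentiableAt_mirror {W : ℝ} {γ : ℝ → Plane} {u : ℝ} (h : DifferentiableAt ℝ γ u) :
    DifferentiableAt ℝ (fun u => pt (W - γ u 0) (γ u 1)) u := by
  rw [differentiableAt_euclidean]
  intro i
  have h0 := (hasDerivAt_coord h.hasDerivAt 0).differentiableAt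
  have h1 := (hasDerivAt_coord h.hasDerivAt 1).differentiableAt
  fin_cases i
  · simpa using h0.const_sub W
  · simpa using h1

lemma norm_deriv_mirror (W : ℝ) (γ : ℝ → Plane) (u : ℝ) :
    ‖deriv (fun u => pt (W - γ u 0) (γ u 1)) u‖ = ‖deriv γ u‖ := by
  by_cases h : DifferentiableAt ℝ γ u
  · have h' := differentiableAt_mirror (W := W) h
    exact le_antisymm (norm_deriv_le_of_norm_sub_le (fun x => (norm_mirror_sub W _ _).le) h' h)
      (norm_deriv_le_of_norm_sub_le (fun x => (norm_mirror_sub W _ _).ge) h h')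
  -- Reflecting twice gives `γ` back, so neither curve is differentiable at `u`, and both
  -- derivatives have the default value zero.
  · have h' : ¬ DifferentiableAt ℝ (fun u => pt (W - γ u 0) (γ u 1)) u := fun h' => h (by
      have := differentiableAt_mirror (W := W) h'
      simpa [pt_eta] using this)
    rw [deriv_zero_of_not_differentiableAt h, deriv_zero_of_not_differentiableAt h']

lemma weightedLength_mirror (α W : ℝ) (γ : ℝ → Plane) :
    weightedLength α W (fun u => pt (W - γ u 0) (γ u 1)) = weightedLength α W γ := by
  simp only [weightedLength, norm_deriv_mirror, weight_mirror]

lemma isPath_mirror {W : ℝ} {γ : ℝ → Plane} {s t : Plane} (h : IsPath γ s t) :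
    IsPath (fun u => pt (W - γ u 0) (γ u 1)) (pt (W - s 0) (s 1)) (pt (W - t 0) (t 1)) := by
  obtain ⟨⟨K, hK⟩, h0, h1⟩ := h
  refine ⟨⟨K, LipschitzOnWith.of_dist_le_mul fun x hx y hy => ?_⟩, by simp [h0], by simp [h1]⟩
  rw [dist_eq_norm, norm_mirror_sub, ← dist_eq_norm]
  exact hK.dist_le_mul x hx y hy

lemma chain_mirror (c : Instance) (p : Plane) (l : List Plane) (u : ℝ) :
    chain (c.mirrorPt true p) (l.map (c.mirrorPt true)) u = c.mirrorPt true (chain p l u) := by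
  induction l generalizing p u with
  | nil => rfl
  | cons q l ih =>
    rw [List.map_cons, chain, chain]
    split_ifs
    · apply plane_ext <;> simp [mirrorPt, AffineMap.lineMap_apply]; ring
    · rw [ih]

lemma path_mirror (c : Instance) (vs : List Plane) :
    (c.mirror true).path (vs.map (c.mirrorPt true)) =
      fun u => pt (c.W - c.path vs u 0) (c.path vs u 1) := by
  funext u
  have := chain_mirror c c.s (vs ++ [c.t]) u
  simp only [path]
  rw [List.map_append] at this
  simpa [mirrorPt, mirror, s, t] using this

lemma len_mirror (c : Instance) (m : Bool) (vs : List Plane) :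
    (c.mirror m).len (vs.map (c.mirrorPt m)) = c.len vs := by
  cases m
  · rw [show c.mirrorPt false = id from rfl, List.map_id]; rfl
  · rw [len, path_mirror]; exact weightedLength_mirror _ _ _

lemma IsShortest.mirror {c : Instance} {vs : List Plane} (h : c.IsShortest vs) (m : Bool) :
    (c.mirror m).IsShortest (vs.map (c.mirrorPt m)) := by
  cases m
  · rw [show c.mirrorPt false = id from rfl, List.map_id]; exact h
  · refine isShortest_of_le (c.len_mirror true vs).le fun δ hδ => ?_
    rw [← weightedLength_mirror]
    refine h.2 _ ?_
    have := isPath_mirror (W := c.W) hδ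
    simpa [Instance.mirror, s, t] using this

end Instance

end WeightedRectangle
end

noncomputable section

namespace WeightedRectangle

open MeasureTheory Filter Topology

/-! ### Weighted lengths of the paths of the thirteen types -/

/-- The weighted length of the segment from `(sx, 0)` to the point `(0, b)` of the left side, if the
weight is at least one. -/
def leftCost (α sx b : ℝ) : ℝ := if sx = 0 then -b else α * √(sx ^ 2 + b ^ 2)

namespace Instance

variable {c : Instance}

lemma Admissible.pos (h : c.Admissible) : 0 < c.α := h.1
lemma Admissible.lt_sqrt_two (h : c.Admissible) : c.α < √2 := h.2.1
lemma Admissible.width_pos (h : c.Admissible) : 0 < c.W := h.2.2.1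
lemma Admissible.sx_nonneg (h : c.Admissible) : 0 ≤ c.sx := h.2.2.2.1
lemma Admissible.sx_le (h : c.Admissible) : c.sx ≤ c.W := h.2.2.2.2.1

lemma Admissible.sx_pos (h : c.Admissible) (ht : c.tx < 0) : 0 < c.sx := by
  rcases h.2.2.2.2.2 with h' | h'
  · exact h'.1
  · linarith [h.sx_nonneg, h'.2]

lemma mem_rect_pt {W x y : ℝ} : pt x y ∈ rect W ↔ 0 ≤ x ∧ x ≤ W ∧ -1 ≤ y ∧ y ≤ 0 := by
  simp [rect]

lemma len_p1 (h : c.Admissible) (ht : 0 < c.ty) :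
    c.len [] = √((c.tx - c.sx) ^ 2 + c.ty ^ 2) := by
  rw [len_nil h.pos, s, t, segCost_above le_rfl ht.le (by linarith), sub_zero]

lemma len_p2 (h : c.Admissible) (hα : c.α ≤ 1) (ht : 0 < c.ty) {b : ℝ} (hb : 0 ≤ b)
    (hbs : b ≤ c.sx) :
    c.len [pt b 0] = c.α * (c.sx - b) + √((b - c.tx) ^ 2 + c.ty ^ 2) := by
  have h1 := h.sx_nonneg
  have h2 := h.sx_le
  rw [len_one h.pos, s, t, segCost_of_le_one hα (mem_rect_pt.2 ⟨h1, h2, by norm_num, le_rfl⟩)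
    (mem_rect_pt.2 ⟨hb, hbs.trans h2, by norm_num, le_rfl⟩),
    segCost_above le_rfl ht.le (by linarith), sub_zero, sub_zero, zero_pow two_ne_zero, add_zero,
    Real.sqrt_sq_eq_abs, abs_of_nonpos (by linarith)]
  congr 3 <;> ring

lemma len_p3 (h : c.Admissible) (hα : c.α ≤ 1) (ht : c.tx < 0) :
    c.len [pt 0 0] = c.α * c.sx + √(c.tx ^ 2 + c.ty ^ 2) := by
  have h1 := h.sx_nonneg
  have h2 := h.sx_le
  rw [len_one h.pos, s, t, segCost_of_le_one hα (mem_rect_pt.2 ⟨h1, h2, by norm_num, le_rfl⟩)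
    (mem_rect_pt.2 ⟨le_rfl, h1.trans h2, by norm_num, le_rfl⟩),
    segCost_left le_rfl ht.le (by linarith), sub_zero, sub_zero, zero_pow two_ne_zero, add_zero,
    Real.sqrt_sq_eq_abs, abs_of_nonpos (by linarith)]
  ring_nf

lemma len_p4 (h : c.Admissible) (hα : 1 ≤ c.α) (ht : c.tx < 0) :
    c.len [pt 0 0] = c.sx + √(c.tx ^ 2 + c.ty ^ 2) := by
  have h1 := h.sx_nonneg
  rw [len_one h.pos, s, t, segCost_top hα,
    segCost_left le_rfl ht.le (by linarith), sub_zero, sub_zero, sub_zero, abs_of_nonneg h1]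

lemma len_p5 (h : c.Admissible) (hα : 1 ≤ c.α) (ht : c.tx < 0) {b₁ b₂ : ℝ} (h1 : 0 < b₁)
    (h1' : b₁ ≤ c.sx) (h2 : -1 < b₂) (h2' : b₂ < 0) :
    c.len [pt b₁ 0, pt 0 b₂] =
      (c.sx - b₁) + c.α * √(b₁ ^ 2 + b₂ ^ 2) + √(c.tx ^ 2 + (b₂ - c.ty) ^ 2) := by
  have := h.sx_le
  have := h.width_pos
  rw [len_two h.pos, s, t, segCost_top hα, segCost_inside, segCost_left le_rfl ht.le (by linarith),
    abs_of_nonneg (by linarith)] <;> try linarith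
  ring_nf

lemma len_p6 (h : c.Admissible) (ht : c.tx < 0) {b : ℝ} (hb : -1 ≤ b) (hb' : b < 0) :
    c.len [pt 0 b] = c.α * √(c.sx ^ 2 + b ^ 2) + √(c.tx ^ 2 + (b - c.ty) ^ 2) := by
  have := h.sx_le
  have := h.width_pos
  have := h.sx_pos ht
  rw [len_one h.pos, s, t, segCost_inside, segCost_left le_rfl ht.le (by linarith)] <;> try linarith
  congr 3 <;> ring

lemma segCost_leftCost (h : c.Admissible) (hα : 1 ≤ c.α) {b : ℝ} (hb : -1 ≤ b) (hb' : b < 0) :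
    segCost c.α c.W c.s (pt 0 b) = leftCost c.α c.sx b := by
  have h1 := h.sx_nonneg
  have := h.sx_le
  have := h.width_pos
  rw [leftCost, s]
  split_ifs with h0
  · rw [h0, segCost_left_side hα, abs_of_nonneg] <;> linarith
  · have : 0 < c.sx := lt_of_le_of_ne h1 (Ne.symm h0)
    rw [segCost_inside] <;> try linarith
    congr 2; ring

lemma len_p7 (h : c.Admissible) (hα : 1 ≤ c.α) (ht : c.ty < -1) {b : ℝ} (hb : -1 ≤ b) (hb' : b < 0) :
    c.len [pt 0 b, pt 0 (-1)] =
      leftCost c.α c.sx b + (b + 1) + √(c.tx ^ 2 + (c.ty + 1) ^ 2) := by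
  rw [len_two h.pos, segCost_leftCost h hα hb hb', t, segCost_left_side hα,
    segCost_below le_rfl ht.le (by linarith), abs_of_nonneg (by linarith)]
  congr 2 <;> ring_nf

lemma len_p8 (h : c.Admissible) (hα : 1 ≤ c.α) (ht : c.ty < -1) {b₁ b₂ b₃ : ℝ} (h2 : -1 < b₂)
    (h12 : b₂ ≤ b₁) (h1 : b₁ < 0) (h3 : 0 < b₃) (h3' : b₃ < c.W) :
    c.len [pt 0 b₁, pt 0 b₂, pt b₃ (-1)] = leftCost c.α c.sx b₁ + (b₁ - b₂) +
      c.α * √(b₃ ^ 2 + (b₂ + 1) ^ 2) + √((b₃ - c.tx) ^ 2 + (c.ty + 1) ^ 2) := by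
  rw [len_three h.pos, segCost_leftCost h hα (by linarith) h1, t, segCost_left_side hα, segCost_inside,
    segCost_below le_rfl ht.le (by linarith), abs_of_nonneg (by linarith)] <;> try linarith
  ring_nf

lemma len_p9 (h : c.Admissible) (hα : c.α ≤ 1) (hx : c.tx ≤ 0) (hy : c.ty ≤ -1)
    (hne : c.tx < 0 ∨ c.ty < -1) :
    c.len [pt 0 (-1)] = c.α * √(c.sx ^ 2 + 1) + √(c.tx ^ 2 + (c.ty + 1) ^ 2) := by
  have h1 := h.sx_nonneg
  have h2 := h.sx_le
  have e : segCost c.α c.W (pt 0 (-1)) (pt c.tx c.ty) = √((c.tx - 0) ^ 2 + (c.ty - -1) ^ 2) := by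
    rcases hne with h | h
    · exact segCost_left le_rfl hx (by linarith)
    · exact segCost_below le_rfl hy (by linarith)
  rw [len_one h.pos, s, t, segCost_of_le_one hα (mem_rect_pt.2 ⟨h1, h2, by norm_num, le_rfl⟩)
    (mem_rect_pt.2 ⟨le_rfl, h1.trans h2, le_rfl, by norm_num⟩), e]
  congr 3 <;> ring

lemma len_p10 (h : c.Admissible) (ht : c.ty < -1) {b : ℝ} (hb : 0 < b) (hb' : b < c.W) :
    c.len [pt b (-1)] =
      c.α * √((b - c.sx) ^ 2 + 1) + √((b - c.tx) ^ 2 + (c.ty + 1) ^ 2) := by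
  have := h.sx_nonneg
  have := h.sx_le
  rw [len_one h.pos, s, t, segCost_inside, segCost_below le_rfl ht.le (by linarith)] <;> try linarith
  congr 3 <;> ring

lemma len_p11 (h : c.Admissible) (hα : 1 ≤ c.α) (ht : c.t ∈ rect c.W) (hty : c.ty < 0) {b : ℝ}
    (hb : 0 < b) (hb' : b < c.sx) :
    c.len [pt b 0] = (c.sx - b) + c.α * √((b - c.tx) ^ 2 + c.ty ^ 2) := by
  have := h.sx_le
  obtain ⟨t1, t2, t3, -⟩ := mem_rect_pt.1 ht
  rw [len_one h.pos, s, t, segCost_top hα, segCost_inside, abs_of_nonneg (by linarith)] <;>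
    try linarith
  congr 3; ring

lemma len_p11_top (h : c.Admissible) (hα : 1 ≤ c.α) (hty : c.ty = 0) (b : ℝ) :
    c.len [pt b 0] = |c.sx - b| + |b - c.tx| := by
  rw [len_one h.pos, s, t, hty, segCost_top hα, segCost_top hα]

/-- Since both endpoints are in the closed rectangle, the position of the midpoint decides. This
form is also what the program can test. -/
lemma openSegment_subset_openRect_iff (h : c.Admissible) (ht : c.t ∈ rect c.W) :
    openSegment ℝ c.s c.t ⊆ openRect c.W ↔ c.ty < 0 ∧ 0 < c.sx + c.tx ∧ c.sx + c.tx < 2 * c.W := by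
  obtain ⟨t1, t2, t3, t4⟩ := mem_rect_pt.1 ht
  have h1 := h.sx_nonneg
  have h2 := h.sx_le
  constructor
  · intro hsub
    have hm : AffineMap.lineMap c.s c.t (1 / 2 : ℝ) ∈ openRect c.W := by
      refine hsub ?_
      rw [openSegment_eq_image_lineMap]
      exact ⟨1 / 2, ⟨by norm_num, by norm_num⟩, rfl⟩
    rw [s, t, lineMap_pt] at hm
    obtain ⟨m1, m2, m3, m4⟩ := hm
    simp only [pt_zero, pt_one] at m1 m2 m3 m4
    exact ⟨by linarith, by linarith, by linarith⟩
  · rintro ⟨hy, hx, hx'⟩ p hp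
    rw [openSegment_eq_image_lineMap] at hp
    obtain ⟨u, hu, rfl⟩ := hp
    rw [s, t, lineMap_pt]
    refine ⟨?_, ?_, ?_, ?_⟩
    · rw [pt_zero]; exact between_pos h1 t1 hx hu
    · have := between_pos (a := c.W - c.sx) (c := c.W - c.tx) (by linarith) (by linarith)
        (by linarith) hu
      rw [pt_zero]; linarith
    · have := between_pos (a := 0 + 1) (c := c.ty + 1) (by linarith) (by linarith) (by linarith) hu
      rw [pt_one]; linarith
    · have := between_pos (a := -0) (c := -c.ty) (by linarith) (by linarith) (by linarith) hu
      rw [pt_one]; linarith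

lemma len_p12 (h : c.Admissible) (ht : c.t ∈ rect c.W)
    (h' : c.α ≤ 1 ∨ c.t = c.s ∨ openSegment ℝ c.s c.t ⊆ openRect c.W) :
    c.len [] = c.α * √((c.sx - c.tx) ^ 2 + c.ty ^ 2) := by
  obtain ⟨t1, t2, t3, t4⟩ := mem_rect_pt.1 ht
  have h1 := h.sx_nonneg
  have h2 := h.sx_le
  rw [len_nil h.pos]
  rcases h' with h' | h' | h'
  · rw [s, t, segCost_of_le_one h' (mem_rect_pt.2 ⟨h1, h2, by norm_num, le_rfl⟩) ht]
    congr 2; ring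
  · have e0 : c.tx = c.sx := by simpa [s, t] using congrArg (fun p : Plane => p 0) h'
    have e1 : c.ty = 0 := by simpa [s, t] using congrArg (fun p : Plane => p 1) h'
    rw [h', e0, e1, segCost]; simp
  · rw [openSegment_subset_openRect_iff h ht] at h'
    obtain ⟨a1, a2, a3⟩ := h'
    rw [s, t, segCost_inside] <;> try linarith
    congr 2; ring

lemma len_p13 (h : c.Admissible) (hα : 1 ≤ c.α) (ht : c.t ∈ rect c.W) {b₁ b₂ : ℝ} (h2 : -1 < b₂)
    (h2' : b₂ < 0) (h1 : -1 ≤ b₁) (h1' : b₁ < 0) :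
    c.len [pt 0 b₁, pt 0 b₂] = leftCost c.α c.sx b₁ + |b₁ - b₂| +
      (if c.tx = 0 then |b₂ - c.ty| else c.α * √(c.tx ^ 2 + (b₂ - c.ty) ^ 2)) := by
  obtain ⟨t1, t2, t3, t4⟩ := mem_rect_pt.1 ht
  have := h.width_pos
  rw [len_two h.pos, segCost_leftCost h hα h1 h1', segCost_left_side hα]
  congr 1
  split_ifs with h0
  · rw [t, h0, segCost_left_side hα]
  · have : 0 < c.tx := lt_of_le_of_ne t1 (Ne.symm h0)
    rw [t, segCost_inside] <;> try linarith
    congr 2; ring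

end Instance

/-! ### One-sided derivatives at minima -/

lemma deriv_nonneg_of_right_min {f : ℝ → ℝ} {f' a : ℝ} (hf : HasDerivAt f f' a)
    (h : ∀ᶠ x in 𝓝[>] a, f a ≤ f x) : 0 ≤ f' := by
  have ht := (hasDerivAt_iff_tendsto_slope.1 hf).mono_left
    (nhdsWithin_mono a (fun x hx => ne_of_gt hx : Ioi a ⊆ {a}ᶜ))
  refine ge_of_tendsto ht ?_
  filter_upwards [h, self_mem_nhdsWithin] with x hx hxa
  rw [slope_def_field]
  exact div_nonneg (by linarith) (sub_nonneg.2 (le_of_lt hxa))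

lemma deriv_nonpos_of_left_min {f : ℝ → ℝ} {f' a : ℝ} (hf : HasDerivAt f f' a)
    (h : ∀ᶠ x in 𝓝[<] a, f a ≤ f x) : f' ≤ 0 := by
  have ht := (hasDerivAt_iff_tendsto_slope.1 hf).mono_left
    (nhdsWithin_mono a (fun x hx => ne_of_lt hx : Iio a ⊆ {a}ᶜ))
  refine le_of_tendsto ht ?_
  filter_upwards [h, self_mem_nhdsWithin] with x hx hxa
  rw [slope_def_field]
  exact div_nonpos_of_nonneg_of_nonpos (by linarith) (sub_nonpos.2 (le_of_lt hxa))

lemma deriv_eq_zero_of_min_on {f : ℝ → ℝ} {f' a l r : ℝ} (hf : HasDerivAt f f' a) (hl : l < a)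
    (hr : a < r) (h : ∀ x, l < x → x < r → f a ≤ f x) : f' = 0 := by
  have : IsLocalMin f a := by
    filter_upwards [Ioo_mem_nhds hl hr] with x hx using h x hx.1 hx.2
  exact this.hasDerivAt_eq_zero hf

lemma hasDerivAt_dist (a h : ℝ) {x : ℝ} (hx : 0 < (x - a) ^ 2 + h) :
    HasDerivAt (fun x => √((x - a) ^ 2 + h)) ((x - a) / √((x - a) ^ 2 + h)) x := by
  have h1 : HasDerivAt (fun x : ℝ => (x - a) ^ 2 + h) (2 * (x - a)) x := by
    have := (((hasDerivAt_id x).sub_const a).pow 2).add_const h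
    simpa using this
  convert h1.sqrt hx.ne' using 1
  field_simp

lemma hasDerivAt_dist' (a h : ℝ) {x : ℝ} (hx : 0 < h + (x - a) ^ 2) :
    HasDerivAt (fun x => √(h + (x - a) ^ 2)) ((x - a) / √(h + (x - a) ^ 2)) x := by
  have := hasDerivAt_dist a h (x := x) (by linarith)
  simpa only [add_comm h] using this

lemma hasDerivAt_norm (h : ℝ) {x : ℝ} (hx : 0 < h + x ^ 2) :
    HasDerivAt (fun x => √(h + x ^ 2)) (x / √(h + x ^ 2)) x := by
  have := hasDerivAt_dist' 0 h (x := x) (by simpa using hx)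
  simpa using this

end WeightedRectangle
end

noncomputable section

namespace WeightedRectangle

open MeasureTheory Filter Topology

/-! ### Best exit points -/

section norms

variable {α D y : ℝ}

lemma slabNorm_of_le (h : y ≤ √(α ^ 2 - 1) * D) : slabNorm α D y = D + √(α ^ 2 - 1) * y := if_pos h

lemma slabNorm_of_ge (hα : 1 < α) (hD : 0 ≤ D) (h : √(α ^ 2 - 1) * D ≤ y) :
    slabNorm α D y = α * √(D ^ 2 + y ^ 2) := by
  rcases eq_or_lt_of_le h with h | h
  · have hk := crit_sq hα
    rw [slabNorm_of_le h.ge, ← h, show D ^ 2 + (√(α ^ 2 - 1) * D) ^ 2 = (α * D) ^ 2 by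
      rw [mul_pow, hk]; ring, Real.sqrt_sq (by positivity)]
    linear_combination D * hk
  · exact if_neg (not_le.2 h)

lemma boxNorm_of_le (h : D ≤ √(α ^ 2 - 1) * y) : boxNorm α D y = √(α ^ 2 - 1) * D + y := if_pos h

lemma boxNorm_of_ge (hα : 1 < α) (h2 : α < √2) (hy : 0 ≤ y) (h : √(α ^ 2 - 1) * y ≤ D) :
    boxNorm α D y = slabNorm α D y := by
  rcases eq_or_lt_of_le h with h | h
  · have hk := crit_sq hα
    have hk0 := crit_pos hα
    have hk1 := crit_lt_one hα h2
    rw [boxNorm_of_le h.ge]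
    rcases eq_or_lt_of_le hy with h0 | h0
    · rw [← h, ← h0, slabNorm_of_le] <;> simp
    · rw [slabNorm_of_ge hα (by rw [← h]; positivity), ← h,
        show (√(α ^ 2 - 1) * y) ^ 2 + y ^ 2 = (α * y) ^ 2 by rw [mul_pow, hk]; ring,
        Real.sqrt_sq (by positivity)]
      · linear_combination y * hk
      · rw [← h]
        have : √(α ^ 2 - 1) * y ≤ y := mul_le_of_le_one_left hy hk1.le
        exact (mul_le_of_le_one_left (by positivity) hk1.le).trans this
  · exact if_neg (not_le.2 h)

lemma sqrt_add_le (a b c d : ℝ) :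
    √((a + b) ^ 2 + (c + d) ^ 2) ≤ √(a ^ 2 + c ^ 2) + √(b ^ 2 + d ^ 2) := by
  have := norm_add_le (pt a c) (pt b d)
  simpa [norm_plane] using this

lemma lt_sqrt_sq_add (a : ℝ) {h : ℝ} (hh : 0 < h) : a < √(a ^ 2 + h) :=
  Real.lt_sqrt_of_sq_lt (by linarith)

lemma lt_sqrt_add_sq (a : ℝ) {h : ℝ} (hh : 0 < h) : a < √(h + a ^ 2) :=
  Real.lt_sqrt_of_sq_lt (by linarith)

end norms

namespace Instance

/-- The length of a shortest path from source to target that leaves the rectangle at `(x, y)`. -/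
def exitLen (c : Instance) (x y : ℝ) : ℝ :=
  innerDist c.α c.W c.sx x y + √((x - c.tx) ^ 2 + (y - c.ty) ^ 2)

/-- The point `(x, y)` is a best exit point. -/
def IsBestExit (c : Instance) (x y : ℝ) : Prop :=
  IsExit c.W c.tx c.ty x y ∧ ∀ x' y', IsExit c.W c.tx c.ty x' y' → c.exitLen x y ≤ c.exitLen x' y'

/-- Some path of one of the thirteen types, up to reflection, has length at most `d`. -/
def Reaches (c : Instance) (d : ℝ) : Prop :=
  ∃ (i : PathType) (m : Bool) (vs : List Plane), HasType (c.mirror m) vs i ∧ (c.mirror m).len vs ≤ d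

variable {c : Instance}

lemma Reaches.of_type {d : ℝ} {i : PathType} {vs : List Plane} (h : HasType c vs i)
    (h' : c.len vs ≤ d) : c.Reaches d := ⟨i, false, vs, h, h'⟩

lemma Reaches.of_mirror_type {d : ℝ} {i : PathType} {vs : List Plane}
    (h : HasType (c.mirror true) vs i) (h' : (c.mirror true).len vs ≤ d) : c.Reaches d :=
  ⟨i, true, vs, h, h'⟩

lemma Reaches.mono {d d' : ℝ} (h : c.Reaches d) (hd : d ≤ d') : c.Reaches d' := by
  obtain ⟨i, m, vs, h1, h2⟩ := h
  exact ⟨i, m, vs, h1, h2.trans hd⟩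

lemma exists_exit_le (h : c.Admissible) (htW : c.tx ≤ c.W) {δ : ℝ → Plane} (hδ : IsPath δ c.s c.t) :
    ∃ x y, IsExit c.W c.tx c.ty x y ∧ c.exitLen x y ≤ weightedLength c.α c.W δ := by
  obtain ⟨x, y, h1, h2⟩ := exists_exit_le_weightedLength h.pos h.lt_sqrt_two h.width_pos h.sx_nonneg
    h.sx_le htW hδ
  refine ⟨x, y, h1, le_trans (le_of_eq ?_) h2⟩
  rw [exitLen]
  ring_nf

/-- The strict inequalities in `IsExit` concern the target only, so in terms of the exit point the
set is a finite union of closed pieces of the rectangle. -/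
lemma isCompact_exits (c : Instance) : IsCompact {p : ℝ × ℝ | IsExit c.W c.tx c.ty p.1 p.2} := by
  have hcl : ∀ (A : Prop) (f : ℝ × ℝ → ℝ) (a : ℝ), Continuous f → IsClosed {p | f p = a ∧ A} := by
    intro A f a hf
    by_cases hA : A
    · simpa [hA] using isClosed_eq hf continuous_const
    · simp [hA]
  have h1 : IsClosed {p : ℝ × ℝ | IsExit c.W c.tx c.ty p.1 p.2} := by
    by_cases ht : pt c.tx c.ty ∈ rect c.W
    · simp only [IsExit, ht, true_and, not_true_eq_false, false_and, or_false]
      exact (isClosed_eq continuous_fst continuous_const).inter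
        (isClosed_eq continuous_snd continuous_const)
    · simp only [IsExit, ht, not_false_eq_true, true_and, false_and, false_or]
      refine (isClosed_le continuous_const continuous_fst).inter
        ((isClosed_le continuous_fst continuous_const).inter
        ((isClosed_le continuous_const continuous_snd).inter
        ((isClosed_le continuous_snd continuous_const).inter ?_)))
      exact (hcl _ _ _ continuous_fst).union ((hcl _ _ _ continuous_snd).union
        (hcl _ _ _ continuous_snd))
  refine IsCompact.of_isClosed_subset
    (isCompact_Icc (a := ((0, -1) : ℝ × ℝ)) (b := (c.W, 0))) h1 ?_
  rintro ⟨x, y⟩ (⟨h, rfl, rfl⟩ | ⟨-, h1, h2, h3, h4, -⟩)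
  · obtain ⟨h1, h2, h3, h4⟩ := mem_rect_pt.1 h
    exact ⟨⟨h1, h3⟩, ⟨h2, h4⟩⟩
  · exact ⟨⟨h1, h3⟩, ⟨h2, h4⟩⟩

lemma IsExit.bounds {W tx ty x y : ℝ} (h : IsExit W tx ty x y) : 0 ≤ x ∧ x ≤ W ∧ -1 ≤ y ∧ y ≤ 0 := by
  rcases h with ⟨h, rfl, rfl⟩ | ⟨-, h1, h2, h3, h4, -⟩
  · exact mem_rect_pt.1 h
  · exact ⟨h1, h2, h3, h4⟩

lemma exists_isBestExit (h : c.Admissible) (htW : c.tx ≤ c.W) : ∃ x y, c.IsBestExit x y := by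
  -- Exits exist because the straight path has one.
  obtain ⟨x₀, y₀, h0, -⟩ := exists_exit_le h htW (c.isPath_path [])
  have hcont : ContinuousOn (fun p : ℝ × ℝ => c.exitLen p.1 p.2)
      {p : ℝ × ℝ | IsExit c.W c.tx c.ty p.1 p.2} := by
    refine ContinuousOn.add ?_ (by fun_prop)
    rcases le_or_gt c.α 1 with hα | hα
    · simp only [innerDist, if_pos hα]
      fun_prop
    · have hs := slabNorm_continuous hα
      have hb := boxNorm_continuous hα h.lt_sqrt_two
      -- The absolute values make the function continuous on the whole plane; on exits their
      -- arguments are nonnegative.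
      have : Continuous fun p : ℝ × ℝ => min (slabNorm c.α |c.sx - p.1| (-p.2))
          (min (boxNorm c.α |c.sx + p.1| |-p.2|) (boxNorm c.α |2 * c.W - c.sx - p.1| |-p.2|)) :=
        (hs.comp (f := fun p : ℝ × ℝ => (c.sx - p.1, -p.2)) (by fun_prop)).min
          ((hb.comp (f := fun p : ℝ × ℝ => (c.sx + p.1, -p.2)) (by fun_prop)).min
          (hb.comp (f := fun p : ℝ × ℝ => (2 * c.W - c.sx - p.1, -p.2)) (by fun_prop)))
      refine this.continuousOn.congr fun p hp => ?_
      obtain ⟨h1, h2, h3, h4⟩ := IsExit.bounds hp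
      have := h.sx_nonneg
      have := h.sx_le
      simp only [innerDist, if_neg (not_le.2 hα)]
      rw [abs_of_nonneg (show 0 ≤ c.sx + p.1 by linarith), abs_of_nonneg (show 0 ≤ -p.2 by linarith),
        abs_of_nonneg (show 0 ≤ 2 * c.W - c.sx - p.1 by linarith)]
  obtain ⟨p, hp, hmin⟩ := c.isCompact_exits.exists_isMinOn ⟨(x₀, y₀), h0⟩ hcont
  exact ⟨p.1, p.2, hp, fun x' y' h' => hmin (show (x', y') ∈ _ from h')⟩

/-! ### Best exits for small weights -/

lemma exitLen_of_le_one (hα : c.α ≤ 1) (x y : ℝ) :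
    c.exitLen x y = c.α * √((x - c.sx) ^ 2 + y ^ 2) + √((x - c.tx) ^ 2 + (y - c.ty) ^ 2) := by
  rw [exitLen, innerDist, if_pos hα]
  congr 3; ring

lemma notMem_rect_of {W x y : ℝ} (h : x < 0 ∨ W < x ∨ y < -1 ∨ 0 < y) : pt x y ∉ rect W := by
  rw [mem_rect_pt]
  rintro ⟨h1, h2, h3, h4⟩
  rcases h with h | h | h | h <;> linarith

lemma isExit_left {W tx ty y : ℝ} (hW : 0 ≤ W) (ht : tx < 0) (h : -1 ≤ y) (h' : y ≤ 0) :
    IsExit W tx ty 0 y :=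
  Or.inr ⟨notMem_rect_of (Or.inl ht), le_rfl, hW, h, h', Or.inl ⟨rfl, ht⟩⟩

lemma isExit_bottom {W tx ty x : ℝ} (ht : ty < -1) (h : 0 ≤ x) (h' : x ≤ W) :
    IsExit W tx ty x (-1) :=
  Or.inr ⟨notMem_rect_of (Or.inr (Or.inr (Or.inl ht))), h, h', le_rfl, by norm_num,
    Or.inr (Or.inl ⟨rfl, ht⟩)⟩

lemma isExit_top {W tx ty x : ℝ} (ht : 0 < ty) (h : 0 ≤ x) (h' : x ≤ W) :
    IsExit W tx ty x 0 :=
  Or.inr ⟨notMem_rect_of (Or.inr (Or.inr (Or.inr ht))), h, h', by norm_num, le_rfl,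
    Or.inr (Or.inr ⟨rfl, ht⟩)⟩

/-- For a target above the top side, an exit on the left side is worse than the top-left corner, and
an exit not to the left of the source is worse than going straight. At the corner with `tx ≥ 0`,
moving the exit to the right would save on both parts. What remains is `p2` or `p3`, and the
straight path for `α = 1` by the triangle inequality. -/
lemma reaches_top_of_le_one (h : c.Admissible) (hs : 0 < c.sx) (hts : c.tx ≤ c.sx) (hα : c.α ≤ 1)
    (hty : 0 < c.ty) {x y : ℝ} (hb : c.IsBestExit x y) : c.Reaches (c.exitLen x y) := by
  obtain ⟨hx, hmin⟩ := hb
  have hsW := h.sx_le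
  have hα0 := h.pos
  have hnot : pt c.tx c.ty ∉ rect c.W := notMem_rect_of (Or.inr (Or.inr (Or.inr hty)))
  obtain ⟨-, x0, xW, y0, y1, hc⟩ := hx.resolve_left fun h => hnot h.1
  rcases eq_or_lt_of_le hα with h1 | h1
  · refine Reaches.of_type (i := .p1) (vs := []) ⟨rfl, hty⟩ ?_
    rw [len_p1 h hty, exitLen_of_le_one hα, h1, one_mul]
    have := sqrt_add_le (x - c.sx) (c.tx - x) y (c.ty - y)
    calc √((c.tx - c.sx) ^ 2 + c.ty ^ 2) = √((x - c.sx + (c.tx - x)) ^ 2 + (y + (c.ty - y)) ^ 2) := by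
          ring_nf
      _ ≤ _ := this
      _ = _ := by ring_nf
  have hleft : c.tx < 0 → c.α * c.sx + √(c.tx ^ 2 + c.ty ^ 2) ≤ c.exitLen 0 y := by
    intro ht
    rw [exitLen_of_le_one hα]
    refine add_le_add (mul_le_mul_of_nonneg_left (Real.le_sqrt_of_sq_le (by nlinarith)) hα0.le)
      (Real.sqrt_le_sqrt ?_)
    nlinarith
  rcases hc with ⟨rfl, ht⟩ | ⟨-, h'⟩ | ⟨rfl, -⟩
  · exact Reaches.of_type (i := .p3) (vs := [pt 0 0]) ⟨h1, ht, hty.le, rfl⟩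
      ((len_p3 h hα ht).le.trans (hleft ht))
  · linarith
  · rcases le_or_gt c.sx x with hsx | hsx
    · refine Reaches.of_type (i := .p1) (vs := []) ⟨rfl, hty⟩ ?_
      rw [len_p1 h hty, exitLen_of_le_one hα]
      refine le_add_of_nonneg_of_le (by positivity) (Real.sqrt_le_sqrt ?_)
      nlinarith
    rcases eq_or_lt_of_le x0 with hx0 | hx0
    · subst hx0
      rcases lt_or_ge c.tx 0 with ht | ht
      · exact Reaches.of_type (i := .p3) (vs := [pt 0 0]) ⟨h1, ht, hty.le, rfl⟩
          ((len_p3 h hα ht).le.trans (hleft ht))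
      · exfalso
        have hval : ∀ x ∈ Ico 0 c.sx, c.exitLen x 0 =
            c.α * (c.sx - x) + √((x - c.tx) ^ 2 + c.ty ^ 2) := by
          intro x hx
          rw [exitLen_of_le_one hα, zero_pow two_ne_zero, add_zero, Real.sqrt_sq_eq_abs,
            abs_of_nonpos (by linarith [hx.2])]
          ring_nf
        have hd : HasDerivAt (fun x => c.α * (c.sx - x) + √((x - c.tx) ^ 2 + c.ty ^ 2))
            (c.α * (-1) + (0 - c.tx) / √((0 - c.tx) ^ 2 + c.ty ^ 2)) 0 :=
          (((hasDerivAt_id (0 : ℝ)).const_sub c.sx).const_mul c.α).add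
            (hasDerivAt_dist _ _ (by positivity))
        have := deriv_nonneg_of_right_min hd (by
          filter_upwards [Ioo_mem_nhdsGT hs] with x hx
          have := hmin x 0 (isExit_top hty hx.1.le (hx.2.le.trans hsW))
          rwa [hval x ⟨hx.1.le, hx.2⟩, hval 0 ⟨le_rfl, hs⟩] at this)
        have h3 : (0 - c.tx) / √((0 - c.tx) ^ 2 + c.ty ^ 2) ≤ 0 :=
          div_nonpos_of_nonpos_of_nonneg (by linarith) (Real.sqrt_nonneg _)
        linarith
    · refine Reaches.of_type (i := .p2) (vs := [pt x 0]) ⟨h1, hty, x, hx0, hsx, rfl⟩ ?_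
      rw [len_p2 h hα hty x0 hsx.le, exitLen_of_le_one hα, zero_pow two_ne_zero, add_zero,
        Real.sqrt_sq_eq_abs, abs_of_nonpos (by linarith)]
      apply le_of_eq; ring_nf

/-- An exit in the open side is `p6`. The derivative along the side excludes the top corner unless
`ty = 0`, since moving down shortens the outer part to first order and the inner part is stationary
there. It excludes the bottom corner unless `ty ≤ -1`, since moving up shortens both parts. -/
lemma reaches_left_of_le_one (h : c.Admissible) (hs : 0 < c.sx) (hα : c.α ≤ 1)
    (hty : c.ty ≤ 0) (htx : c.tx < 0) {y : ℝ} (hb : c.IsBestExit 0 y) :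
    c.Reaches (c.exitLen 0 y) := by
  obtain ⟨hx, hmin⟩ := hb
  obtain ⟨-, -, y0, y1⟩ := IsExit.bounds hx
  have hα0 := h.pos
  have hval : ∀ y, c.exitLen 0 y = c.α * √(c.sx ^ 2 + y ^ 2) + √(c.tx ^ 2 + (y - c.ty) ^ 2) := by
    intro y
    rw [exitLen_of_le_one hα, zero_sub, zero_sub, neg_sq, neg_sq]
  have htx2 : 0 < c.tx ^ 2 := by nlinarith
  have hd : ∀ y, HasDerivAt (fun y => c.α * √(c.sx ^ 2 + y ^ 2) + √(c.tx ^ 2 + (y - c.ty) ^ 2))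
      (c.α * (y / √(c.sx ^ 2 + y ^ 2)) + (y - c.ty) / √(c.tx ^ 2 + (y - c.ty) ^ 2)) y := fun y =>
    ((hasDerivAt_norm _ (by positivity)).const_mul c.α).add (hasDerivAt_dist' _ _ (by positivity))
  rcases eq_or_lt_of_le y1 with rfl | y1
  · rcases eq_or_lt_of_le hty with h0 | h0
    · rcases eq_or_lt_of_le hα with h1 | h1
      · refine Reaches.of_type (i := .p4) (vs := [pt 0 0]) ⟨h1.ge, htx, hty, rfl⟩ ?_
        rw [len_p4 h h1.ge htx, hval, h0, h1]
        simp [Real.sqrt_sq hs.le]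
      · refine Reaches.of_type (i := .p3) (vs := [pt 0 0]) ⟨h1, htx, h0.ge, rfl⟩ ?_
        rw [len_p3 h hα htx, hval, h0]
        simp [Real.sqrt_sq hs.le]
    · exfalso
      have := deriv_nonpos_of_left_min (hd 0) (by
        filter_upwards [Ioo_mem_nhdsLT (show (-1 : ℝ) < 0 by norm_num)] with y hy
        have := hmin 0 y (isExit_left h.width_pos.le htx hy.1.le hy.2.le)
        rwa [hval, hval] at this)
      have h3 : 0 < (0 - c.ty) / √(c.tx ^ 2 + (0 - c.ty) ^ 2) :=
        div_pos (by linarith) (Real.sqrt_pos.2 (by positivity))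
      rw [zero_div] at this
      linarith
  rcases eq_or_lt_of_le y0 with rfl | y0
  · rcases le_or_gt c.ty (-1) with h1 | h1
    · refine Reaches.of_type (i := .p9) (vs := [pt 0 (-1)])
        ⟨hα, htx.le, h1, notMem_rect_of (Or.inl htx), rfl⟩ ?_
      rw [len_p9 h hα htx.le h1 (Or.inl htx), hval]
      apply le_of_eq; ring_nf
    · exfalso
      have := deriv_nonneg_of_right_min (hd (-1)) (by
        filter_upwards [Ioo_mem_nhdsGT (show (-1 : ℝ) < 0 by norm_num)] with y hy
        have := hmin 0 y (isExit_left h.width_pos.le htx hy.1.le hy.2.le)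
        rwa [hval, hval] at this)
      have h3 : (-1 - c.ty) / √(c.tx ^ 2 + (-1 - c.ty) ^ 2) < 0 :=
        div_neg_of_neg_of_pos (by linarith) (Real.sqrt_pos.2 (by positivity))
      have h4 : c.α * (-1 / √(c.sx ^ 2 + (-1) ^ 2)) ≤ 0 :=
        mul_nonpos_of_nonneg_of_nonpos hα0.le
          (div_nonpos_of_nonpos_of_nonneg (by norm_num) (Real.sqrt_nonneg _))
      linarith
  · refine Reaches.of_type (i := .p6) (vs := [pt 0 y]) ⟨htx, y, y0, y1, rfl⟩ ?_
    rw [len_p6 h htx y0.le y1, hval]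

/-- An exit in the open side is `p10`. At a corner, moving the exit inwards shortens one part
strictly and does not lengthen the other to first order, unless the target is not on the inner side
of the vertical line through the corner. -/
lemma reaches_bottom_of_le_one (h : c.Admissible) (hs : 0 < c.sx) (hts : c.tx ≤ c.sx) (hα : c.α ≤ 1)
    (hty : c.ty < -1) {x : ℝ} (hb : c.IsBestExit x (-1)) : c.Reaches (c.exitLen x (-1)) := by
  obtain ⟨hx, hmin⟩ := hb
  obtain ⟨x0, xW, -, -⟩ := IsExit.bounds hx
  have hα0 := h.pos
  have hW := h.width_pos
  have hsW := h.sx_le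
  have hval : ∀ x, c.exitLen x (-1) =
      c.α * √((x - c.sx) ^ 2 + 1) + √((x - c.tx) ^ 2 + (c.ty + 1) ^ 2) := by
    intro x
    rw [exitLen_of_le_one hα]
    ring_nf
  have hty2 : 0 < (c.ty + 1) ^ 2 := by nlinarith
  have hd : ∀ x, HasDerivAt (fun x => c.α * √((x - c.sx) ^ 2 + 1) + √((x - c.tx) ^ 2 + (c.ty + 1) ^ 2))
      (c.α * ((x - c.sx) / √((x - c.sx) ^ 2 + 1)) +
        (x - c.tx) / √((x - c.tx) ^ 2 + (c.ty + 1) ^ 2)) x := fun x =>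
    ((hasDerivAt_dist _ _ (by positivity)).const_mul c.α).add (hasDerivAt_dist _ _ (by positivity))
  rcases eq_or_lt_of_le x0 with rfl | x0
  · rcases le_or_gt c.tx 0 with ht | ht
    · refine Reaches.of_type (i := .p9) (vs := [pt 0 (-1)])
        ⟨hα, ht, hty.le, notMem_rect_of (Or.inr (Or.inr (Or.inl hty))), rfl⟩ ?_
      rw [len_p9 h hα ht hty.le (Or.inr hty), hval]
      apply le_of_eq; ring_nf
    · exfalso
      have := deriv_nonneg_of_right_min (hd 0) (by
        filter_upwards [Ioo_mem_nhdsGT hW] with x hx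
        have := hmin x (-1) (isExit_bottom hty hx.1.le hx.2.le)
        rwa [hval, hval] at this)
      have h3 : (0 - c.tx) / √((0 - c.tx) ^ 2 + (c.ty + 1) ^ 2) < 0 :=
        div_neg_of_neg_of_pos (by linarith) (Real.sqrt_pos.2 (by positivity))
      have h4 : c.α * ((0 - c.sx) / √((0 - c.sx) ^ 2 + 1)) ≤ 0 :=
        mul_nonpos_of_nonneg_of_nonpos hα0.le
          (div_nonpos_of_nonpos_of_nonneg (by linarith) (Real.sqrt_nonneg _))
      linarith
  rcases eq_or_lt_of_le xW with rfl | xW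
  -- Because `tx ≤ sx ≤ W`, the right corner can be optimal only if source and target are both on
  -- its vertical line; this is `p9` after reflection.
  · rcases eq_or_lt_of_le (hts.trans hsW) with ht | ht
    · have hsW' : c.sx = c.W := le_antisymm hsW (ht ▸ hts)
      refine Reaches.of_mirror_type (i := .p9) (vs := [pt 0 (-1)])
        ⟨hα, ?_, hty.le, notMem_rect_of (Or.inr (Or.inr (Or.inl hty))), rfl⟩ ?_
      · simp [Instance.mirror, ht]
      · rw [len_p9 (h.mirror true) hα (by simp [Instance.mirror, ht]) hty.le (Or.inr hty), hval]
        simp [Instance.mirror, ht, hsW']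
    · exfalso
      have := deriv_nonpos_of_left_min (hd c.W) (by
        filter_upwards [Ioo_mem_nhdsLT hW] with x hx
        have := hmin x (-1) (isExit_bottom hty hx.1.le hx.2.le)
        rwa [hval, hval] at this)
      have h3 : 0 < (c.W - c.tx) / √((c.W - c.tx) ^ 2 + (c.ty + 1) ^ 2) :=
        div_pos (by linarith) (Real.sqrt_pos.2 (by positivity))
      have h4 : 0 ≤ c.α * ((c.W - c.sx) / √((c.W - c.sx) ^ 2 + 1)) :=
        mul_nonneg hα0.le (div_nonneg (by linarith) (Real.sqrt_nonneg _))
      linarith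
  · refine Reaches.of_type (i := .p10) (vs := [pt x (-1)]) ⟨hts, hty, x, x0, xW, rfl⟩ ?_
    rw [len_p10 h hty x0 xW, hval]

lemma reaches_of_le_one (h : c.Admissible) (hs : 0 < c.sx) (hts : c.tx ≤ c.sx) (hα : c.α ≤ 1)
    {x y : ℝ} (hb : c.IsBestExit x y) : c.Reaches (c.exitLen x y) := by
  by_cases ht : pt c.tx c.ty ∈ rect c.W
  · obtain ⟨-, rfl, rfl⟩ := hb.1.resolve_right fun h => h.1 ht
    refine Reaches.of_type (i := .p12) (vs := []) ⟨ht, rfl, Or.inl hα⟩ ?_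
    rw [len_p12 h ht (Or.inl hα), exitLen_of_le_one hα]
    simp [sub_sq_comm c.sx c.tx]
  · obtain ⟨-, x0, xW, y0, y1, hc⟩ := hb.1.resolve_left fun h => ht h.1
    rcases lt_or_ge 0 c.ty with hty | hty
    · exact reaches_top_of_le_one h hs hts hα hty hb
    rcases hc with ⟨rfl, h'⟩ | ⟨rfl, h'⟩ | ⟨rfl, h'⟩
    · exact reaches_left_of_le_one h hs hα hty h' hb
    · exact reaches_bottom_of_le_one h hs hts hα h' hb
    · linarith

end Instance

end WeightedRectangle
end

noncomputable section

namespace WeightedRectangle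

open MeasureTheory Filter Topology

/-! ### Best exits for large weights -/

lemma crit_hyp {α : ℝ} (hα : 1 < α) {z : ℝ} (hz : 0 ≤ z) :
    α * √(z ^ 2 + (√(α ^ 2 - 1) * z) ^ 2) = α ^ 2 * z := by
  have hk := crit_sq hα
  rw [show z ^ 2 + (√(α ^ 2 - 1) * z) ^ 2 = (α * z) ^ 2 by rw [mul_pow, hk]; ring,
    Real.sqrt_sq (by positivity)]
  ring

/-- A segment at the critical angle to a side costs as much as its projection to the side at unit
price, plus `k` per unit of its distance from the side. Here the side is vertical and `z` is the
distance. -/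
lemma crit_hyp_div {α : ℝ} (hα : 1 < α) {z : ℝ} (hz : 0 ≤ z) :
    α * √(z ^ 2 + (z / √(α ^ 2 - 1)) ^ 2) = z / √(α ^ 2 - 1) + √(α ^ 2 - 1) * z := by
  have hk := crit_sq hα
  have hk0 := crit_pos hα
  have := crit_hyp hα (z := z / √(α ^ 2 - 1)) (by positivity)
  rw [mul_div_cancel₀ _ hk0.ne', add_comm] at this
  rw [this]
  set k := √(α ^ 2 - 1)
  field_simp
  linear_combination (-z) * hk

/-- For `sx = 0` the source is already on the left side and every `b` gives the same formula; this
is the reason for the alternative in the hypothesis. -/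
lemma leftCost_crit {α sx b : ℝ} (hα : 1 < α) (hs : 0 ≤ sx)
    (h : sx = 0 ∨ b = -(sx / √(α ^ 2 - 1))) : leftCost α sx b = -b + √(α ^ 2 - 1) * sx := by
  rw [leftCost]
  split_ifs with h0
  · rw [h0]; ring
  · rw [h.resolve_left h0, neg_sq, crit_hyp_div hα hs, neg_neg]

namespace Instance

variable {c : Instance}

lemma reaches_euclid (h : c.Admissible) (hs : 0 < c.sx) (hts : c.tx ≤ c.sx) (hα : 1 < c.α)
    (hty : 0 ≤ c.ty) : c.Reaches √((c.tx - c.sx) ^ 2 + (c.ty - 0) ^ 2) := by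
  rcases eq_or_lt_of_le hty with h0 | h0
  · have hd : √((c.tx - c.sx) ^ 2 + (c.ty - 0) ^ 2) = c.sx - c.tx := by
      rw [← h0, sub_zero, zero_pow two_ne_zero, add_zero, Real.sqrt_sq_eq_abs, abs_of_nonpos] <;>
        linarith
    rw [hd]
    rcases lt_or_ge c.tx 0 with ht | ht
    · refine Reaches.of_type (i := .p4) (vs := [pt 0 0]) ⟨hα.le, ht, h0.ge, rfl⟩ ?_
      rw [len_p4 h hα.le ht, ← h0, zero_pow two_ne_zero, add_zero, Real.sqrt_sq_eq_abs,
        abs_of_nonpos ht.le]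
      linarith
    · have hR : c.t ∈ rect c.W := mem_rect_pt.2 ⟨ht, hts.trans h.sx_le, by linarith, h0.ge⟩
      rcases eq_or_lt_of_le hts with e | e
      · have hts' : c.t = c.s := by rw [s, t, e, ← h0]
        refine Reaches.of_type (i := .p12) (vs := []) ⟨hR, rfl, Or.inr (Or.inl hts')⟩ ?_
        rw [len_p12 h hR (Or.inr (Or.inl hts')), e, ← h0]
        simp
      -- For a target on the top side every vertex between target and source gives the straight
      -- path; the type demands one strictly to the left of the source and strictly to the right of
      -- the corner.
      · refine Reaches.of_type (i := .p11) (vs := [pt ((c.tx + c.sx) / 2) 0])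
          ⟨hα, hR, _, by linarith, by linarith, rfl⟩ ?_
        rw [len_p11_top h hα.le h0.symm, abs_of_nonneg, abs_of_nonneg] <;> linarith
  · refine Reaches.of_type (i := .p1) (vs := []) ⟨rfl, h0⟩ ?_
    rw [len_p1 h h0, sub_zero]

/-- The vertices of a path of type `p7`. -/
def vertices₇ (c : Instance) : List Plane :=
  [pt 0 (if c.sx = 0 then -1 / 2 else -(c.sx / √(c.α ^ 2 - 1))), pt 0 (-1)]

lemma vertices₇_spec (h : c.Admissible) (hα : 1 < c.α) (htx : 0 ≤ c.tx) (hty : c.ty < -1)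
    (hs : c.sx < √(c.α ^ 2 - 1)) :
    HasType c c.vertices₇ .p7 ∧
      c.len c.vertices₇ = √(c.α ^ 2 - 1) * c.sx + 1 + √(c.tx ^ 2 + (c.ty + 1) ^ 2) := by
  have hk0 := crit_pos hα
  have h0 := h.sx_nonneg
  rw [vertices₇]
  -- For `sx = 0` the critical height is the source itself, which the type excludes; any other
  -- interior point of the side gives the same length.
  set b := if c.sx = 0 then -1 / 2 else -(c.sx / √(c.α ^ 2 - 1)) with hbdef
  obtain ⟨hb, hb', hc⟩ : -1 < b ∧ b < 0 ∧ (c.sx = 0 ∨ b = -(c.sx / √(c.α ^ 2 - 1))) := by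
    by_cases e : c.sx = 0
    · rw [hbdef, if_pos e]
      exact ⟨by norm_num, by norm_num, Or.inl e⟩
    · rw [hbdef, if_neg e]
      have : 0 < c.sx := lt_of_le_of_ne h0 (Ne.symm e)
      refine ⟨?_, ?_, Or.inr rfl⟩
      · rw [neg_lt_neg_iff, div_lt_one hk0]; exact hs
      · rw [neg_lt_zero]; positivity
  refine ⟨⟨hα, htx, hty, b, hb, hb', rfl⟩, ?_⟩
  rw [len_p7 h hα.le hty hb.le hb', leftCost_crit hα h0 hc]
  ring

/-- Both segments in the rectangle are taken at the critical angle, which puts the vertices on the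
left side at heights `-sx/k` and `-1 + x/k`. The hypothesis on `sx + x` says exactly that they are
in this order. For `sx = 0` the first one may be any point between the second one and the source. -/
lemma exists_p8 (h : c.Admissible) (hα : 1 < c.α) (hty : c.ty < -1) {x : ℝ} (hx : 0 < x)
    (hxW : x < c.W) (hs : c.sx + x < √(c.α ^ 2 - 1)) :
    ∃ vs, HasType c vs .p8 ∧ c.len vs = √(c.α ^ 2 - 1) * (c.sx + x) + 1 +
      √((x - c.tx) ^ 2 + (c.ty + 1) ^ 2) := by
  have hk0 := crit_pos hα
  have h0 := h.sx_nonneg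
  have hx' : 0 < x / √(c.α ^ 2 - 1) := by positivity
  have hsx : c.sx / √(c.α ^ 2 - 1) + x / √(c.α ^ 2 - 1) < 1 := by
    rw [← add_div, div_lt_one hk0]; exact hs
  have hs0 : 0 ≤ c.sx / √(c.α ^ 2 - 1) := by positivity
  obtain ⟨b, hb, hb', hc⟩ : ∃ b, -1 + x / √(c.α ^ 2 - 1) < b ∧ b < 0 ∧
      (c.sx = 0 ∨ b = -(c.sx / √(c.α ^ 2 - 1))) := by
    rcases eq_or_lt_of_le h0 with e | e
    · exact ⟨(-1 + x / √(c.α ^ 2 - 1)) / 2, by linarith, by linarith, Or.inl e.symm⟩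
    · refine ⟨_, ?_, ?_, Or.inr rfl⟩
      · linarith
      · rw [neg_lt_zero]; positivity
  refine ⟨_, ⟨hα, hty, b, _, x, ?_, hb, hb', hx, hxW, rfl⟩, ?_⟩
  · linarith
  rw [len_p8 h hα.le hty (by linarith) hb.le hb' hx hxW, leftCost_crit hα h0 hc,
    neg_add_cancel_comm, crit_hyp_div hα hx.le]
  ring

/-- The vertices of a path of type `p13`. -/
def vertices₁₃ (c : Instance) : List Plane :=
  let p := -(c.sx / √(c.α ^ 2 - 1))
  let q := c.ty + c.tx / √(c.α ^ 2 - 1)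
  [pt 0 (if c.sx = 0 then (2 * p + q) / 3 else p), pt 0 (if c.tx = 0 then (p + 2 * q) / 3 else q)]

/-- `p` and `q` are the heights at which segments at the critical angle from source and target meet
the left side; the hypothesis says `q < p`. If the source or the target is on the left side, this
height is its own and not admissible in general, so a point one third of the way into the gap
between `p` and `q` replaces it, at the same total length. -/
lemma vertices₁₃_spec (h : c.Admissible) (hα : 1 < c.α) (ht : c.t ∈ rect c.W)
    (hs : c.sx + c.tx < √(c.α ^ 2 - 1) * -c.ty) :
    HasType c c.vertices₁₃ .p13 ∧
      c.len c.vertices₁₃ = √(c.α ^ 2 - 1) * (c.sx + c.tx) - c.ty := by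
  have hk0 := crit_pos hα
  have h0 := h.sx_nonneg
  obtain ⟨t1, t2, t3, t4⟩ := mem_rect_pt.1 ht
  rw [vertices₁₃]
  set p := -(c.sx / √(c.α ^ 2 - 1)) with hp
  set q := c.ty + c.tx / √(c.α ^ 2 - 1) with hq
  have hpq : q < p := by
    have : (c.sx + c.tx) / √(c.α ^ 2 - 1) < -c.ty := by
      rw [div_lt_iff₀ hk0]; linarith
    rw [add_div] at this
    linarith
  have hp0 : p ≤ 0 := by rw [hp, neg_nonpos]; positivity
  have hq0 : c.ty ≤ q := by
    have : 0 ≤ c.tx / √(c.α ^ 2 - 1) := by positivity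
    linarith
  set b₁ := if c.sx = 0 then (2 * p + q) / 3 else p with hb₁
  set b₂ := if c.tx = 0 then (p + 2 * q) / 3 else q with hb₂
  obtain ⟨h1, h1', hc1⟩ : (2 * p + q) / 3 ≤ b₁ ∧ b₁ < 0 ∧ (c.sx = 0 ∨ b₁ = p) := by
    by_cases e : c.sx = 0
    · rw [hb₁, if_pos e]
      exact ⟨le_rfl, by linarith, Or.inl e⟩
    · rw [hb₁, if_neg e]
      have : 0 < c.sx := lt_of_le_of_ne h0 (Ne.symm e)
      refine ⟨by linarith, ?_, Or.inr rfl⟩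
      rw [hp, neg_lt_zero]; positivity
  obtain ⟨h2, h2', h2'', hc2⟩ : -1 < b₂ ∧ b₂ ≤ (p + 2 * q) / 3 ∧ c.ty ≤ b₂ ∧
      (c.tx = 0 ∨ b₂ = q) := by
    by_cases e : c.tx = 0
    · rw [hb₂, if_pos e]
      exact ⟨by linarith, le_rfl, by linarith, Or.inl e⟩
    · rw [hb₂, if_neg e]
      have e' : 0 < c.tx := lt_of_le_of_ne t1 (Ne.symm e)
      refine ⟨?_, by linarith, hq0, Or.inr rfl⟩
      have : 0 < c.tx / √(c.α ^ 2 - 1) := by positivity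
      linarith
  have h12 : b₂ < b₁ := by linarith
  refine ⟨⟨hα, ht, b₁, b₂, h2, h12, h1', rfl⟩, ?_⟩
  rw [len_p13 h hα.le ht h2 (by linarith) (by linarith) h1', leftCost_crit hα h0 hc1,
    abs_of_nonneg (by linarith)]
  have : (if c.tx = 0 then |b₂ - c.ty| else c.α * √(c.tx ^ 2 + (b₂ - c.ty) ^ 2)) =
      b₂ - c.ty + √(c.α ^ 2 - 1) * c.tx := by
    split_ifs with e
    · rw [abs_of_nonneg (by linarith), e]; ring
    · have e2 : b₂ - c.ty = c.tx / √(c.α ^ 2 - 1) := by rw [hc2.resolve_left e, hq]; ring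
      rw [e2, crit_hyp_div hα t1]
  rw [this]
  ring

lemma mirror_mem_rect (ht : c.t ∈ rect c.W) : (c.mirror true).t ∈ rect (c.mirror true).W := by
  obtain ⟨t1, t2, t3, t4⟩ := mem_rect_pt.1 ht
  exact mem_rect_pt.2 ⟨by simpa [Instance.mirror] using t2, by simpa [Instance.mirror] using t1, t3, t4⟩

lemma innerDist_eq {α W sx x y : ℝ} (hα : 1 < α) : innerDist α W sx x y =
    min (slabNorm α |sx - x| (-y)) (min (boxNorm α (sx + x) (-y)) (boxNorm α (2 * W - sx - x) (-y))) :=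
  if_neg (not_le.2 hα)

/-- Each term of the minimum in `innerDist` is reached or dominated: `slabNorm` by `p11` or `p12`,
according to the branch; `boxNorm` by `p13`, possibly reflected, in the branch where running along
the side pays. -/
lemma reaches_rect (h : c.Admissible) (hs : 0 < c.sx) (hts : c.tx ≤ c.sx) (hα : 1 < c.α)
    (hty : c.ty < 0) (ht : c.t ∈ rect c.W) : c.Reaches (innerDist c.α c.W c.sx c.tx c.ty) := by
  have hk0 := crit_pos hα
  have hα2 := h.lt_sqrt_two
  obtain ⟨t1, t2, t3, t4⟩ := mem_rect_pt.1 ht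
  have hsW := h.sx_le
  have hy : 0 ≤ -c.ty := by linarith
  rw [innerDist_eq hα, abs_of_nonneg (show 0 ≤ c.sx - c.tx by linarith)]
  have hright : 2 * c.W - c.sx - c.tx < √(c.α ^ 2 - 1) * -c.ty →
      c.Reaches (boxNorm c.α (2 * c.W - c.sx - c.tx) (-c.ty)) := by
    intro hlt
    obtain ⟨h1, h2⟩ := vertices₁₃_spec (h.mirror true) hα (mirror_mem_rect ht)
      (by simp only [Instance.mirror]; linarith)
    refine Reaches.of_mirror_type h1 ?_
    rw [h2, boxNorm_of_le hlt.le]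
    simp only [Instance.mirror]
    apply le_of_eq; ring
  -- If the target is on the right side, so is the source, and the direct segment is not in the open
  -- rectangle. Going straight down the side is then optimal, and this is a degenerate `p13` after
  -- reflection.
  rcases eq_or_lt_of_le t2 with e | e
  · have e' : c.sx = c.W := le_antisymm hsW (e ▸ hts)
    refine (hright ?_).mono ?_
    · have : 0 < √(c.α ^ 2 - 1) * -c.ty := mul_pos hk0 (by linarith)
      linarith
    · rw [show 2 * c.W - c.sx - c.tx = 0 by linarith, boxNorm_of_le (by positivity), mul_zero, zero_add]
      refine le_min ?_ (le_min ?_ ?_)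
      · have := le_slabNorm (a := 0) (b := 1) hα (show 0 ≤ c.sx - c.tx by linarith) hy zero_le_one
          (by nlinarith)
        linarith
      · have := le_boxNorm (a := 0) (b := 1) hα (show 0 ≤ c.sx + c.tx by linarith) hy zero_le_one le_rfl
          (by nlinarith)
        linarith
      · have := le_boxNorm (a := 0) (b := 1) hα (le_refl (0 : ℝ)) hy zero_le_one le_rfl
          (by nlinarith)
        linarith
  · have hA : c.Reaches (slabNorm c.α (c.sx - c.tx) (-c.ty)) := by
      rcases lt_or_ge (-c.ty) (√(c.α ^ 2 - 1) * (c.sx - c.tx)) with hlt | hge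
      · have h1 : 0 < -c.ty / √(c.α ^ 2 - 1) := div_pos (by linarith) hk0
        have h2 : -c.ty / √(c.α ^ 2 - 1) < c.sx - c.tx := by
          rw [div_lt_iff₀ hk0]; linarith
        refine Reaches.of_type (i := .p11) (vs := [pt (c.tx + -c.ty / √(c.α ^ 2 - 1)) 0])
          ⟨hα, ht, _, by linarith, by linarith, rfl⟩ ?_
        rw [len_p11 h hα.le ht hty (by linarith) (by linarith), slabNorm_of_le hlt.le,
          add_sub_cancel_left, add_comm ((-c.ty / √(c.α ^ 2 - 1)) ^ 2), ← neg_sq c.ty,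
          crit_hyp_div hα hy]
        linarith
      · have hopen := (openSegment_subset_openRect_iff h ht).2 ⟨hty, by linarith, by linarith⟩
        refine Reaches.of_type (i := .p12) (vs := []) ⟨ht, rfl, Or.inr (Or.inr hopen)⟩ ?_
        rw [len_p12 h ht (Or.inr (Or.inr hopen)), slabNorm_of_ge hα (by linarith) hge, neg_sq]
    -- Where running along a vertical side does not pay, `boxNorm` is `slabNorm` of a longer
    -- displacement, so avoiding the side is no worse.
    have hbox : ∀ D, c.sx - c.tx ≤ D → √(c.α ^ 2 - 1) * -c.ty ≤ D →
        c.Reaches (boxNorm c.α D (-c.ty)) := fun D hD h' => hA.mono (by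
      rw [boxNorm_of_ge hα hα2 hy h']
      exact slabNorm_mono hα (by linarith) hD hy)
    rcases min_choice (slabNorm c.α (c.sx - c.tx) (-c.ty)) (min (boxNorm c.α (c.sx + c.tx) (-c.ty))
      (boxNorm c.α (2 * c.W - c.sx - c.tx) (-c.ty))) with e1 | e1
    · rw [e1]; exact hA
    rw [e1]
    rcases min_choice (boxNorm c.α (c.sx + c.tx) (-c.ty))
      (boxNorm c.α (2 * c.W - c.sx - c.tx) (-c.ty)) with e2 | e2
    · rw [e2]
      rcases lt_or_ge (c.sx + c.tx) (√(c.α ^ 2 - 1) * -c.ty) with hlt | hge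
      · obtain ⟨h1, h2⟩ := vertices₁₃_spec h hα ht hlt
        refine Reaches.of_type h1 ?_
        rw [h2, boxNorm_of_le hlt.le]
        apply le_of_eq; ring
      · exact hbox _ (by linarith) hge
    · rw [e2]
      rcases lt_or_ge (2 * c.W - c.sx - c.tx) (√(c.α ^ 2 - 1) * -c.ty) with hlt | hge
      · exact hright hlt
      · exact hbox _ (by linarith) hge

/-! ### Large weights: exits on the left and on the bottom side -/

lemma innerDist_left {α W sx y : ℝ} (hα : 1 < α) (h2 : α < √2) (hs : 0 ≤ sx) (hsW : sx ≤ W)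
    (hy : y ≤ 0) : innerDist α W sx 0 y = boxNorm α sx (-y) := by
  have hy' : 0 ≤ -y := by linarith
  rw [innerDist_eq hα, sub_zero, sub_zero, add_zero, abs_of_nonneg hs, min_eq_right, min_eq_left]
  · exact boxNorm_mono hα h2 hs (by linarith) hy'
  · exact (min_le_left _ _).trans (boxNorm_le_slabNorm hα h2 hs hy')

lemma exitLen_bottom_le (hα : 1 < c.α) {x : ℝ} (hxs : x ≤ c.sx) :
    c.exitLen x (-1) ≤ slabNorm c.α (c.sx - x) 1 + √((x - c.tx) ^ 2 + (c.ty + 1) ^ 2) := by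
  rw [exitLen, innerDist_eq hα, abs_of_nonneg (by linarith), neg_neg]
  refine add_le_add (min_le_left _ _) (le_of_eq ?_)
  congr 1; ring

/-- The branches of `boxNorm` describe how `(0, y)` is reached. Down the left side: impossible.
Along the top side and then at the critical angle: `p4` or `p5`. Straight: `p6`. In the last two the
bottom corner has to be excluded. For all this, any function that bounds the inner distance from
above on one side of the exit and agrees with it there gives a valid one-sided derivative test. -/
lemma reaches_left (h : c.Admissible) (hs : 0 < c.sx) (hα : 1 < c.α)
    (hty : c.ty < 0) (htx : c.tx < 0) {y : ℝ} (hb : c.IsBestExit 0 y) :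
    c.Reaches (c.exitLen 0 y) := by
  obtain ⟨hx, hmin⟩ := hb
  obtain ⟨-, -, y0, y1⟩ := IsExit.bounds hx
  have hα2 := h.lt_sqrt_two
  have hk := crit_sq hα
  have hk0 := crit_pos hα
  have hk1 := crit_lt_one hα hα2
  have hval : ∀ y ≤ 0, c.exitLen 0 y = boxNorm c.α c.sx (-y) + √(c.tx ^ 2 + (y - c.ty) ^ 2) := by
    intro y hy
    rw [exitLen, innerDist_left hα hα2 hs.le h.sx_le hy, zero_sub, neg_sq]
  have htx2 : 0 < c.tx ^ 2 := by nlinarith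
  have hd : ∀ y, HasDerivAt (fun y => √(c.tx ^ 2 + (y - c.ty) ^ 2))
      ((y - c.ty) / √(c.tx ^ 2 + (y - c.ty) ^ 2)) y := fun y => hasDerivAt_dist' _ _ (by positivity)
  have hρ : ∀ y, 0 < √(c.tx ^ 2 + (y - c.ty) ^ 2) := fun y => Real.sqrt_pos.2 (by positivity)
  -- moving along the left side
  have hup : ∀ {f : ℝ → ℝ} {f' r : ℝ}, y < r → r ≤ 0 → HasDerivAt f f' y →
      boxNorm c.α c.sx (-y) = f y → (∀ x, y < x → x < r → boxNorm c.α c.sx (-x) ≤ f x) →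
      0 ≤ f' + (y - c.ty) / √(c.tx ^ 2 + (y - c.ty) ^ 2) := by
    intro f f' r hr hr0 hf he hle
    refine deriv_nonneg_of_right_min (hf.add (hd y)) ?_
    filter_upwards [Ioo_mem_nhdsGT hr] with x hx
    have := hmin 0 x (isExit_left h.width_pos.le htx (y0.trans hx.1.le) (hx.2.le.trans hr0))
    rw [hval _ (hx.2.le.trans hr0), hval _ y1, he] at this
    exact this.trans (add_le_add (hle x hx.1 hx.2) le_rfl)
  rcases lt_or_ge c.sx (√(c.α ^ 2 - 1) * -y) with h3 | h3
  -- Leaving the side earlier saves one per unit of length, while the outer segment grows at a rate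
  -- below one because `tx ≠ 0`.
  · exfalso
    have hy : y < 0 := by nlinarith
    have := hup (f := fun x => √(c.α ^ 2 - 1) * c.sx + -x) (r := -(c.sx / √(c.α ^ 2 - 1)))
      (by rw [lt_neg, div_lt_iff₀ hk0]; linarith)
      (by rw [neg_nonpos]; positivity) ((hasDerivAt_neg y).const_add _)
      (boxNorm_of_le h3.le) (fun x _ hx => by
        rw [boxNorm_of_le]
        rw [lt_neg, div_lt_iff₀ hk0] at hx
        linarith)
    have h4 : (y - c.ty) / √(c.tx ^ 2 + (y - c.ty) ^ 2) < 1 := by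
      rw [div_lt_one (hρ y)]; exact lt_sqrt_add_sq _ htx2
    linarith
  rcases lt_or_ge (-y) (√(c.α ^ 2 - 1) * c.sx) with h1 | h1
  · have hb1 : ∀ x, y ≤ x → x ≤ 0 →
        boxNorm c.α c.sx (-x) ≤ c.sx + √(c.α ^ 2 - 1) * -x := fun x hx hx0 =>
      (boxNorm_le_slabNorm hα hα2 hs.le (by linarith)).trans (slabNorm_of_le (by linarith)).le
    have hb2 : boxNorm c.α c.sx (-y) = c.sx + √(c.α ^ 2 - 1) * -y := by
      rw [boxNorm_of_ge hα hα2 (by linarith) h3, slabNorm_of_le h1.le]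
    rcases eq_or_lt_of_le y1 with rfl | y1
    · refine Reaches.of_type (i := .p4) (vs := [pt 0 0]) ⟨hα.le, htx, hty.le, rfl⟩ ?_
      rw [len_p4 h hα.le htx, hval 0 le_rfl, hb2]
      simp
    rcases eq_or_lt_of_le y0 with rfl | y0
    · exfalso
      rcases le_or_gt (-1) c.ty with hty1 | hty1
      · have := hup (f := fun x => c.sx + √(c.α ^ 2 - 1) * -x) (r := 0) (by norm_num) le_rfl
          (((hasDerivAt_neg _).const_mul _).const_add _) hb2 (fun x hx hx' => hb1 x hx.le hx'.le)
        have h4 : (-1 - c.ty) / √(c.tx ^ 2 + (-1 - c.ty) ^ 2) ≤ 0 :=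
          div_nonpos_of_nonpos_of_nonneg (by linarith) (Real.sqrt_nonneg _)
        linarith
      -- The corner is also an exit on the bottom side. Moving along that side to the right saves
      -- one per unit on the top side and costs less than one outside, because the target is
      -- strictly below.
      · have hty2 : 0 < (c.ty + 1) ^ 2 := by nlinarith
        have hlt : 0 < c.sx - 1 / √(c.α ^ 2 - 1) := by
          rw [sub_pos, div_lt_iff₀ hk0]; linarith
        have := deriv_nonneg_of_right_min (f := fun x => (c.sx - x) + √(c.α ^ 2 - 1) * 1 +
            √((x - c.tx) ^ 2 + (c.ty + 1) ^ 2)) (a := 0)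
          ((((hasDerivAt_id (0 : ℝ)).const_sub c.sx).add_const _).add
            (hasDerivAt_dist _ _ (by positivity))) (by
          filter_upwards [Ioo_mem_nhdsGT hlt] with x hx
          have hk' : 0 < 1 / √(c.α ^ 2 - 1) := by positivity
          have e1 := hmin x (-1) (isExit_bottom hty1 hx.1.le (by linarith [h.sx_le, hx.2]))
          have e2 := exitLen_bottom_le hα (c := c) (x := x) (by linarith [hx.2])
          rw [slabNorm_of_le] at e2
          · rw [hval _ (by norm_num), hb2] at e1
            have e3 : √(c.tx ^ 2 + (-1 - c.ty) ^ 2) = √((0 - c.tx) ^ 2 + (c.ty + 1) ^ 2) := by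
              congr 1; ring
            rw [e3] at e1
            linarith
          · have := hx.2
            rw [lt_sub_comm, div_lt_iff₀ hk0] at this
            linarith)
        have h4 : (0 - c.tx) / √((0 - c.tx) ^ 2 + (c.ty + 1) ^ 2) < 1 := by
          rw [div_lt_one (Real.sqrt_pos.2 (by positivity))]; exact lt_sqrt_sq_add _ hty2
        linarith
    · have hlt : -y / √(c.α ^ 2 - 1) < c.sx := by rw [div_lt_iff₀ hk0]; linarith
      have hpos : 0 < -y / √(c.α ^ 2 - 1) := div_pos (by linarith) hk0
      refine Reaches.of_type (i := .p5) (vs := [pt (-y / √(c.α ^ 2 - 1)) 0, pt 0 y])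
        ⟨hα, htx, _, y, hpos, hlt, y0, y1, rfl⟩ ?_
      rw [len_p5 h hα.le htx hpos hlt.le y0 y1, hval y y1.le, hb2, ← neg_sq y,
        add_comm ((-y / √(c.α ^ 2 - 1)) ^ 2), crit_hyp_div hα (by linarith)]
      linarith
  · have hb2 : boxNorm c.α c.sx (-y) = c.α * √(c.sx ^ 2 + y ^ 2) := by
      rw [boxNorm_of_ge hα hα2 (by linarith) h3, slabNorm_of_ge hα hs.le h1, neg_sq]
    have hy : y < 0 := by nlinarith
    rcases eq_or_lt_of_le y0 with rfl | y0
    · exfalso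
      have hu := hup (f := fun x => c.α * √(c.sx ^ 2 + x ^ 2)) (r := 0) (by norm_num) le_rfl
        ((hasDerivAt_norm _ (by positivity)).const_mul _) hb2 (fun x _ hx' => by
          have := (boxNorm_le_slabNorm hα hα2 hs.le (y := -x) (by linarith)).trans
            (slabNorm_le hα hs.le (by linarith))
          rwa [neg_sq] at this)
      have hr : 0 < √(c.sx ^ 2 + (-1) ^ 2) := Real.sqrt_pos.2 (by positivity)
      have h5 : c.α * (-1 / √(c.sx ^ 2 + (-1) ^ 2)) < 0 :=
        mul_neg_of_pos_of_neg (by linarith) (div_neg_of_neg_of_pos (by norm_num) hr)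
      rcases le_or_gt (-1) c.ty with hty1 | hty1
      · have h4 : (-1 - c.ty) / √(c.tx ^ 2 + (-1 - c.ty) ^ 2) ≤ 0 :=
          div_nonpos_of_nonpos_of_nonneg (by linarith) (Real.sqrt_nonneg _)
        linarith
      · have hty2 : 0 < (c.ty + 1) ^ 2 := by nlinarith
        have e3 : √((0 - c.tx) ^ 2 + (c.ty + 1) ^ 2) = √(c.tx ^ 2 + (-1 - c.ty) ^ 2) := by
          congr 1; ring
        have e4 : √((0 - c.sx) ^ 2 + 1) = √(c.sx ^ 2 + (-1) ^ 2) := by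
          congr 1; ring
        have hr' := deriv_nonneg_of_right_min (f := fun x => c.α * √((x - c.sx) ^ 2 + 1) +
            √((x - c.tx) ^ 2 + (c.ty + 1) ^ 2)) (a := 0)
          (((hasDerivAt_dist _ _ (by positivity)).const_mul _).add
            (hasDerivAt_dist _ _ (by positivity))) (by
          filter_upwards [Ioo_mem_nhdsGT hs] with x hx
          have e1 := hmin x (-1) (isExit_bottom hty1 hx.1.le (hx.2.le.trans h.sx_le))
          have e2 := exitLen_bottom_le hα (c := c) (x := x) hx.2.le
          have e5 := slabNorm_le hα (D := c.sx - x) (by linarith [hx.2]) zero_le_one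
          rw [hval _ (by norm_num), hb2] at e1
          rw [e3, e4]
          rw [sub_sq_comm, one_pow] at e5
          linarith)
        rw [e3, e4] at hr'
        have hρ1 := hρ (-1)
        have hrr : √(c.sx ^ 2 + (-1) ^ 2) ^ 2 = c.sx ^ 2 + (-1) ^ 2 := Real.sq_sqrt (by positivity)
        have hρρ : √(c.tx ^ 2 + (-1 - c.ty) ^ 2) ^ 2 = c.tx ^ 2 + (-1 - c.ty) ^ 2 :=
          Real.sq_sqrt (by positivity)
        set r := √(c.sx ^ 2 + (-1) ^ 2)
        set ρ := √(c.tx ^ 2 + (-1 - c.ty) ^ 2)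
        -- At the corner, moving up gives a refraction inequality for the vertical components,
        -- moving right one for the horizontal components. Squaring and adding them yields `α² ≤ 1`:
        -- no ray leaves the denser medium through the corner without a cheaper way nearby.
        have a1 : c.α / r ≤ (-1 - c.ty) / ρ := by
          have : c.α * (-1 / r) = -(c.α / r) := by ring
          linarith
        have a2 : c.α * c.sx / r ≤ -c.tx / ρ := by
          have e6 : c.α * ((0 - c.sx) / r) = -(c.α * c.sx / r) := by ring
          have e7 : (0 - c.tx) / ρ = -c.tx / ρ := by ring
          linarith
        have a1' : (c.α / r) ^ 2 ≤ ((-1 - c.ty) / ρ) ^ 2 := pow_le_pow_left₀ (by positivity) a1 2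
        have a2' : (c.α * c.sx / r) ^ 2 ≤ (-c.tx / ρ) ^ 2 := pow_le_pow_left₀ (by positivity) a2 2
        have s1 : (c.α / r) ^ 2 + (c.α * c.sx / r) ^ 2 = c.α ^ 2 := by
          field_simp
          rw [hrr]; ring
        have s2 : ((-1 - c.ty) / ρ) ^ 2 + (-c.tx / ρ) ^ 2 = 1 := by
          field_simp
          rw [hρρ]; ring
        nlinarith
    · refine Reaches.of_type (i := .p6) (vs := [pt 0 y]) ⟨htx, y, y0, hy, rfl⟩ ?_
      rw [len_p6 h htx y0.le hy, hval y y1, hb2]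

/-- The left corner with `tx < 0` is not covered here, since it is also an exit on the left side.
Otherwise the term that realizes the minimum `F` decides: `p10` if no vertical side is touched, `p7`
or `p8` if one is, reflected for the right side. -/
lemma reaches_bottom (h : c.Admissible) (hs : 0 < c.sx) (hts : c.tx ≤ c.sx) (hα : 1 < c.α)
    (hty : c.ty < -1) {x : ℝ} (hx0 : 0 < x ∨ 0 ≤ c.tx) (hb : c.IsBestExit x (-1)) :
    c.Reaches (c.exitLen x (-1)) := by
  obtain ⟨hx, hmin⟩ := hb
  obtain ⟨x0, xW, -, -⟩ := IsExit.bounds hx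
  have hα2 := h.lt_sqrt_two
  have hk := crit_sq hα
  have hk0 := crit_pos hα
  have hk1 := crit_lt_one hα hα2
  have hW := h.width_pos
  have hsW := h.sx_le
  have hty2 : 0 < (c.ty + 1) ^ 2 := by nlinarith
  have hval : ∀ x, c.exitLen x (-1) = min (slabNorm c.α |c.sx - x| 1)
      (min (boxNorm c.α (c.sx + x) 1) (boxNorm c.α (2 * c.W - c.sx - x) 1)) +
      √((x - c.tx) ^ 2 + (c.ty + 1) ^ 2) := by
    intro x
    rw [exitLen, innerDist_eq hα, neg_neg]
    congr 2; ring
  have hd : ∀ x, HasDerivAt (fun x => √((x - c.tx) ^ 2 + (c.ty + 1) ^ 2))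
      ((x - c.tx) / √((x - c.tx) ^ 2 + (c.ty + 1) ^ 2)) x := fun x =>
    hasDerivAt_dist _ _ (by positivity)
  have hρ : ∀ x, 0 < √((x - c.tx) ^ 2 + (c.ty + 1) ^ 2) := fun x => Real.sqrt_pos.2 (by positivity)
  have hmin' : ∀ x', 0 ≤ x' → x' ≤ c.W → c.exitLen x (-1) ≤ c.exitLen x' (-1) := fun x' h1 h2 =>
    hmin x' (-1) (isExit_bottom hty h1 h2)
  have hle : ∀ x, min (slabNorm c.α |c.sx - x| 1) (min (boxNorm c.α (c.sx + x) 1)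
      (boxNorm c.α (2 * c.W - c.sx - x) 1)) ≤ boxNorm c.α (c.sx + x) 1 := fun x =>
    (min_le_right _ _).trans (min_le_left _ _)
  have hle' : ∀ x, min (slabNorm c.α |c.sx - x| 1) (min (boxNorm c.α (c.sx + x) 1)
      (boxNorm c.α (2 * c.W - c.sx - x) 1)) ≤ boxNorm c.α (2 * c.W - c.sx - x) 1 := fun x =>
    (min_le_right _ _).trans (min_le_right _ _)
  set F := min (slabNorm c.α |c.sx - x| 1) (min (boxNorm c.α (c.sx + x) 1)
      (boxNorm c.α (2 * c.W - c.sx - x) 1)) with hF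
  have hright : ∀ {f : ℝ → ℝ} {f' r : ℝ}, x < r → r ≤ c.W → HasDerivAt f f' x → F = f x →
      (∀ z, x < z → z < r → slabNorm c.α |c.sx - z| 1 ≤ f z) →
      0 ≤ f' + (x - c.tx) / √((x - c.tx) ^ 2 + (c.ty + 1) ^ 2) := by
    intro f f' r hr hr0 hf he hle
    refine deriv_nonneg_of_right_min (hf.add (hd x)) ?_
    filter_upwards [Ioo_mem_nhdsGT hr] with z hz
    have := hmin' z (x0.trans hz.1.le) (hz.2.le.trans hr0)
    rw [hval, hval z, ← hF, he] at this
    exact this.trans (add_le_add ((min_le_left _ _).trans (hle z hz.1 hz.2)) le_rfl)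
  -- no side has been touched
  have hslab : F = slabNorm c.α |c.sx - x| 1 → c.Reaches (c.exitLen x (-1)) := by
    intro hF1
    -- An exit to the right of the source is worse than the point below the source: the inner part
    -- does not grow, and the outer part shrinks.
    rcases lt_or_ge c.sx x with hsx | hsx
    · exfalso
      have h1 := hmin' c.sx hs.le hsW
      rw [hval, hval c.sx, ← hF, hF1] at h1
      have h2 : slabNorm c.α |c.sx - c.sx| 1 ≤ slabNorm c.α |c.sx - x| 1 :=
        slabNorm_mono hα (abs_nonneg _) (by simp) zero_le_one
      have h3 : √((c.sx - c.tx) ^ 2 + (c.ty + 1) ^ 2) < √((x - c.tx) ^ 2 + (c.ty + 1) ^ 2) := by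
        refine Real.sqrt_lt_sqrt (by positivity) ?_
        nlinarith
      have h4 := min_le_left (slabNorm c.α |c.sx - c.sx| 1) (min (boxNorm c.α (c.sx + c.sx) 1)
        (boxNorm c.α (2 * c.W - c.sx - c.sx) 1))
      linarith
    rw [abs_of_nonneg (by linarith)] at hF1
    rcases lt_or_ge 1 (√(c.α ^ 2 - 1) * (c.sx - x)) with h1 | h1
    · exfalso
      have hlt : x < c.sx - 1 / √(c.α ^ 2 - 1) := by
        rw [lt_sub_comm, div_lt_iff₀ hk0]; linarith
      have hk' : 0 < 1 / √(c.α ^ 2 - 1) := by positivity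
      have := hright (f := fun z => (c.sx - z) + √(c.α ^ 2 - 1) * 1) hlt (by linarith)
        (((hasDerivAt_id x).const_sub c.sx).add_const _)
        (by rw [hF1, slabNorm_of_le h1.le])
        (fun z _ hz => by
          rw [abs_of_nonneg (by linarith), slabNorm_of_le]
          rw [lt_sub_comm, div_lt_iff₀ hk0] at hz
          linarith)
      have h4 : (x - c.tx) / √((x - c.tx) ^ 2 + (c.ty + 1) ^ 2) < 1 := by
        rw [div_lt_one (hρ x)]; exact lt_sqrt_sq_add _ hty2
      linarith
    have hF2 : F = c.α * √((x - c.sx) ^ 2 + 1) := by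
      rw [hF1, slabNorm_of_ge hα (by linarith) h1, sub_sq_comm, one_pow]
    rcases eq_or_lt_of_le x0 with rfl | x0
    · exfalso
      have htx := hx0.resolve_left (lt_irrefl _)
      have := hright (f := fun z => c.α * √((z - c.sx) ^ 2 + 1)) hs hsW
        ((hasDerivAt_dist _ _ (by positivity)).const_mul _) hF2 (fun z _ hz => by
          have := slabNorm_le hα (abs_nonneg (c.sx - z)) zero_le_one
          rwa [sq_abs, sub_sq_comm, one_pow] at this)
      have h4 : (0 - c.tx) / √((0 - c.tx) ^ 2 + (c.ty + 1) ^ 2) ≤ 0 :=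
        div_nonpos_of_nonpos_of_nonneg (by linarith) (Real.sqrt_nonneg _)
      have h5 : c.α * ((0 - c.sx) / √((0 - c.sx) ^ 2 + 1)) < 0 :=
        mul_neg_of_pos_of_neg (by linarith)
          (div_neg_of_neg_of_pos (by linarith) (Real.sqrt_pos.2 (by positivity)))
      linarith
    rcases eq_or_lt_of_le xW with rfl | xW
    -- Here source and exit are both on the right side, and running down that side costs `1 < α`.
    · exfalso
      have e : c.sx = c.W := le_antisymm hsW hsx
      have h5 := hle' c.W
      rw [← hF, hF2, e, show 2 * c.W - c.W - c.W = 0 by ring, boxNorm_of_le (by positivity)] at h5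
      simp at h5
      linarith
    · refine Reaches.of_type (i := .p10) (vs := [pt x (-1)]) ⟨hts, hty, x, x0, xW, rfl⟩ ?_
      rw [len_p10 h hty x0 xW, hval, ← hF, hF2]
  have hbox : ∀ D, |c.sx - x| ≤ D → F = boxNorm c.α D 1 → √(c.α ^ 2 - 1) ≤ D →
      c.Reaches (c.exitLen x (-1)) := by
    intro D hD he hkD
    refine hslab (le_antisymm (min_le_left _ _) ?_)
    rw [he, boxNorm_of_ge hα hα2 zero_le_one (by simpa using hkD)]
    exact slabNorm_mono hα (abs_nonneg _) hD zero_le_one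
  -- the left side has been touched
  have hleft : F = boxNorm c.α (c.sx + x) 1 → c.Reaches (c.exitLen x (-1)) := by
    intro he
    rcases lt_or_ge (c.sx + x) (√(c.α ^ 2 - 1)) with hlt | hge
    · have he' : F = √(c.α ^ 2 - 1) * (c.sx + x) + 1 := by
        rw [he, boxNorm_of_le (by linarith)]
      rcases eq_or_lt_of_le x0 with e | x0
      · obtain ⟨h1, h2⟩ := vertices₇_spec h hα (hx0.resolve_left (by rw [← e]; exact lt_irrefl _)) hty
          (by linarith)
        refine Reaches.of_type h1 ?_
        rw [h2, hval, ← hF, he', ← e]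
        simp
      rcases eq_or_lt_of_le xW with e | xW
      -- At the right corner, moving the exit to the left shortens the way from the left side at
      -- rate `k` and does not lengthen the outer segment, as `tx ≤ W`.
      · exfalso
        have hd' : HasDerivAt (fun z => √(c.α ^ 2 - 1) * (c.sx + z) + 1) (√(c.α ^ 2 - 1) * 1) x :=
          (((hasDerivAt_id x).const_add c.sx).const_mul _).add_const _
        have := deriv_nonpos_of_left_min (hd'.add (hd x)) (by
          filter_upwards [Ioo_mem_nhdsLT x0] with z hz
          have := hmin' z hz.1.le (hz.2.le.trans xW)
          rw [hval, hval z, ← hF, he'] at this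
          refine this.trans (add_le_add ((hle z).trans ?_) le_rfl)
          rw [boxNorm_of_le (by linarith [hz.2])])
        have h4 : 0 ≤ (x - c.tx) / √((x - c.tx) ^ 2 + (c.ty + 1) ^ 2) :=
          div_nonneg (by linarith) (Real.sqrt_nonneg _)
        linarith
      · obtain ⟨vs, h1, h2⟩ := exists_p8 h hα hty x0 xW hlt
        refine Reaches.of_type h1 ?_
        rw [h2, hval, ← hF, he']
    · exact hbox _ (by rw [abs_le]; constructor <;> linarith) he hge
  rcases min_choice (slabNorm c.α |c.sx - x| 1) (min (boxNorm c.α (c.sx + x) 1)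
      (boxNorm c.α (2 * c.W - c.sx - x) 1)) with e1 | e1
  · exact hslab (hF.trans e1)
  rcases min_choice (boxNorm c.α (c.sx + x) 1) (boxNorm c.α (2 * c.W - c.sx - x) 1) with e2 | e2
  · exact hleft (hF.trans (e1.trans e2))
  have he : F = boxNorm c.α (2 * c.W - c.sx - x) 1 := hF.trans (e1.trans e2)
  rcases lt_or_ge (2 * c.W - c.sx - x) (√(c.α ^ 2 - 1)) with hlt | hge
  · have he' : F = √(c.α ^ 2 - 1) * (2 * c.W - c.sx - x) + 1 := by
      rw [he, boxNorm_of_le (by linarith)]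
    rcases eq_or_lt_of_le x0 with e | x0
    -- For an exit at the left corner, a way that touches the left side is at most as long as one
    -- that touches the right side, since `sx ≤ 2 W - sx`.
    · refine hleft (le_antisymm (hle x) ?_)
      rw [he]
      exact boxNorm_mono hα hα2 (by linarith) (by linarith) zero_le_one
    rcases eq_or_lt_of_le xW with e | xW
    · obtain ⟨h1, h2⟩ := vertices₇_spec (h.mirror true) hα
        (by simp only [Instance.mirror]; linarith) hty (by simp only [Instance.mirror]; linarith)
      refine Reaches.of_mirror_type h1 ?_
      rw [h2, hval, ← hF, he', e]
      simp only [Instance.mirror]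
      apply le_of_eq; ring_nf
    · obtain ⟨vs, h1, h2⟩ := exists_p8 (h.mirror true) hα hty (x := c.W - x)
        (by linarith) (by simp only [Instance.mirror]; linarith)
        (by simp only [Instance.mirror]; linarith)
      refine Reaches.of_mirror_type h1 ?_
      rw [h2, hval, ← hF, he']
      simp only [Instance.mirror]
      apply le_of_eq; ring_nf
  · exact hbox _ (by rw [abs_le]; constructor <;> linarith) he hge

/-! ### Some shortest path is of one of the types -/

lemma exists_isShortest_of_left (h : c.Admissible) (hs : 0 < c.sx) (hts : c.tx ≤ c.sx) :
    ∃ (i : PathType) (m : Bool) (vs : List Plane),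
      HasType (c.mirror m) (vs.map (c.mirrorPt m)) i ∧ c.IsShortest vs := by
  have key : ∀ d, c.Reaches d → (∀ δ, IsPath δ c.s c.t → d ≤ weightedLength c.α c.W δ) →
      ∃ (i : PathType) (m : Bool) (vs : List Plane),
        HasType (c.mirror m) (vs.map (c.mirrorPt m)) i ∧ c.IsShortest vs := by
    rintro d ⟨i, m, vs, h1, h2⟩ hd
    refine ⟨i, m, vs.map (c.mirrorPt m), by rwa [map_mirrorPt_map_mirrorPt], ?_⟩
    refine isShortest_of_le ?_ hd
    rwa [← len_mirror c m, map_mirrorPt_map_mirrorPt]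
  have htW : c.tx ≤ c.W := hts.trans h.sx_le
  -- In this case no weight is below one, and the straight line to the target avoids the open
  -- rectangle, so no exit analysis is needed.
  by_cases hE : 1 < c.α ∧ 0 ≤ c.ty
  · exact key _ (reaches_euclid h hs hts hE.1 hE.2) fun δ hδ =>
      dist_le_weightedLength hE.1.le hδ
  obtain ⟨x, y, hb⟩ := exists_isBestExit h htW
  refine key (c.exitLen x y) ?_ fun δ hδ => ?_
  · rcases le_or_gt c.α 1 with hα | hα
    · exact reaches_of_le_one h hs hts hα hb
    have hty : c.ty < 0 := by
      by_contra! h'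
      exact hE ⟨hα, h'⟩
    rcases hb.1 with ⟨ht, rfl, rfl⟩ | ⟨ht, x0, xW, y0, y1, hc⟩
    · refine (reaches_rect h hs hts hα hty ht).mono ?_
      rw [exitLen]; simp
    rcases hc with ⟨rfl, htx⟩ | ⟨rfl, hty1⟩ | ⟨rfl, h'⟩
    · exact reaches_left h hs hα hty htx hb
    -- The bottom-left corner with `tx < 0` is treated as an exit on the left side.
    · by_cases hx0 : 0 < x ∨ 0 ≤ c.tx
      · exact reaches_bottom h hs hts hα hty1 hx0 hb
      · push Not at hx0
        obtain rfl : x = 0 := le_antisymm hx0.1 x0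
        exact reaches_left h hs hα hty hx0.2 hb
    · linarith
  · obtain ⟨x', y', h1, h2⟩ := exists_exit_le h htW hδ
    exact (hb.2 x' y' h1).trans h2

theorem exists_isShortest (h : c.Admissible) :
    ∃ (i : PathType) (m : Bool) (vs : List Plane),
      HasType (c.mirror m) (vs.map (c.mirrorPt m)) i ∧ c.IsShortest vs := by
  rcases h.2.2.2.2.2 with ⟨h1, h2⟩ | ⟨h1, h2⟩
  · exact exists_isShortest_of_left h h1 h2
  · obtain ⟨i, m, vs, h3, h4⟩ := exists_isShortest_of_left (h.mirror true)
      (by simp only [Instance.mirror]; linarith) (by simp only [Instance.mirror]; linarith)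
    have h5 := h4.mirror true
    rw [mirror_mirror, mirrorPt_mirror] at h5
    refine ⟨i, !m, vs.map (c.mirrorPt true), ?_, h5⟩
    rw [mirrorPt_mirror] at h3
    cases m
    · rw [Bool.not_false, map_mirrorPt_map_mirrorPt]
      rwa [show c.mirrorPt false = id from rfl, List.map_id] at h3
    · rw [Bool.not_true, show c.mirrorPt false = id from rfl, List.map_id]
      rw [mirror_mirror] at h3
      exact h3

end Instance

end WeightedRectangle
end

noncomputable section

namespace WeightedRectangle

/-! ### Functions that are computed by programs -/

/-- The test of the machine. -/
def TestLE (x y : ℂ) : Prop := (y - x).im = 0 ∧ 0 ≤ (y - x).re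

/-- The input numbers. -/
def inputs : List (Instance → ℂ) :=
  [fun c => (c.α : ℂ), fun c => (c.W : ℂ), fun c => (c.sx : ℂ), fun c => (c.tx : ℂ),
    fun c => (c.ty : ℂ)]

open Classical in
/-- The functions of the input that can be computed by the machine; division by zero gives zero. -/
inductive Alg : (Instance → ℂ) → Prop
  | input {f} (h : f ∈ inputs) : Alg f
  | const (q : ℚ) : Alg fun _ => (q : ℂ)
  | add {f g} (hf : Alg f) (hg : Alg g) : Alg fun c => f c + g c
  | sub {f g} (hf : Alg f) (hg : Alg g) : Alg fun c => f c - g c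
  | mul {f g} (hf : Alg f) (hg : Alg g) : Alg fun c => f c * g c
  | div {f g} (hf : Alg f) (hg : Alg g) : Alg fun c => f c / g c
  | root {f} (k : ℕ) (hk : 2 ≤ k) (hf : Alg f) : Alg fun c => f c ^ (1 / (k : ℂ))
  | ite {f g h k} (hf : Alg f) (hg : Alg g) (hh : Alg h) (hk : Alg k) :
      Alg fun c => if TestLE (f c) (g c) then h c else k c

/-- On the instances in `S`, some register contains the value of `f`. -/
def Holds (S : Instance → Prop) (r : Instance → List ℂ) (f : Instance → ℂ) : Prop :=
  ∃ k : ℕ, ∀ c, S c → (r c)[k]? = some (f c)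

/-- On the instances in `S`, some program, started with the registers `r`, has a result with the
property `Q` after a bounded number of steps. -/
def Solves {Λ : Type} (S : Instance → Prop) (r : Instance → List ℂ)
    (Q : Instance → Λ × List ℂ → Prop) : Prop :=
  ∃ (P : Program Λ) (C : ℕ), ∀ c, S c → ∃ o n, P.run (r c) = some (o, n) ∧ n ≤ C ∧ Q c o

/-! ### Compiling computable functions into programs with a bounded number of steps -/

section compile

variable {Λ : Type} {S S' : Instance → Prop} {r r' : Instance → List ℂ}
  {Q : Instance → Λ × List ℂ → Prop} {f g : Instance → ℂ}

lemma Holds.mono (h : Holds S r f) (hS : ∀ c, S' c → S c) (hr : ∀ c, S' c → r c <+: r' c) :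
    Holds S' r' f := by
  obtain ⟨k, hk⟩ := h
  refine ⟨k, fun c hc => ?_⟩
  obtain ⟨l, hl⟩ := hr c hc
  have := hk c (hS c hc)
  rw [← hl, List.getElem?_append_left (List.getElem?_eq_some_iff.1 this).1, this]

lemma Holds.last (S : Instance → Prop) (r : Instance → List ℂ) (f : Instance → ℂ)
    (n : ℕ) (hn : ∀ c, S c → (r c).length = n) : Holds S (fun c => r c ++ [f c]) f :=
  ⟨n, fun c hc => by rw [← hn c hc, List.getElem?_concat_length]⟩

lemma Solves.op (I : Instr) (v : Instance → ℂ) (hI : ∀ c, S c → I.eval (r c) = some (v c))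
    (h : Solves S (fun c => r c ++ [v c]) Q) : Solves S r Q := by
  obtain ⟨P, C, hP⟩ := h
  refine ⟨.op I P, C + 1, fun c hc => ?_⟩
  obtain ⟨o, n, h1, h2, h3⟩ := hP c hc
  exact ⟨o, n + 1, by simp [Program.run, hI c hc, h1], by omega, h3⟩

lemma Solves.ifLE (hf : Holds S r f) (hg : Holds S r g)
    (h1 : Solves (fun c => S c ∧ TestLE (f c) (g c)) r Q)
    (h2 : Solves (fun c => S c ∧ ¬ TestLE (f c) (g c)) r Q) : Solves S r Q := by
  obtain ⟨i, hi⟩ := hf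
  obtain ⟨j, hj⟩ := hg
  obtain ⟨P₁, C₁, hP₁⟩ := h1
  obtain ⟨P₂, C₂, hP₂⟩ := h2
  refine ⟨.ifLE i j P₁ P₂, max C₁ C₂ + 1, fun c hc => ?_⟩
  by_cases ht : TestLE (f c) (g c)
  · obtain ⟨o, n, e1, e2, e3⟩ := hP₁ c ⟨hc, ht⟩
    refine ⟨o, n + 1, ?_, by have := le_max_left C₁ C₂; omega, e3⟩
    have ht' : (g c - f c).im = 0 ∧ 0 ≤ (g c - f c).re := ht
    simp only [Program.run, hi c hc, hj c hc, Option.bind_eq_bind, Option.bind_some, if_pos ht', e1,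
      Option.pure_def]
  · obtain ⟨o, n, e1, e2, e3⟩ := hP₂ c ⟨hc, ht⟩
    refine ⟨o, n + 1, ?_, by have := le_max_right C₁ C₂; omega, e3⟩
    have ht' : ¬ ((g c - f c).im = 0 ∧ 0 ≤ (g c - f c).re) := ht
    simp only [Program.run, hi c hc, hj c hc, Option.bind_eq_bind, Option.bind_some, if_neg ht', e1,
      Option.pure_def]

lemma Solves.halt (l : Λ) (fs : List (Instance → ℂ)) (hfs : ∀ f ∈ fs, Holds S r f)
    (hQ : ∀ c, S c → Q c (l, fs.map fun f => f c)) : Solves S r Q := by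
  have : ∃ out : List ℕ, ∀ c, S c → out.mapM (fun i => (r c)[i]?) = some (fs.map fun f => f c) := by
    clear hQ
    induction fs with
    | nil => exact ⟨[], fun c _ => by simp⟩
    | cons f fs ih =>
      obtain ⟨out, ho⟩ := ih fun g hg => hfs g (List.mem_cons_of_mem _ hg)
      obtain ⟨k, hk⟩ := hfs f List.mem_cons_self
      exact ⟨k :: out, fun c hc => by simp [hk c hc, ho c hc]⟩
  obtain ⟨out, ho⟩ := this
  exact ⟨.halt l out, 1, fun c hc => ⟨_, 1, by simp [Program.run, ho c hc], le_rfl, hQ c hc⟩⟩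

/-- All registers that are in use have the same number on all instances in `S`, and the input is
still there. -/
def Ready (S : Instance → Prop) (r : Instance → List ℂ) : Prop :=
  (∃ n, ∀ c, S c → (r c).length = n) ∧ ∀ f ∈ inputs, Holds S r f

/-- The registers `r'`, on the instances in `S'`, extend the registers `r`. -/
def Extends (S S' : Instance → Prop) (r r' : Instance → List ℂ) : Prop :=
  Ready S' r' ∧ (∀ c, S' c → S c) ∧ ∀ c, S' c → r c <+: r' c

lemma Extends.holds (h : Extends S S' r r') (hf : Holds S r f) : Holds S' r' f :=
  hf.mono h.2.1 h.2.2

lemma Extends.refl (h : Ready S r) : Extends S S r r :=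
  ⟨h, fun _ h => h, fun _ _ => List.prefix_rfl⟩

lemma Extends.trans {S'' : Instance → Prop} {r'' : Instance → List ℂ} (h : Extends S S' r r')
    (h' : Extends S' S'' r' r'') : Extends S S'' r r'' :=
  ⟨h'.1, fun c hc => h.2.1 c (h'.2.1 c hc),
    fun c hc => (h.2.2 c (h'.2.1 c hc)).trans (h'.2.2 c hc)⟩

lemma Extends.restrict (h : Ready S r) (hS : ∀ c, S' c → S c) : Extends S S' r r := by
  refine ⟨⟨?_, fun f hf => (h.2 f hf).mono hS fun _ _ => List.prefix_rfl⟩, hS,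
    fun _ _ => List.prefix_rfl⟩
  obtain ⟨n, hn⟩ := h.1
  exact ⟨n, fun c hc => hn c (hS c hc)⟩

lemma Extends.append (h : Ready S r) (v : Instance → ℂ) : Extends S S r (fun c => r c ++ [v c]) := by
  refine ⟨⟨?_, fun f hf => (h.2 f hf).mono (fun _ h => h) fun c _ => List.prefix_append _ _⟩,
    fun _ h => h, fun c _ => List.prefix_append _ _⟩
  obtain ⟨n, hn⟩ := h.1
  exact ⟨n + 1, fun c hc => by simp [hn c hc]⟩

lemma Ready.op (h : Ready S r) (I : Instr) (v : Instance → ℂ)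
    (hI : ∀ c, S c → I.eval (r c) = some (v c))
    (hv : ∀ r', Extends S S r r' → Holds S r' v → Solves S r' Q) : Solves S r Q := by
  obtain ⟨n, hn⟩ := h.1
  exact Solves.op I v hI (hv _ (Extends.append h v) (Holds.last S r v n hn))

/-- Computable functions can be computed before continuing. -/
lemma Alg.solves (hf : Alg f) : ∀ {S r}, Ready S r →
    (∀ S' r', Extends S S' r r' → Holds S' r' f → Solves S' r' Q) → Solves S r Q := by
  induction hf with
  | input h => exact fun hr hQ => hQ _ _ (Extends.refl hr) (hr.2 _ h)
  | const q =>
    intro S r hr hQ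
    exact hr.op (.const q) (fun _ => (q : ℂ)) (fun c _ => rfl) fun r' h1 h2 => hQ _ _ h1 h2
  | @add f g _ _ ihf ihg =>
    intro S r hr hQ
    refine ihf hr fun S₁ r₁ e₁ h₁ => ihg e₁.1 fun S₂ r₂ e₂ h₂ => ?_
    obtain ⟨i, hi⟩ := e₂.holds h₁
    obtain ⟨j, hj⟩ := h₂
    exact e₂.1.op (.add i j) (fun c => f c + g c) (fun c hc => by simp [Instr.eval, hi c hc, hj c hc])
      fun r' h1 h2 => hQ _ _ ((e₁.trans e₂).trans h1) h2
  | @sub f g _ _ ihf ihg =>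
    intro S r hr hQ
    refine ihf hr fun S₁ r₁ e₁ h₁ => ihg e₁.1 fun S₂ r₂ e₂ h₂ => ?_
    obtain ⟨i, hi⟩ := e₂.holds h₁
    obtain ⟨j, hj⟩ := h₂
    exact e₂.1.op (.sub i j) (fun c => f c - g c) (fun c hc => by simp [Instr.eval, hi c hc, hj c hc])
      fun r' h1 h2 => hQ _ _ ((e₁.trans e₂).trans h1) h2
  | @mul f g _ _ ihf ihg =>
    intro S r hr hQ
    refine ihf hr fun S₁ r₁ e₁ h₁ => ihg e₁.1 fun S₂ r₂ e₂ h₂ => ?_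
    obtain ⟨i, hi⟩ := e₂.holds h₁
    obtain ⟨j, hj⟩ := h₂
    exact e₂.1.op (.mul i j) (fun c => f c * g c) (fun c hc => by simp [Instr.eval, hi c hc, hj c hc])
      fun r' h1 h2 => hQ _ _ ((e₁.trans e₂).trans h1) h2
  | @div f g _ _ ihf ihg =>
    intro S r hr hQ
    refine ihf hr fun S₁ r₁ e₁ h₁ => ihg e₁.1 fun S₂ r₂ e₂ h₂ => ?_
    -- The machine has no result for a zero divisor, whereas division in `Alg` gives zero. The tests
    -- `0 ≤ g` and `g ≤ 0` together detect `g = 0`, also for complex values, and in that case the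
    -- register with the constant zero holds the quotient.
    refine e₂.1.op (.const 0) (fun _ => 0) (fun c _ => by simp [Instr.eval]) fun r₃ e₃ h₃ => ?_
    have hdiv : ∀ S', (∀ c, S' c → S₂ c) → (∀ c, S' c → g c ≠ 0) → Solves S' r₃ Q := by
      intro S' hS' hne
      have e₄ := Extends.restrict e₃.1 hS'
      obtain ⟨i, hi⟩ := e₄.holds (e₃.holds (e₂.holds h₁))
      obtain ⟨j, hj⟩ := e₄.holds (e₃.holds h₂)
      exact e₄.1.op (.div i j) (fun c => f c / g c)
        (fun c hc => by simp [Instr.eval, hi c hc, hj c hc, hne c hc])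
        fun r' h1 h2 => hQ _ _ ((((e₁.trans e₂).trans e₃).trans e₄).trans h1) h2
    refine Solves.ifLE h₃ (e₃.holds h₂) ?_ (hdiv _ (fun c hc => hc.1) fun c hc h0 => hc.2 (by
      simp [TestLE, h0]))
    have e₄ := Extends.restrict e₃.1 (S' := fun c => S₂ c ∧ TestLE 0 (g c)) (fun c hc => hc.1)
    refine Solves.ifLE (e₄.holds (e₃.holds h₂)) (e₄.holds h₃) ?_
      (hdiv _ (fun c hc => hc.1.1) fun c hc h0 => hc.2 (by simp [TestLE, h0]))
    have e₅ := Extends.restrict e₄.1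
      (S' := fun c => (S₂ c ∧ TestLE 0 (g c)) ∧ TestLE (g c) 0) (fun c hc => hc.1)
    refine hQ _ _ ((((e₁.trans e₂).trans e₃).trans e₄).trans e₅) ?_
    obtain ⟨k, hk⟩ := e₅.holds (e₄.holds h₃)
    refine ⟨k, fun c hc => ?_⟩
    rw [hk c hc]
    obtain ⟨⟨-, t1⟩, t2⟩ := hc
    simp only [TestLE, sub_zero, zero_sub, Complex.neg_re, Complex.neg_im] at t1 t2
    have : g c = 0 := Complex.ext (by simp only [Complex.zero_re]; linarith [t1.2, t2.2]) t1.1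
    simp [this]
  | @root f k hk _ ihf =>
    intro S r hr hQ
    refine ihf hr fun S₁ r₁ e₁ h₁ => ?_
    obtain ⟨i, hi⟩ := h₁
    exact e₁.1.op (.root k i) (fun c => f c ^ (1 / (k : ℂ)))
      (fun c hc => by simp [Instr.eval, hi c hc, hk])
      fun r' h1 h2 => hQ _ _ (e₁.trans h1) h2
  | @ite f g h k _ _ _ _ ihf ihg ihh ihk =>
    intro S r hr hQ
    refine ihf hr fun S₁ r₁ e₁ h₁ => ihg e₁.1 fun S₂ r₂ e₂ h₂ => ?_
    -- The continuation is used once in each branch, on the instances that take this branch;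
    -- therefore it is required for all smaller sets of instances and all extensions of the
    -- registers.
    refine Solves.ifLE (e₂.holds h₁) h₂ ?_ ?_
    · have e₃ := Extends.restrict e₂.1 (S' := fun c => S₂ c ∧ TestLE (f c) (g c)) (fun c hc => hc.1)
      refine ihh e₃.1 fun S₄ r₄ e₄ h₄ => hQ _ _ (((e₁.trans e₂).trans e₃).trans e₄) ?_
      obtain ⟨i, hi⟩ := h₄
      exact ⟨i, fun c hc => by simp [hi c hc, (e₄.2.1 c hc).2]⟩
    · have e₃ := Extends.restrict e₂.1 (S' := fun c => S₂ c ∧ ¬ TestLE (f c) (g c)) (fun c hc => hc.1)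
      refine ihk e₃.1 fun S₄ r₄ e₄ h₄ => hQ _ _ (((e₁.trans e₂).trans e₃).trans e₄) ?_
      obtain ⟨i, hi⟩ := h₄
      exact ⟨i, fun c hc => by simp [hi c hc, (e₄.2.1 c hc).2]⟩

lemma solves_output (l : Λ) (fs : List (Instance → ℂ)) (hfs : ∀ f ∈ fs, Alg f) (hr : Ready S r)
    (hQ : ∀ c, S c → Q c (l, fs.map fun f => f c)) : Solves S r Q := by
  suffices H : ∀ gs : List (Instance → ℂ), (∀ f ∈ gs, Alg f) → ∀ {S r}, Ready S r →
      (∀ S' r', Extends S S' r r' → (∀ f ∈ gs, Holds S' r' f) → Solves S' r' Q) → Solves S r Q from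
    H fs hfs hr fun S' r' e h => Solves.halt l fs h fun c hc => hQ c (e.2.1 c hc)
  intro gs
  induction gs with
  | nil => exact fun _ S r hr h => h _ _ (Extends.refl hr) (by simp)
  | cons f gs ih =>
    intro hgs S r hr h
    refine (hgs f List.mem_cons_self).solves hr fun S₁ r₁ e₁ h₁ => ?_
    refine ih (fun g hg => hgs g (List.mem_cons_of_mem _ hg)) e₁.1 fun S₂ r₂ e₂ h₂ => ?_
    refine h _ _ (e₁.trans e₂) fun g hg => ?_
    rcases List.mem_cons.1 hg with rfl | hg
    · exact e₂.holds h₁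
    · exact h₂ g hg

end compile

/-! ### Closure properties of computable functions and predicates -/

/-- Computable real functions. -/
def RAlg (f : Instance → ℝ) : Prop := Alg fun c => (f c : ℂ)

open Classical in
/-- Decidable predicates. -/
def AlgP (p : Instance → Prop) : Prop := Alg fun c => if p c then 1 else 0

section closure

variable {f g : Instance → ℝ} {p q : Instance → Prop} {F G : Instance → ℂ}

lemma Alg.congr (h : Alg F) (e : ∀ c, F c = G c) : Alg G := (funext e : F = G) ▸ h

lemma Alg.one : Alg fun _ => 1 := (Alg.const 1).congr fun _ => by simp

lemma Alg.zero : Alg fun _ => 0 := (Alg.const 0).congr fun _ => by simp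

lemma RAlg.congr (h : RAlg f) (e : ∀ c, f c = g c) : RAlg g := (funext e : f = g) ▸ h

lemma AlgP.congr (h : AlgP p) (e : ∀ c, p c ↔ q c) : AlgP q :=
  (funext fun c => propext (e c) : p = q) ▸ h

lemma testLE_ite (p : Prop) [Decidable p] : TestLE 1 (if p then 1 else 0) ↔ p := by
  by_cases h : p <;> simp [TestLE, h]

lemma Alg.ite_prop [∀ c, Decidable (p c)] (hp : AlgP p) (hF : Alg F) (hG : Alg G) :
    Alg fun c => if p c then F c else G c :=
  (Alg.ite Alg.one hp hF hG).congr fun c => by by_cases h : p c <;> simp [TestLE, h]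

lemma AlgP.testLE (hF : Alg F) (hG : Alg G) : AlgP fun c => TestLE (F c) (G c) :=
  Alg.ite hF hG Alg.one Alg.zero

lemma AlgP.not (hp : AlgP p) : AlgP fun c => ¬ p c :=
  (Alg.sub Alg.one hp).congr fun c => by by_cases h : p c <;> simp [h]

lemma AlgP.and (hp : AlgP p) (hq : AlgP q) : AlgP fun c => p c ∧ q c :=
  (Alg.mul hp hq).congr fun c => by by_cases h : p c <;> by_cases h' : q c <;> simp [h, h']

lemma AlgP.or (hp : AlgP p) (hq : AlgP q) : AlgP fun c => p c ∨ q c :=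
  (hp.not.and hq.not).not.congr fun c => by tauto

lemma AlgP.imp (hp : AlgP p) (hq : AlgP q) : AlgP fun c => p c → q c :=
  (hp.not.or hq).congr fun c => by tauto

lemma AlgP.true : AlgP fun _ => True := Alg.one.congr fun _ => by simp

lemma AlgP.forall_mem {ι : Type*} (l : List ι) {P : ι → Instance → Prop} (h : ∀ i ∈ l, AlgP (P i)) :
    AlgP fun c => ∀ i ∈ l, P i c := by
  induction l with
  | nil => exact AlgP.true.congr fun c => by simp
  | cons i l ih =>
    exact ((h i List.mem_cons_self).and (ih fun j hj => h j (List.mem_cons_of_mem _ hj))).congr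
      fun c => by simp

lemma AlgP.eq_complex (hF : Alg F) (hG : Alg G) : AlgP fun c => F c = G c :=
  ((AlgP.testLE hF hG).and (AlgP.testLE hG hF)).congr fun c => by
    simp only [TestLE, Complex.sub_im, Complex.sub_re]
    constructor
    · rintro ⟨⟨h1, h2⟩, h3, h4⟩
      exact Complex.ext (by linarith) (by linarith)
    · rintro h; rw [h]; simp

lemma AlgP.le (hf : RAlg f) (hg : RAlg g) : AlgP fun c => f c ≤ g c :=
  (AlgP.testLE hf hg).congr fun c => by simp [TestLE]

lemma AlgP.lt (hf : RAlg f) (hg : RAlg g) : AlgP fun c => f c < g c :=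
  (AlgP.le hg hf).not.congr fun _ => not_le

lemma AlgP.eq (hf : RAlg f) (hg : RAlg g) : AlgP fun c => f c = g c :=
  ((AlgP.le hf hg).and (AlgP.le hg hf)).congr fun _ => le_antisymm_iff.symm

lemma RAlg.const (q : ℚ) : RAlg fun _ => (q : ℝ) := (Alg.const q).congr fun c => by simp

lemma RAlg.zero : RAlg fun _ => 0 := (RAlg.const 0).congr fun _ => by simp

lemma RAlg.one : RAlg fun _ => 1 := (RAlg.const 1).congr fun _ => by simp

lemma RAlg.ofNat (n : ℕ) [n.AtLeastTwo] : RAlg fun _ => (OfNat.ofNat n : ℝ) :=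
  (RAlg.const (OfNat.ofNat n)).congr fun _ => by simp

lemma RAlg.add (hf : RAlg f) (hg : RAlg g) : RAlg fun c => f c + g c :=
  (Alg.add hf hg).congr fun c => by push_cast; rfl

lemma RAlg.sub (hf : RAlg f) (hg : RAlg g) : RAlg fun c => f c - g c :=
  (Alg.sub hf hg).congr fun c => by push_cast; rfl

lemma RAlg.mul (hf : RAlg f) (hg : RAlg g) : RAlg fun c => f c * g c :=
  (Alg.mul hf hg).congr fun c => by push_cast; rfl

lemma RAlg.div (hf : RAlg f) (hg : RAlg g) : RAlg fun c => f c / g c :=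
  (Alg.div hf hg).congr fun c => by push_cast; rfl

lemma RAlg.neg (hf : RAlg f) : RAlg fun c => -f c :=
  (RAlg.zero.sub hf).congr fun _ => zero_sub _

lemma RAlg.pow (hf : RAlg f) (n : ℕ) : RAlg fun c => f c ^ n := by
  induction n with
  | zero => exact RAlg.one.congr fun c => (pow_zero _).symm
  | succ n ih => exact (ih.mul hf).congr fun c => (pow_succ _ _).symm

lemma RAlg.ite [∀ c, Decidable (p c)] (hp : AlgP p) (hf : RAlg f) (hg : RAlg g) :
    RAlg fun c => if p c then f c else g c :=
  (Alg.ite_prop hp hf hg).congr fun c => by dsimp only; split_ifs <;> rfl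

lemma RAlg.sqrt (hf : RAlg f) : RAlg fun c => √(f c) := by
  classical
  -- The principal root of a negative number is imaginary, while the real square root has the
  -- default value zero there; a test separates the cases.
  refine (Alg.ite_prop (AlgP.le RAlg.zero hf) (Alg.root 2 le_rfl hf) Alg.zero).congr fun c => ?_
  dsimp only
  split_ifs with h
  · rw [Real.sqrt_eq_rpow, Complex.ofReal_cpow h]
    push_cast; rfl
  · rw [Real.sqrt_eq_zero_of_nonpos (le_of_not_ge h)]; simp

lemma RAlg.abs (hf : RAlg f) : RAlg fun c => |f c| :=
  (hf.mul hf).sqrt.congr fun _ => Real.sqrt_mul_self_eq_abs _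

lemma RAlg.α : RAlg Instance.α := Alg.input (by simp [inputs])
lemma RAlg.W : RAlg Instance.W := Alg.input (by simp [inputs])
lemma RAlg.sx : RAlg Instance.sx := Alg.input (by simp [inputs])
lemma RAlg.tx : RAlg Instance.tx := Alg.input (by simp [inputs])
lemma RAlg.ty : RAlg Instance.ty := Alg.input (by simp [inputs])

/-- Reflection replaces the inputs `sx` and `tx` by computable ones, and the constructors commute
with this substitution. -/
lemma Alg.mirror (hF : Alg F) (m : Bool) : Alg fun c => F (c.mirror m) := by
  cases m
  · exact hF
  induction hF with
  | input h =>
    simp only [inputs, List.mem_cons, List.not_mem_nil, or_false] at h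
    rcases h with rfl | rfl | rfl | rfl | rfl
    · exact RAlg.α
    · exact RAlg.W
    · exact RAlg.W.sub RAlg.sx
    · exact RAlg.W.sub RAlg.tx
    · exact RAlg.ty
  | const q => exact .const q
  | add _ _ h1 h2 => exact h1.add h2
  | sub _ _ h1 h2 => exact h1.sub h2
  | mul _ _ h1 h2 => exact h1.mul h2
  | div _ _ h1 h2 => exact h1.div h2
  | root k hk _ h => exact h.root k hk
  | ite _ _ _ _ h1 h2 h3 h4 => exact h1.ite h2 h3 h4

lemma RAlg.mirror (hf : RAlg f) (m : Bool) : RAlg fun c => f (c.mirror m) := Alg.mirror hf m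

lemma AlgP.mirror (hp : AlgP p) (m : Bool) : AlgP fun c => p (c.mirror m) := Alg.mirror hp m

end closure

/-- A finite list of guarded outputs can be executed. -/
lemma solves_cases {Λ : Type} [Inhabited Λ] {Q : Instance → Λ × List ℂ → Prop}
    {ι : Type*} (l : List ι) (lab : ι → Λ) (cond : ι → Instance → Prop)
    (out : ι → List (Instance → ℂ)) (hc : ∀ i ∈ l, AlgP (cond i)) (ho : ∀ i ∈ l, ∀ f ∈ out i, Alg f) :
    ∀ {S : Instance → Prop} {r : Instance → List ℂ}, Ready S r →
    (∀ c, S c → ∃ i ∈ l, cond i c) →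
    (∀ i ∈ l, ∀ c, S c → cond i c → Q c (lab i, (out i).map fun f => f c)) → Solves S r Q := by
  classical
  induction l with
  | nil =>
    intro S r hr hS hQ
    have hempty : ∀ c, ¬ S c := fun c hc => by simpa using hS c hc
    exact ⟨.halt default [], 0, fun c hc => absurd hc (hempty c)⟩
  | cons i l ih =>
    intro S r hr hS hQ
    refine Alg.one.solves hr fun S₁ r₁ e₁ h₁ => (hc i List.mem_cons_self).solves e₁.1
      fun S₂ r₂ e₂ h₂ => Solves.ifLE (e₂.holds h₁) h₂ ?_ ?_
    · refine solves_output (lab i) (out i) (ho i List.mem_cons_self)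
        (Extends.restrict e₂.1 fun c hc => hc.1).1 fun c hc => ?_
      rw [testLE_ite] at hc
      exact hQ i List.mem_cons_self c (e₁.2.1 c (e₂.2.1 c hc.1)) hc.2
    · refine ih (fun j hj => hc j (List.mem_cons_of_mem _ hj))
        (fun j hj => ho j (List.mem_cons_of_mem _ hj))
        (Extends.restrict e₂.1 fun c hc => hc.1).1 (fun c hc => ?_) fun j hj c hc => ?_
      · rw [testLE_ite] at hc
        obtain ⟨j, hj, hj'⟩ := hS c (e₁.2.1 c (e₂.2.1 c hc.1))
        rcases List.mem_cons.1 hj with rfl | hj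
        · exact absurd hj' hc.2
        · exact ⟨j, hj, hj'⟩
      · exact hQ j (List.mem_cons_of_mem _ hj) c (e₁.2.1 c (e₂.2.1 c hc.1))

end WeightedRectangle
end

noncomputable section

namespace WeightedRectangle

/-! ### Solving quartic equations by radicals -/

/-- The principal square root. -/
def sqrtC (z : ℂ) : ℂ := z ^ (1 / ((2 : ℕ) : ℂ))

/-- The principal cubic root. -/
def cbrtC (z : ℂ) : ℂ := z ^ (1 / ((3 : ℕ) : ℂ))

lemma sqrtC_sq (z : ℂ) : sqrtC z ^ 2 = z := by
  rw [sqrtC, one_div, Complex.cpow_nat_inv_pow z two_ne_zero]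

lemma cbrtC_cube (z : ℂ) : cbrtC z ^ 3 = z := by
  rw [cbrtC, one_div, Complex.cpow_nat_inv_pow z three_ne_zero]

/-- Candidates for the zeros of `a x² + b x + c`. -/
def quadraticZeros (a b c : ℂ) : List ℂ :=
  [(-b + sqrtC (b ^ 2 - 4 * a * c)) / (2 * a), (-b - sqrtC (b ^ 2 - 4 * a * c)) / (2 * a), -c / b]

/-- The first two candidates come from completing the square, the third is for the degenerate linear
equation. -/
lemma mem_quadraticZeros {a b c x : ℂ} (h : a ≠ 0 ∨ b ≠ 0) (hx : a * x ^ 2 + b * x + c = 0) :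
    x ∈ quadraticZeros a b c := by
  simp only [quadraticZeros, List.mem_cons, List.not_mem_nil, or_false]
  by_cases ha : a = 0
  · right; right
    rw [eq_div_iff (h.resolve_left fun h => h ha)]
    rw [ha] at hx
    linear_combination hx
  · have hs := sqrtC_sq (b ^ 2 - 4 * a * c)
    set s := sqrtC (b ^ 2 - 4 * a * c)
    have : (2 * a * x + b - s) * (2 * a * x + b + s) = 0 := by
      linear_combination 4 * a * hx - hs
    have h2a : 2 * a ≠ 0 := mul_ne_zero two_ne_zero ha
    rcases mul_eq_zero.1 this with h | h
    · left; rw [eq_div_iff h2a]; linear_combination h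
    · right; left; rw [eq_div_iff h2a]; linear_combination h

/-- Candidates for some zero of `x³ + a x² + b x + c`. -/
def cubicZeros (a b c : ℂ) : List ℂ :=
  let p := b - a ^ 2 / 3
  let q := 2 * a ^ 3 / 27 - a * b / 3 + c
  let u := cbrtC (-q / 2 + sqrtC (q ^ 2 / 4 + p ^ 3 / 27))
  [u - p / (3 * u) - a / 3, cbrtC (-q) - a / 3]

/-- Cardano's formula. It divides by `u`; if `u = 0`, then `p = 0`, the depressed cubic is `y³ =
-q`, and the second candidate works. -/
lemma exists_mem_cubicZeros (a b c : ℂ) :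
    ∃ x ∈ cubicZeros a b c, x ^ 3 + a * x ^ 2 + b * x + c = 0 := by
  simp only [cubicZeros, List.exists_mem_cons_iff, List.not_mem_nil, false_and, exists_false, or_false]
  set p := b - a ^ 2 / 3 with hp
  set q := 2 * a ^ 3 / 27 - a * b / 3 + c with hq
  have depress : ∀ y : ℂ, y ^ 3 + p * y + q = 0 →
      (y - a / 3) ^ 3 + a * (y - a / 3) ^ 2 + b * (y - a / 3) + c = 0 := by
    intro y hy
    rw [← hy, hp, hq]; ring
  have hs := sqrtC_sq (q ^ 2 / 4 + p ^ 3 / 27)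
  set s := sqrtC (q ^ 2 / 4 + p ^ 3 / 27)
  have hu := cbrtC_cube (-q / 2 + s)
  set u := cbrtC (-q / 2 + s)
  by_cases h0 : u = 0
  · right
    have hs' : s = q / 2 := by
      rw [h0] at hu; linear_combination -hu
    have hp0 : p = 0 := by
      rw [hs'] at hs
      have : p ^ 3 = 0 := by linear_combination -27 * hs
      exact pow_eq_zero_iff (three_ne_zero) |>.1 this
    have hv := cbrtC_cube (-q)
    exact depress _ (by rw [hp0]; linear_combination hv)
  · left
    refine depress _ ?_
    have : (u - p / (3 * u)) ^ 3 + p * (u - p / (3 * u)) + q =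
        ((u ^ 3) ^ 2 + q * u ^ 3 - p ^ 3 / 27) / u ^ 3 := by
      field_simp; ring
    rw [this, hu, div_eq_zero_iff]
    left
    linear_combination hs

/-- Candidates for the zeros of `a x⁴ + b x³ + c x² + d x + e`, if `b` vanishes where `a` does. -/
def quarticZeros (a b c d e : ℂ) : List ℂ :=
  let p := c / a - 3 * b ^ 2 / (8 * a ^ 2)
  let q := d / a - b * c / (2 * a ^ 2) + b ^ 3 / (8 * a ^ 3)
  let r := e / a - b * d / (4 * a ^ 2) + b ^ 2 * c / (16 * a ^ 3) - 3 * b ^ 4 / (256 * a ^ 4)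
  quadraticZeros c d e ++
  ((quadraticZeros 1 p r).flatMap fun z => [sqrtC z - b / (4 * a), -sqrtC z - b / (4 * a)]) ++
  (cubicZeros p (p ^ 2 / 4 - r) (-q ^ 2 / 8)).flatMap fun m =>
    (quadraticZeros 1 (-sqrtC (2 * m)) (p / 2 + m + q / (2 * sqrtC (2 * m))) ++
      quadraticZeros 1 (sqrtC (2 * m)) (p / 2 + m - q / (2 * sqrtC (2 * m)))).flatMap
        fun y => [y - b / (4 * a)]

/-- Ferrari's method: a zero `m` of the resolvent cubic makes the depressed quartic a difference of
two squares, hence a product of two quadratics. This divides by `√(2m)`, and `m ≠ 0` follows from `q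
≠ 0`; the biquadratic case `q = 0` and the case `a = 0` have their own candidates. -/
lemma mem_quarticZeros {a b c d e x : ℂ} (h : a = 0 → b = 0) (h' : a ≠ 0 ∨ c ≠ 0 ∨ d ≠ 0)
    (hx : a * x ^ 4 + b * x ^ 3 + c * x ^ 2 + d * x + e = 0) : x ∈ quarticZeros a b c d e := by
  simp only [quarticZeros, List.mem_append, List.mem_flatMap, List.mem_cons, List.not_mem_nil,
    or_false]
  by_cases ha : a = 0
  · refine Or.inl (Or.inl (mem_quadraticZeros (h'.resolve_left fun h => h ha) ?_))
    rw [ha, h ha] at hx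
    linear_combination hx
  set p := c / a - 3 * b ^ 2 / (8 * a ^ 2) with hp
  set q := d / a - b * c / (2 * a ^ 2) + b ^ 3 / (8 * a ^ 3) with hq
  set r := e / a - b * d / (4 * a ^ 2) + b ^ 2 * c / (16 * a ^ 3) - 3 * b ^ 4 / (256 * a ^ 4) with hr
  obtain ⟨y, hy⟩ : ∃ y, y = x + b / (4 * a) := ⟨_, rfl⟩
  have hxy : x = y - b / (4 * a) := by rw [hy]; ring
  have key : y ^ 4 + p * y ^ 2 + q * y + r = 0 := by
    have : y ^ 4 + p * y ^ 2 + q * y + r =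
        (a * x ^ 4 + b * x ^ 3 + c * x ^ 2 + d * x + e) / a := by
      rw [hy, hp, hq, hr]; field_simp; ring
    rw [this, hx, zero_div]
  by_cases h0 : q = 0
  · refine Or.inl (Or.inr ⟨y ^ 2, mem_quadraticZeros (Or.inl one_ne_zero) ?_, ?_⟩)
    · rw [h0] at key; linear_combination key
    · have hs := sqrtC_sq (y ^ 2)
      have : (y - sqrtC (y ^ 2)) * (y + sqrtC (y ^ 2)) = 0 := by linear_combination -hs
      rcases mul_eq_zero.1 this with h | h
      · left; rw [hxy]; linear_combination h
      · right; rw [hxy]; linear_combination h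
  · right
    obtain ⟨m, hm, hm0⟩ := exists_mem_cubicZeros p (p ^ 2 / 4 - r) (-q ^ 2 / 8)
    refine ⟨m, hm, y, ?_, hxy⟩
    have hs := sqrtC_sq (2 * m)
    set s := sqrtC (2 * m)
    have hm1 : m ≠ 0 := by
      rintro rfl
      apply h0
      have : q ^ 2 = 0 := by linear_combination -8 * hm0
      exact pow_eq_zero_iff two_ne_zero |>.1 this
    have hs0 : s ≠ 0 := by
      intro h
      rw [h] at hs
      apply hm1
      linear_combination -hs / 2
    have hm2 : m = s ^ 2 / 2 := by rw [hs]; ring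
    have hq2 : q ^ 2 / (4 * s ^ 2) = (p / 2 + m) ^ 2 - r := by
      rw [div_eq_iff (by simp [hs0]), hm2]
      rw [hm2] at hm0
      linear_combination -8 * hm0
    have : (1 * y ^ 2 + -s * y + (p / 2 + m + q / (2 * s))) *
        (1 * y ^ 2 + s * y + (p / 2 + m - q / (2 * s))) = 0 := by
      have e : (1 * y ^ 2 + -s * y + (p / 2 + m + q / (2 * s))) *
        (1 * y ^ 2 + s * y + (p / 2 + m - q / (2 * s))) =
        (y ^ 2 + p / 2 + m) ^ 2 - s ^ 2 * y ^ 2 + q * y - q ^ 2 / (4 * s ^ 2) := by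
        field_simp; ring
      rw [e, hq2, hs]
      linear_combination key
    rcases mul_eq_zero.1 this with h | h
    · exact Or.inl (mem_quadraticZeros (Or.inl one_ne_zero) h)
    · exact Or.inr (mem_quadraticZeros (Or.inl one_ne_zero) h)

/-! ### Computing zeros of quartics -/

section closure

variable {F G : Instance → ℂ} {L M : Instance → List ℂ}

lemma Alg.ofNat (n : ℕ) [n.AtLeastTwo] : Alg fun _ => (OfNat.ofNat n : ℂ) :=
  (Alg.const (OfNat.ofNat n)).congr fun _ => by simp

lemma Alg.neg (hF : Alg F) : Alg fun c => -F c :=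
  (Alg.zero.sub hF).congr fun _ => zero_sub _

lemma Alg.pow (hF : Alg F) (n : ℕ) : Alg fun c => F c ^ n := by
  induction n with
  | zero => exact Alg.one.congr fun _ => (pow_zero _).symm
  | succ n ih => exact (ih.mul hF).congr fun _ => (pow_succ _ _).symm

lemma Alg.sqrtC (hF : Alg F) : Alg fun c => sqrtC (F c) := hF.root 2 le_rfl

lemma Alg.cbrtC (hF : Alg F) : Alg fun c => cbrtC (F c) := hF.root 3 (by norm_num)

/-- Computable lists of fixed length. -/
def AlgList (L : Instance → List ℂ) : Prop :=
  ∃ fs : List (Instance → ℂ), (∀ f ∈ fs, Alg f) ∧ ∀ c, L c = fs.map fun f => f c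

lemma AlgList.nil : AlgList fun _ => [] := ⟨[], by simp, fun _ => rfl⟩

lemma AlgList.cons (hF : Alg F) (hL : AlgList L) : AlgList fun c => F c :: L c := by
  obtain ⟨fs, h1, h2⟩ := hL
  exact ⟨F :: fs, by simpa using ⟨hF, h1⟩, fun c => by simp [h2]⟩

lemma AlgList.append (hL : AlgList L) (hM : AlgList M) : AlgList fun c => L c ++ M c := by
  obtain ⟨fs, h1, h2⟩ := hL
  obtain ⟨gs, h3, h4⟩ := hM
  refine ⟨fs ++ gs, fun f hf => ?_, fun c => by simp [h2, h4]⟩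
  rcases List.mem_append.1 hf with h | h
  exacts [h1 f h, h3 f h]

lemma AlgList.flatMap (hL : AlgList L) {H : Instance → ℂ → List ℂ}
    (hH : ∀ F, Alg F → AlgList fun c => H c (F c)) : AlgList fun c => (L c).flatMap (H c) := by
  obtain ⟨fs, h1, h2⟩ := hL
  obtain rfl : L = fun c => fs.map fun f => f c := funext h2
  clear h2
  induction fs with
  | nil => exact AlgList.nil
  | cons f fs ih =>
    have := (hH f (h1 f List.mem_cons_self)).append (ih fun g hg => h1 g (List.mem_cons_of_mem _ hg))
    simpa using this

variable {A B C D E : Instance → ℂ}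

lemma AlgList.quadraticZeros (hA : Alg A) (hB : Alg B) (hC : Alg C) :
    AlgList fun c => quadraticZeros (A c) (B c) (C c) := by
  have hs := ((hB.pow 2).sub (((Alg.ofNat 4).mul hA).mul hC)).sqrtC
  exact .cons ((hB.neg.add hs).div ((Alg.ofNat 2).mul hA))
    (.cons ((hB.neg.sub hs).div ((Alg.ofNat 2).mul hA)) (.cons (hC.neg.div hB) .nil))

lemma AlgList.cubicZeros (hA : Alg A) (hB : Alg B) (hC : Alg C) :
    AlgList fun c => cubicZeros (A c) (B c) (C c) := by
  have hp := hB.sub ((hA.pow 2).div (Alg.ofNat 3))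
  have hq := ((((Alg.ofNat 2).mul (hA.pow 3)).div (Alg.ofNat 27)).sub
    ((hA.mul hB).div (Alg.ofNat 3))).add hC
  have hu := ((hq.neg.div (Alg.ofNat 2)).add
    (((hq.pow 2).div (Alg.ofNat 4)).add ((hp.pow 3).div (Alg.ofNat 27))).sqrtC).cbrtC
  exact .cons ((hu.sub (hp.div ((Alg.ofNat 3).mul hu))).sub (hA.div (Alg.ofNat 3)))
    (.cons (hq.neg.cbrtC.sub (hA.div (Alg.ofNat 3))) .nil)

lemma AlgList.quarticZeros (hA : Alg A) (hB : Alg B) (hC : Alg C) (hD : Alg D) (hE : Alg E) :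
    AlgList fun c => quarticZeros (A c) (B c) (C c) (D c) (E c) := by
  have hp := (hC.div hA).sub (((Alg.ofNat 3).mul (hB.pow 2)).div ((Alg.ofNat 8).mul (hA.pow 2)))
  have hq := ((hD.div hA).sub ((hB.mul hC).div ((Alg.ofNat 2).mul (hA.pow 2)))).add
    ((hB.pow 3).div ((Alg.ofNat 8).mul (hA.pow 3)))
  have hr := (((hE.div hA).sub ((hB.mul hD).div ((Alg.ofNat 4).mul (hA.pow 2)))).add
    (((hB.pow 2).mul hC).div ((Alg.ofNat 16).mul (hA.pow 3)))).sub
    (((Alg.ofNat 3).mul (hB.pow 4)).div ((Alg.ofNat 256).mul (hA.pow 4)))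
  have hz := hB.div ((Alg.ofNat 4).mul hA)
  refine ((AlgList.quadraticZeros hC hD hE).append
    ((AlgList.quadraticZeros Alg.one hp hr).flatMap fun F hF =>
      .cons (hF.sqrtC.sub hz) (.cons (hF.sqrtC.neg.sub hz) .nil))).append
    ((AlgList.cubicZeros hp (((hp.pow 2).div (Alg.ofNat 4)).sub hr)
      ((hq.pow 2).neg.div (Alg.ofNat 8))).flatMap fun F hF => ?_)
  have hs := ((Alg.ofNat 2).mul hF).sqrtC
  have h1 := (hp.div (Alg.ofNat 2)).add hF
  have h2 := hq.div ((Alg.ofNat 2).mul hs)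
  exact ((AlgList.quadraticZeros Alg.one hs.neg (h1.add h2)).append
    (AlgList.quadraticZeros Alg.one hs (h1.sub h2))).flatMap fun F hF => .cons (hF.sub hz) .nil

/-- An element of a computable list with a decidable property can be found. -/
lemma AlgList.exists_find (hL : AlgList L) {P : Instance → ℂ → Prop}
    (hP : ∀ F, Alg F → AlgP fun c => P c (F c)) :
    ∃ F, Alg F ∧ ∀ c, (∃ x ∈ L c, P c x) → P c (F c) := by
  classical
  obtain ⟨fs, h1, h2⟩ := hL
  obtain rfl : L = fun c => fs.map fun f => f c := funext h2
  clear h2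
  induction fs with
  | nil => exact ⟨_, Alg.zero, fun c h => by simp at h⟩
  | cons f fs ih =>
    obtain ⟨F, hF, h⟩ := ih fun g hg => h1 g (List.mem_cons_of_mem _ hg)
    have hf := h1 f List.mem_cons_self
    refine ⟨_, Alg.ite_prop (hP f hf) hf hF, fun c hc => ?_⟩
    split_ifs with hfc
    · exact hfc
    · refine h c ?_
      simpa [hfc] using hc

/-- Unique zeros of quartics in intervals can be computed. -/
theorem exists_ralg_zero {a b c d e l u : Instance → ℝ} (ha : RAlg a) (hb : RAlg b) (hc : RAlg c)
    (hd : RAlg d) (he : RAlg e) (hl : RAlg l) (hu : RAlg u) (hab : ∀ i, a i = 0 → b i = 0) :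
    ∃ w, RAlg w ∧ ∀ i v, IsUniqueZero
      (fun x => a i * x ^ 4 + b i * x ^ 3 + c i * x ^ 2 + d i * x + e i) (l i) (u i) v → w i = v := by
  classical
  obtain ⟨P, hPiff⟩ : ∃ P : Instance → ℂ → Prop, ∀ i x, (TestLE (l i) x ∧ ¬ x = l i) ∧
      (TestLE x (u i) ∧ ¬ x = u i) ∧
        a i * x ^ 4 + b i * x ^ 3 + c i * x ^ 2 + d i * x + e i = 0 ↔ P i x := ⟨_, fun _ _ => Iff.rfl⟩
  have hP : ∀ F, Alg F → AlgP fun i => P i (F i) := fun F hF =>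
    (((AlgP.testLE hl hF).and (AlgP.eq_complex hF hl).not).and
      (((AlgP.testLE hF hu).and (AlgP.eq_complex hF hu).not).and
        (AlgP.eq_complex (Alg.add (Alg.add (Alg.add (Alg.add (Alg.mul ha (hF.pow 4))
          (Alg.mul hb (hF.pow 3))) (Alg.mul hc (hF.pow 2))) (Alg.mul hd hF)) he) Alg.zero))).congr
      fun i => hPiff i (F i)
  obtain ⟨F, hF, h⟩ := (AlgList.quarticZeros ha hb hc hd he).exists_find hP
  have hPim : ∀ i x, P i x → ((x.re : ℝ) : ℂ) = x := by
    intro i x hx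
    obtain ⟨⟨⟨h, -⟩, -⟩, -⟩ := (hPiff i x).2 hx
    apply Complex.ext <;> simp_all
  -- Taking real parts is not an operation of the machine, but the order test contained in `P`
  -- already forces `F i` to be real.
  have hw : Alg fun i => if P i (F i) then F i else 0 := Alg.ite_prop (hP F hF) hF Alg.zero
  refine ⟨fun i => if P i (F i) then (F i).re else 0, Alg.congr hw fun i => ?_, ?_⟩
  · dsimp only
    split_ifs with h
    · exact (hPim _ _ h).symm
    · simp
  · rintro i v ⟨⟨hv1, hv2⟩, hv0, huniq⟩
    have hPF : P i (F i) := by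
      refine h i ⟨v, mem_quarticZeros ?_ ?_ ?_, (hPiff i v).1 ⟨⟨?_, ?_⟩, ⟨?_, ?_⟩, ?_⟩⟩
      · simpa using hab i
      -- If all these coefficients vanished, the polynomial would be constant, and its zero in the
      -- interval would not be unique.
      · by_contra! hcon
        obtain ⟨h1, h2, h3⟩ := hcon
        have h1 : a i = 0 := by exact_mod_cast h1
        have h2 : c i = 0 := by exact_mod_cast h2
        have h3 : d i = 0 := by exact_mod_cast h3
        simp only [h1, h2, h3, hab i h1, zero_mul, zero_add] at hv0 huniq
        have := huniq ((l i + v) / 2) ⟨by linarith, by linarith⟩ hv0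
        linarith
      · exact_mod_cast hv0
      · simpa [TestLE] using hv1.le
      · exact_mod_cast hv1.ne'
      · simpa [TestLE] using hv2.le
      · exact_mod_cast hv2.ne
      · exact_mod_cast hv0
    simp only [if_pos hPF]
    have hre := hPim _ _ hPF
    obtain ⟨⟨h1, h2⟩, ⟨h3, h4⟩, h5⟩ := (hPiff _ _).2 hPF
    rw [← hre] at h1 h2 h3 h4 h5
    refine huniq _ ⟨lt_of_le_of_ne ?_ ?_, lt_of_le_of_ne ?_ ?_⟩ (by exact_mod_cast h5)
    · simpa [TestLE] using h1
    · exact fun h => h2 (by rw [← h])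
    · simpa [TestLE] using h3
    · exact fun h => h4 (by rw [h])

end closure

/-- The cubic coefficient is a multiple of the leading one, so for `α = 1` the degree drops to at
most two, as `exists_ralg_zero` requires. -/
lemma exists_zero₁ : ∃ w, RAlg w ∧ ∀ c v, IsUniqueZero (quartic₁ c) c.ty 0 v → w c = v := by
  have hβ := (RAlg.α.pow 2).sub .one
  obtain ⟨w, hw, h⟩ := exists_ralg_zero hβ (((RAlg.ofNat 2).mul .ty).mul hβ).neg
    ((((RAlg.α.pow 2).mul (RAlg.tx.pow 2)).add (hβ.mul (RAlg.ty.pow 2))).sub (RAlg.sx.pow 2))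
    (((RAlg.ofNat 2).mul (RAlg.sx.pow 2)).mul .ty) ((RAlg.sx.pow 2).mul (RAlg.ty.pow 2)).neg
    .ty .zero (fun c h => by rw [h]; ring)
  refine ⟨w, hw, fun c v hv => h c v ?_⟩
  convert hv using 1
  funext x
  rw [quartic₁]; ring

lemma exists_zero₂ : ∃ w, RAlg w ∧ ∀ c v, IsUniqueZero (quartic₂ c) c.tx c.sx v → w c = v := by
  have hβ := (RAlg.α.pow 2).sub .one
  have hg := (RAlg.α.pow 2).mul ((RAlg.one.add .ty).pow 2)
  obtain ⟨w, hw, h⟩ := exists_ralg_zero hβ (((RAlg.ofNat 2).mul hβ).mul (RAlg.tx.add .sx)).neg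
    (((hβ.mul (((RAlg.sx.pow 2).add (RAlg.tx.pow 2)).add
      (((RAlg.ofNat 4).mul .sx).mul .tx))).add hg).sub .one)
    ((RAlg.ofNat 2).mul (((hβ.mul ((RAlg.tx.mul (RAlg.sx.pow 2)).add ((RAlg.tx.pow 2).mul .sx))).add
      (hg.mul .sx)).sub .tx)).neg
    ((((hβ.mul (RAlg.tx.pow 2)).mul (RAlg.sx.pow 2)).add (hg.mul (RAlg.sx.pow 2))).sub
      (RAlg.tx.pow 2))
    .tx .sx (fun c h => by rw [h]; ring)
  refine ⟨w, hw, fun c v hv => h c v ?_⟩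
  convert hv using 1
  funext x
  rw [quartic₂]; ring

/-- The unique zero of the first quartic, if there is one. -/
def zero₁ : Instance → ℝ := exists_zero₁.choose

/-- The unique zero of the second quartic, if there is one. -/
def zero₂ : Instance → ℝ := exists_zero₂.choose

lemma RAlg.zero₁ : RAlg zero₁ := exists_zero₁.choose_spec.1

lemma RAlg.zero₂ : RAlg zero₂ := exists_zero₂.choose_spec.1

lemma zero₁_eq {c : Instance} {w : ℝ} (h : IsUniqueZero (quartic₁ c) c.ty 0 w) : zero₁ c = w :=
  exists_zero₁.choose_spec.2 c w h

lemma zero₂_eq {c : Instance} {w : ℝ} (h : IsUniqueZero (quartic₂ c) c.tx c.sx w) : zero₂ c = w :=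
  exists_zero₂.choose_spec.2 c w h

end WeightedRectangle
end

noncomputable section

namespace WeightedRectangle

open MeasureTheory Filter Topology

/-! ### First-order conditions -/

/-- The equations are squared Snell laws `a · A/(p + A) = B/(q + B)`. Both ratios are squares of
sines, increasing in `A` and in `B`; as the refraction point moves, one of `A`, `B` decreases and
the other increases, so the law holds at most once. -/
lemma ratio_unique {a p q A B A' B' : ℝ} (ha : 0 < a) (hp : 0 < p) (hq : 0 < q) (hA' : 0 ≤ A')
    (hA : A' < A) (hB : 0 ≤ B) (hB' : B < B') (h : a * A * (q + B) = B * (p + A))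
    (h' : a * A' * (q + B') = B' * (p + A')) : False := by
  have e : a * (A / (p + A)) = B / (q + B) := by
    rw [mul_div_assoc', div_eq_div_iff] <;> linarith
  have e' : a * (A' / (p + A')) = B' / (q + B') := by
    rw [mul_div_assoc', div_eq_div_iff] <;> linarith
  have i1 : A' / (p + A') < A / (p + A) := by
    rw [div_lt_div_iff₀ (by linarith) (by linarith)]; nlinarith
  have i2 : B / (q + B) < B' / (q + B') := by
    rw [div_lt_div_iff₀ (by linarith) (by linarith)]; nlinarith
  nlinarith

/-- This is the difference of the two sides of the squared Snell law after clearing denominators. -/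
lemma quartic₁_eq (c : Instance) (w : ℝ) : quartic₁ c w =
    c.α ^ 2 * w ^ 2 * (c.tx ^ 2 + (w - c.ty) ^ 2) - (w - c.ty) ^ 2 * (c.sx ^ 2 + w ^ 2) := by
  rw [quartic₁]; ring

lemma quartic₂_eq (c : Instance) (w : ℝ) : quartic₂ c w =
    c.α ^ 2 * (c.sx - w) ^ 2 * ((1 + c.ty) ^ 2 + (w - c.tx) ^ 2) -
      (w - c.tx) ^ 2 * (1 + (c.sx - w) ^ 2) := by
  rw [quartic₂]; ring

namespace Instance

variable {c : Instance}

lemma quartic₁_unique (hα : 0 < c.α) (hs : c.sx ≠ 0) (ht : c.tx ≠ 0) {v w : ℝ}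
    (hv : v ∈ Ioo c.ty 0) (hw : w ∈ Ioo c.ty 0) (hv0 : quartic₁ c v = 0) (hw0 : quartic₁ c w = 0) :
    v = w := by
  have key : ∀ v ∈ Ioo c.ty 0, ∀ w ∈ Ioo c.ty 0, quartic₁ c v = 0 → quartic₁ c w = 0 → ¬ v < w := by
    intro v hv w hw hv0 hw0 hlt
    rw [quartic₁_eq] at hv0 hw0
    refine ratio_unique (a := c.α ^ 2) (p := c.sx ^ 2) (q := c.tx ^ 2) (A := v ^ 2) (A' := w ^ 2)
      (B := (v - c.ty) ^ 2) (B' := (w - c.ty) ^ 2) (by positivity) (by positivity) (by positivity)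
      (by positivity) ?_ (by positivity) ?_ (by linarith) (by linarith)
    · nlinarith [hw.2]
    · nlinarith [hv.1]
  rcases lt_trichotomy v w with h | h | h
  · exact absurd h (key v hv w hw hv0 hw0)
  · exact h
  · exact absurd h (key w hw v hv hw0 hv0)

lemma quartic₂_unique (hα : 0 < c.α) (ht : c.ty < -1) {v w : ℝ} (hv : v ∈ Ioo c.tx c.sx)
    (hw : w ∈ Ioo c.tx c.sx) (hv0 : quartic₂ c v = 0) (hw0 : quartic₂ c w = 0) : v = w := by
  have hq : 0 < (1 + c.ty) ^ 2 := by nlinarith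
  have key : ∀ v ∈ Ioo c.tx c.sx, ∀ w ∈ Ioo c.tx c.sx, quartic₂ c v = 0 → quartic₂ c w = 0 →
      ¬ v < w := by
    intro v hv w hw hv0 hw0 hlt
    rw [quartic₂_eq] at hv0 hw0
    refine ratio_unique (a := c.α ^ 2) (p := 1) (q := (1 + c.ty) ^ 2) (A := (c.sx - v) ^ 2)
      (A' := (c.sx - w) ^ 2) (B := (v - c.tx) ^ 2) (B' := (w - c.tx) ^ 2) (by positivity) one_pos hq
      (by positivity) ?_ (by positivity) ?_ (by linarith) (by linarith)
    · nlinarith [hw.2]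
    · nlinarith [hv.1]
  rcases lt_trichotomy v w with h | h | h
  · exact absurd h (key v hv w hw hv0 hw0)
  · exact h
  · exact absurd h (key w hw v hv hw0 hv0)

/-- The intermediate vertices of a shortest path of the given type, if there is one. -/
def vertices (c : Instance) : PathType → List Plane
  | .p1 => []
  | .p2 => [pt (c.tx + c.α * c.ty / √(1 - c.α ^ 2)) 0]
  | .p3 => [pt 0 0]
  | .p4 => [pt 0 0]
  | .p5 =>
    let b := c.ty - √(c.α ^ 2 - 1) * c.tx / √(2 - c.α ^ 2)
    [pt (-b / √(c.α ^ 2 - 1)) 0, pt 0 b]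
  | .p6 => [pt 0 (zero₁ c)]
  | .p7 => c.vertices₇
  | .p8 =>
    let x := c.tx + √(c.α ^ 2 - 1) * (1 + c.ty) / √(2 - c.α ^ 2)
    let b := -1 + x / √(c.α ^ 2 - 1)
    [pt 0 (if c.sx = 0 then b / 2 else -(c.sx / √(c.α ^ 2 - 1))), pt 0 b, pt x (-1)]
  | .p9 => [pt 0 (-1)]
  | .p10 => [pt (if c.tx = c.sx then c.sx else zero₂ c) (-1)]
  | .p11 => [pt (if c.ty = 0 then (c.tx + c.sx) / 2 else c.tx - c.ty / √(c.α ^ 2 - 1)) 0]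
  | .p12 => []
  | .p13 => c.vertices₁₃

/-- What is claimed about a shortest path with intermediate vertices `vs` of type `i`. -/
def Determined (c : Instance) (vs : List Plane) (i : PathType) : Prop :=
  IsFormula c (c.len vs) i ∧ HasType c (c.vertices i) i ∧ c.len (c.vertices i) ≤ c.len vs

lemma Determined.of_eq {vs : List Plane} {i : PathType} (h : HasType c vs i) (hv : vs = c.vertices i)
    (hf : IsFormula c (c.len vs) i) : c.Determined vs i :=
  ⟨hf, hv ▸ h, hv ▸ le_rfl⟩

/-! ### Stationarity of the vertices of a shortest path, type by type -/

/-- Stationarity of `b` says that the last segment, of length `ρ`, has horizontal extent `α ρ`;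
hence its vertical extent is `√(1 - α²) ρ`. -/
lemma determined_p2 (h : c.Admissible) {vs : List Plane} (hT : HasType c vs .p2)
    (hS : c.IsShortest vs) : c.Determined vs .p2 := by
  obtain ⟨hα, hty, b, hb, hbs, rfl⟩ := hT
  have hα0 := h.pos
  have hd : HasDerivAt (fun x => c.α * (c.sx - x) + √((x - c.tx) ^ 2 + c.ty ^ 2))
      (c.α * (-1) + (b - c.tx) / √((b - c.tx) ^ 2 + c.ty ^ 2)) b :=
    (((hasDerivAt_id b).const_sub c.sx).const_mul c.α).add (hasDerivAt_dist _ _ (by positivity))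
  have h0 := deriv_eq_zero_of_min_on hd hb hbs fun x h1 h2 => by
    have := hS.len_le [pt x 0]
    rwa [len_p2 h hα.le hty hb.le hbs.le, len_p2 h hα.le hty h1.le h2.le] at this
  have hρ : 0 < √((b - c.tx) ^ 2 + c.ty ^ 2) := Real.sqrt_pos.2 (by positivity)
  have hρρ : √((b - c.tx) ^ 2 + c.ty ^ 2) ^ 2 = (b - c.tx) ^ 2 + c.ty ^ 2 :=
    Real.sq_sqrt (by positivity)
  have hlen := len_p2 h hα.le hty hb.le hbs.le
  set ρ := √((b - c.tx) ^ 2 + c.ty ^ 2)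
  have e1 : b - c.tx = c.α * ρ := by
    rw [← div_eq_iff hρ.ne']; linarith
  have hl : 0 < 1 - c.α ^ 2 := by nlinarith
  have hl0 : 0 < √(1 - c.α ^ 2) := Real.sqrt_pos.2 hl
  have hll : √(1 - c.α ^ 2) ^ 2 = 1 - c.α ^ 2 := Real.sq_sqrt hl.le
  set l := √(1 - c.α ^ 2) with hldef
  have e2 : c.ty = l * ρ := by
    have : c.ty ^ 2 = (l * ρ) ^ 2 := by rw [mul_pow, hll]; rw [e1] at hρρ; linarith
    exact (pow_left_inj₀ hty.le (by positivity) two_ne_zero).1 this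
  refine Determined.of_eq ⟨hα, hty, b, hb, hbs, rfl⟩ ?_ ?_
  · rw [vertices, ← hldef, e2, show c.tx + c.α * (l * ρ) / l = b by
      field_simp
      linarith]
  · rw [IsFormula, hlen, ← hldef]
    rw [e2, ← mul_assoc, ← pow_two, hll, show c.tx = b - c.α * ρ by linarith]
    ring

/-- Stationarity of the first vertex makes the middle segment critical, `-b₂ = k b₁`. Snell's law at
the second vertex then fixes the direction of the last segment as `(-l, -k)` with `l = √(2 - α²)`,
so both vertices are determined by tracing back from the target. -/
lemma determined_p5 (h : c.Admissible) {vs : List Plane} (hT : HasType c vs .p5)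
    (hS : c.IsShortest vs) : c.Determined vs .p5 := by
  obtain ⟨hα, htx, b₁, b₂, hb1, hb1', hb2, hb2', rfl⟩ := hT
  have hα0 := h.pos
  have hk := crit_sq hα
  have hk0 := crit_pos hα
  have htx2 : 0 < c.tx ^ 2 := by nlinarith
  have hd1 : HasDerivAt (fun x => (c.sx - x) + c.α * √(x ^ 2 + b₂ ^ 2) + √(c.tx ^ 2 + (b₂ - c.ty) ^ 2))
      (-1 + c.α * (b₁ / √(b₁ ^ 2 + b₂ ^ 2))) b₁ := by
    have := hasDerivAt_dist 0 (b₂ ^ 2) (x := b₁) (by positivity)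
    simp only [sub_zero] at this
    exact ((((hasDerivAt_id b₁).const_sub c.sx).add (this.const_mul c.α))).add_const _
  have h1 := deriv_eq_zero_of_min_on hd1 hb1 hb1' fun x i1 i2 => by
    have := hS.len_le [pt x 0, pt 0 b₂]
    rwa [len_p5 h hα.le htx hb1 hb1'.le hb2 hb2', len_p5 h hα.le htx i1 i2.le hb2 hb2'] at this
  have hd2 : HasDerivAt (fun y => (c.sx - b₁) + c.α * √(b₁ ^ 2 + y ^ 2) + √(c.tx ^ 2 + (y - c.ty) ^ 2))
      (c.α * (b₂ / √(b₁ ^ 2 + b₂ ^ 2)) + (b₂ - c.ty) / √(c.tx ^ 2 + (b₂ - c.ty) ^ 2)) b₂ :=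
    (((hasDerivAt_norm _ (by positivity)).const_mul c.α).const_add _).add
      (hasDerivAt_dist' _ _ (by positivity))
  have h2 := deriv_eq_zero_of_min_on hd2 hb2 hb2' fun y i1 i2 => by
    have := hS.len_le [pt b₁ 0, pt 0 y]
    rwa [len_p5 h hα.le htx hb1 hb1'.le hb2 hb2', len_p5 h hα.le htx hb1 hb1'.le i1 i2] at this
  have hlen := len_p5 h hα.le htx hb1 hb1'.le hb2 hb2'
  have hr : 0 < √(b₁ ^ 2 + b₂ ^ 2) := Real.sqrt_pos.2 (by positivity)
  have hrr : √(b₁ ^ 2 + b₂ ^ 2) ^ 2 = b₁ ^ 2 + b₂ ^ 2 := Real.sq_sqrt (by positivity)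
  have hρ : 0 < √(c.tx ^ 2 + (b₂ - c.ty) ^ 2) := Real.sqrt_pos.2 (by positivity)
  have hρρ : √(c.tx ^ 2 + (b₂ - c.ty) ^ 2) ^ 2 = c.tx ^ 2 + (b₂ - c.ty) ^ 2 :=
    Real.sq_sqrt (by positivity)
  set r := √(b₁ ^ 2 + b₂ ^ 2)
  set ρ := √(c.tx ^ 2 + (b₂ - c.ty) ^ 2)
  have e1 : c.α * b₁ = r := by
    rw [← div_eq_one_iff_eq hr.ne', mul_div_assoc]; linarith
  have hl : 0 < 2 - c.α ^ 2 := by linarith [sq_lt_two hα0 h.lt_sqrt_two]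
  have hl0 : 0 < √(2 - c.α ^ 2) := Real.sqrt_pos.2 hl
  have hll : √(2 - c.α ^ 2) ^ 2 = 2 - c.α ^ 2 := Real.sq_sqrt hl.le
  set k := √(c.α ^ 2 - 1) with hkdef
  set l := √(2 - c.α ^ 2) with hldef
  have e2 : -b₂ = k * b₁ := by
    have : (-b₂) ^ 2 = (k * b₁) ^ 2 := by rw [mul_pow, hk]; rw [← e1] at hrr; linarith
    exact (pow_left_inj₀ (by linarith) (by positivity) two_ne_zero).1 this
  have e3 : b₂ - c.ty = k * ρ := by
    rw [← div_eq_iff hρ.ne']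
    have : c.α * (b₂ / r) = -k := by
      rw [← e1, show b₂ = -(k * b₁) by linarith]; field_simp
    linarith
  have e4 : -c.tx = l * ρ := by
    have : (-c.tx) ^ 2 = (l * ρ) ^ 2 := by
      rw [mul_pow, hll]
      rw [e3, mul_pow, hk] at hρρ
      linarith
    exact (pow_left_inj₀ (by linarith) (by positivity) two_ne_zero).1 this
  have e5 : c.ty - k * c.tx / l = b₂ := by
    rw [show c.tx = -(l * ρ) by linarith]
    field_simp
    linarith
  refine Determined.of_eq ⟨hα, htx, b₁, b₂, hb1, hb1', hb2, hb2', rfl⟩ ?_ ?_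
  · rw [vertices, ← hldef, ← hkdef, e5, e2, mul_div_cancel_left₀ _ hk0.ne']
  · rw [IsFormula, hlen, ← hldef, ← hkdef, ← e1, show c.tx = -(l * ρ) by linarith,
      show c.ty = b₂ - k * ρ by linarith, show b₂ = -(k * b₁) by linarith]
    linear_combination (-b₁ - ρ) * hk - ρ * hll

lemma determined_p6 (h : c.Admissible) {vs : List Plane} (hT : HasType c vs .p6)
    (hS : c.IsShortest vs) : c.Determined vs .p6 := by
  obtain ⟨htx, b, hb, hb', rfl⟩ := hT
  have hα0 := h.pos
  have hs := h.sx_pos htx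
  have htx2 : 0 < c.tx ^ 2 := by nlinarith
  have hd : HasDerivAt (fun y => c.α * √(c.sx ^ 2 + y ^ 2) + √(c.tx ^ 2 + (y - c.ty) ^ 2))
      (c.α * (b / √(c.sx ^ 2 + b ^ 2)) + (b - c.ty) / √(c.tx ^ 2 + (b - c.ty) ^ 2)) b :=
    ((hasDerivAt_norm _ (by positivity)).const_mul c.α).add (hasDerivAt_dist' _ _ (by positivity))
  have h0 := deriv_eq_zero_of_min_on hd hb hb' fun y i1 i2 => by
    have := hS.len_le [pt 0 y]
    rwa [len_p6 h htx hb.le hb', len_p6 h htx i1.le i2] at this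
  have hr : 0 < √(c.sx ^ 2 + b ^ 2) := Real.sqrt_pos.2 (by positivity)
  have hrr : √(c.sx ^ 2 + b ^ 2) ^ 2 = c.sx ^ 2 + b ^ 2 := Real.sq_sqrt (by positivity)
  have hρ : 0 < √(c.tx ^ 2 + (b - c.ty) ^ 2) := Real.sqrt_pos.2 (by positivity)
  have hρρ : √(c.tx ^ 2 + (b - c.ty) ^ 2) ^ 2 = c.tx ^ 2 + (b - c.ty) ^ 2 :=
    Real.sq_sqrt (by positivity)
  have hlen := len_p6 h htx hb.le hb'
  have e1 : c.α * -b * √(c.tx ^ 2 + (b - c.ty) ^ 2) = (b - c.ty) * √(c.sx ^ 2 + b ^ 2) := by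
    field_simp at h0
    linarith
  -- Squaring Snell's law loses signs; the law itself shows that the vertex lies strictly between
  -- the heights of target and source, which is the interval where the quartic has one zero.
  have hbt : c.ty < b := by
    have h1 : 0 < (b - c.ty) * √(c.sx ^ 2 + b ^ 2) := by
      rw [← e1]; exact mul_pos (mul_pos hα0 (by linarith)) hρ
    linarith [pos_of_mul_pos_left h1 hr.le]
  have hz : IsUniqueZero (quartic₁ c) c.ty 0 b := by
    have hb0 : quartic₁ c b = 0 := by
      rw [quartic₁_eq, ← hρρ, ← hrr]
      have := congrArg (· ^ 2) e1
      simp only [mul_pow, neg_sq] at this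
      linarith
    exact ⟨⟨hbt, hb'⟩, hb0, fun v hv hv0 => quartic₁_unique hα0 hs.ne' htx.ne hv ⟨hbt, hb'⟩ hv0 hb0⟩
  refine Determined.of_eq ⟨htx, b, hb, hb', rfl⟩ ?_ ?_
  · rw [vertices, zero₁_eq hz]
  · refine ⟨b, hz, ?_⟩
    rw [hlen, sub_sq_comm]

lemma determined_p10 (h : c.Admissible) {vs : List Plane} (hT : HasType c vs .p10)
    (hS : c.IsShortest vs) : c.Determined vs .p10 := by
  obtain ⟨hts, hty, b, hb, hb', rfl⟩ := hT
  have hα0 := h.pos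
  have hty2 : 0 < (c.ty + 1) ^ 2 := by nlinarith
  have hd : HasDerivAt (fun x => c.α * √((x - c.sx) ^ 2 + 1) + √((x - c.tx) ^ 2 + (c.ty + 1) ^ 2))
      (c.α * ((b - c.sx) / √((b - c.sx) ^ 2 + 1)) +
        (b - c.tx) / √((b - c.tx) ^ 2 + (c.ty + 1) ^ 2)) b :=
    ((hasDerivAt_dist _ _ (by positivity)).const_mul c.α).add (hasDerivAt_dist _ _ (by positivity))
  have h0 := deriv_eq_zero_of_min_on hd hb hb' fun x i1 i2 => by
    have := hS.len_le [pt x (-1)]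
    rwa [len_p10 h hty hb hb', len_p10 h hty i1 i2] at this
  have hr : 0 < √((b - c.sx) ^ 2 + 1) := Real.sqrt_pos.2 (by positivity)
  have hrr : √((b - c.sx) ^ 2 + 1) ^ 2 = (b - c.sx) ^ 2 + 1 := Real.sq_sqrt (by positivity)
  have hρ : 0 < √((b - c.tx) ^ 2 + (c.ty + 1) ^ 2) := Real.sqrt_pos.2 (by positivity)
  have hρρ : √((b - c.tx) ^ 2 + (c.ty + 1) ^ 2) ^ 2 = (b - c.tx) ^ 2 + (c.ty + 1) ^ 2 :=
    Real.sq_sqrt (by positivity)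
  have hlen := len_p10 h hty hb hb'
  have e1 : c.α * (c.sx - b) * √((b - c.tx) ^ 2 + (c.ty + 1) ^ 2) =
      (b - c.tx) * √((b - c.sx) ^ 2 + 1) := by
    field_simp at h0
    linarith
  have hlen' : c.len [pt b (-1)] =
      c.α * √((c.sx - b) ^ 2 + 1) + √((c.tx - b) ^ 2 + (c.ty + 1) ^ 2) := by
    rw [hlen, sub_sq_comm b, sub_sq_comm b]
  have hρ' := mul_pos hα0 hρ
  rcases eq_or_lt_of_le hts with e | e
  -- With the target vertically below the source, both parts pull the vertex towards the same
  -- vertical line.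
  · have hbs : b = c.sx := by
      rw [e] at e1 hρ'
      have : (b - c.sx) * (√((b - c.sx) ^ 2 + 1) + c.α * √((b - c.sx) ^ 2 + (c.ty + 1) ^ 2)) = 0 := by
        linarith
      rcases mul_eq_zero.1 this with h | h <;> linarith
    refine Determined.of_eq ⟨hts, hty, b, hb, hb', rfl⟩ ?_ ?_
    · rw [vertices, if_pos e, hbs]
    · exact ⟨b, Or.inr ⟨e, hbs⟩, hlen'⟩
  · have hbt : c.tx < b := by
      by_contra! hle
      have h1 : 0 < c.α * (c.sx - b) * √((b - c.tx) ^ 2 + (c.ty + 1) ^ 2) :=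
        mul_pos (mul_pos hα0 (by linarith)) hρ
      have h2 := mul_nonpos_of_nonpos_of_nonneg (show b - c.tx ≤ 0 by linarith) hr.le
      linarith
    have hbs : b < c.sx := by
      by_contra! hle
      have h1 : c.α * (c.sx - b) * √((b - c.tx) ^ 2 + (c.ty + 1) ^ 2) ≤ 0 :=
        mul_nonpos_of_nonpos_of_nonneg
          (mul_nonpos_of_nonneg_of_nonpos hα0.le (by linarith)) hρ.le
      have h2 := mul_pos (show 0 < b - c.tx by linarith) hr
      linarith
    have hz : IsUniqueZero (quartic₂ c) c.tx c.sx b := by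
      have hb0 : quartic₂ c b = 0 := by
        have h1 : (1 + c.ty) ^ 2 + (b - c.tx) ^ 2 = √((b - c.tx) ^ 2 + (c.ty + 1) ^ 2) ^ 2 := by
          rw [hρρ]; ring
        have h2 : 1 + (c.sx - b) ^ 2 = √((b - c.sx) ^ 2 + 1) ^ 2 := by
          rw [hrr]; ring
        rw [quartic₂_eq, h1, h2]
        have := congrArg (· ^ 2) e1
        simp only [mul_pow] at this
        linarith
      exact ⟨⟨hbt, hbs⟩, hb0, fun v hv hv0 => quartic₂_unique hα0 hty hv ⟨hbt, hbs⟩ hv0 hb0⟩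
    refine Determined.of_eq ⟨hts, hty, b, hb, hb', rfl⟩ ?_ ?_
    · rw [vertices, if_neg e.ne, zero₂_eq hz]
    · exact ⟨b, Or.inl hz, hlen'⟩

/-- The first-order condition for reaching the left side. -/
lemma eq_of_leftCost_min (hα : 1 < c.α) (hs : 0 ≤ c.sx) {b l C : ℝ} (hb : b < 0) (hl : l < b)
    (hmin : ∀ x, l < x → x < 0 → leftCost c.α c.sx b + b + C ≤ leftCost c.α c.sx x + x + C) :
    c.sx = 0 ∨ b = -(c.sx / √(c.α ^ 2 - 1)) := by
  by_cases h0 : c.sx = 0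
  · exact Or.inl h0
  right
  have hs0 : 0 < c.sx := lt_of_le_of_ne hs (Ne.symm h0)
  have hk := crit_sq hα
  have hk0 := crit_pos hα
  simp only [leftCost, if_neg h0] at hmin
  have hd : HasDerivAt (fun y => c.α * √(c.sx ^ 2 + y ^ 2) + y + C)
      (c.α * (b / √(c.sx ^ 2 + b ^ 2)) + 1) b :=
    (((hasDerivAt_norm _ (by positivity)).const_mul c.α).add (hasDerivAt_id b)).add_const C
  have h1 := deriv_eq_zero_of_min_on hd hl hb hmin
  have hr : 0 < √(c.sx ^ 2 + b ^ 2) := Real.sqrt_pos.2 (by positivity)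
  have hrr : √(c.sx ^ 2 + b ^ 2) ^ 2 = c.sx ^ 2 + b ^ 2 := Real.sq_sqrt (by positivity)
  set r := √(c.sx ^ 2 + b ^ 2)
  have e1 : c.α * -b = r := by
    rw [← div_eq_one_iff_eq hr.ne', mul_div_assoc, neg_div]; linarith
  have e2 : √(c.α ^ 2 - 1) * -b = c.sx := by
    have : (√(c.α ^ 2 - 1) * -b) ^ 2 = c.sx ^ 2 := by
      rw [mul_pow, hk]; rw [← e1] at hrr; linarith
    exact (pow_left_inj₀ (mul_nonneg hk0.le (by linarith)) hs two_ne_zero).1 this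
  rw [← e2, mul_div_cancel_left₀ _ hk0.ne', neg_neg]

/-- For `sx = 0` the first vertex is arbitrary, so the canonical vertices may differ from the given
ones; only the lengths agree. -/
lemma determined_p7 (h : c.Admissible) {vs : List Plane} (hT : HasType c vs .p7)
    (hS : c.IsShortest vs) : c.Determined vs .p7 := by
  obtain ⟨hα, htx, hty, b, hb, hb', rfl⟩ := hT
  have hs := h.sx_nonneg
  have hk0 := crit_pos hα
  have hc := eq_of_leftCost_min (C := 1 + √(c.tx ^ 2 + (c.ty + 1) ^ 2)) hα hs hb' hb fun x i1 i2 => by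
    have := hS.len_le [pt 0 x, pt 0 (-1)]
    rw [len_p7 h hα.le hty hb.le hb', len_p7 h hα.le hty i1.le i2] at this
    linarith
  have hlen : c.len [pt 0 b, pt 0 (-1)] =
      √(c.α ^ 2 - 1) * c.sx + 1 + √(c.tx ^ 2 + (c.ty + 1) ^ 2) := by
    rw [len_p7 h hα.le hty hb.le hb', leftCost_crit hα hs hc]; ring
  have hlt : c.sx < √(c.α ^ 2 - 1) := by
    rcases hc with e | e
    · rw [e]; exact hk0
    · rw [e, neg_lt_neg_iff, div_lt_one hk0] at hb; exact hb
  obtain ⟨h1, h2⟩ := vertices₇_spec h hα htx hty hlt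
  exact ⟨hlen, h1, (h2.trans hlen.symm).le⟩

/-- The two vertices on the left side have critical angles. Snell's law on the bottom side then
gives the last segment the direction `(k, -l)` with `l = √(2 - α²)`, and tracing back from the
target determines the last two vertices. -/
lemma determined_p8 (h : c.Admissible) {vs : List Plane} (hT : HasType c vs .p8)
    (hS : c.IsShortest vs) : c.Determined vs .p8 := by
  obtain ⟨hα, hty, b₁, b₂, x, hb2, hb12, hb1, hx, hxW, rfl⟩ := hT
  have hs := h.sx_nonneg
  have hα0 := h.pos
  have hk := crit_sq hα
  have hk0 := crit_pos hα
  have hty2 : 0 < (c.ty + 1) ^ 2 := by nlinarith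
  have hlen := len_p8 h hα.le hty hb2 hb12.le hb1 hx hxW
  have hc := eq_of_leftCost_min (C := -b₂ + c.α * √(x ^ 2 + (b₂ + 1) ^ 2) +
      √((x - c.tx) ^ 2 + (c.ty + 1) ^ 2)) hα hs hb1 hb12 fun z i1 i2 => by
    have := hS.len_le [pt 0 z, pt 0 b₂, pt x (-1)]
    rw [hlen, len_p8 h hα.le hty hb2 i1.le i2 hx hxW] at this
    linarith
  have hd2 : HasDerivAt (fun y => leftCost c.α c.sx b₁ + (b₁ - y) + c.α * √(x ^ 2 + (y + 1) ^ 2) +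
      √((x - c.tx) ^ 2 + (c.ty + 1) ^ 2)) (-1 + c.α * ((b₂ + 1) / √(x ^ 2 + (b₂ + 1) ^ 2))) b₂ := by
    have := hasDerivAt_dist' (-1) (x ^ 2) (x := b₂) (by positivity)
    simp only [sub_neg_eq_add] at this
    exact ((((hasDerivAt_id b₂).const_sub b₁).const_add _).add (this.const_mul _)).add_const _
  have h2 := deriv_eq_zero_of_min_on hd2 hb2 hb12 fun y i1 i2 => by
    have := hS.len_le [pt 0 b₁, pt 0 y, pt x (-1)]
    rwa [hlen, len_p8 h hα.le hty i1 i2.le hb1 hx hxW] at this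
  have hd3 : HasDerivAt (fun z => leftCost c.α c.sx b₁ + (b₁ - b₂) + c.α * √(z ^ 2 + (b₂ + 1) ^ 2) +
      √((z - c.tx) ^ 2 + (c.ty + 1) ^ 2)) (c.α * (x / √(x ^ 2 + (b₂ + 1) ^ 2)) +
        (x - c.tx) / √((x - c.tx) ^ 2 + (c.ty + 1) ^ 2)) x := by
    have := hasDerivAt_dist 0 ((b₂ + 1) ^ 2) (x := x) (by positivity)
    simp only [sub_zero] at this
    exact ((this.const_mul _).const_add _).add (hasDerivAt_dist _ _ (by positivity))
  have h3 := deriv_eq_zero_of_min_on hd3 hx hxW fun z i1 i2 => by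
    have := hS.len_le [pt 0 b₁, pt 0 b₂, pt z (-1)]
    rwa [hlen, len_p8 h hα.le hty hb2 hb12.le hb1 i1 i2] at this
  have hr : 0 < √(x ^ 2 + (b₂ + 1) ^ 2) := Real.sqrt_pos.2 (by positivity)
  have hrr : √(x ^ 2 + (b₂ + 1) ^ 2) ^ 2 = x ^ 2 + (b₂ + 1) ^ 2 := Real.sq_sqrt (by positivity)
  have hρ : 0 < √((x - c.tx) ^ 2 + (c.ty + 1) ^ 2) := Real.sqrt_pos.2 (by positivity)
  have hρρ : √((x - c.tx) ^ 2 + (c.ty + 1) ^ 2) ^ 2 = (x - c.tx) ^ 2 + (c.ty + 1) ^ 2 :=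
    Real.sq_sqrt (by positivity)
  set r := √(x ^ 2 + (b₂ + 1) ^ 2)
  set ρ := √((x - c.tx) ^ 2 + (c.ty + 1) ^ 2)
  have hl : 0 < 2 - c.α ^ 2 := by linarith [sq_lt_two hα0 h.lt_sqrt_two]
  have hl0 : 0 < √(2 - c.α ^ 2) := Real.sqrt_pos.2 hl
  have hll : √(2 - c.α ^ 2) ^ 2 = 2 - c.α ^ 2 := Real.sq_sqrt hl.le
  have hlc := leftCost_crit hα hs hc
  set k := √(c.α ^ 2 - 1) with hkdef
  set l := √(2 - c.α ^ 2) with hldef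
  have hb20 : 0 < b₂ + 1 := by linarith
  have e1 : c.α * (b₂ + 1) = r := by
    rw [← div_eq_one_iff_eq hr.ne', mul_div_assoc]; linarith
  have e2 : x = k * (b₂ + 1) := by
    have : x ^ 2 = (k * (b₂ + 1)) ^ 2 := by rw [mul_pow, hk]; rw [← e1] at hrr; linarith
    exact (pow_left_inj₀ hx.le (by positivity) two_ne_zero).1 this
  have e3 : c.tx - x = k * ρ := by
    rw [← div_eq_iff hρ.ne']
    have : c.α * (x / r) = k := by
      rw [← e1, e2]; field_simp
    have h4 : (c.tx - x) / ρ = -((x - c.tx) / ρ) := by ring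
    linarith
  have e4 : -(c.ty + 1) = l * ρ := by
    have : (-(c.ty + 1)) ^ 2 = (l * ρ) ^ 2 := by
      rw [mul_pow, hll]
      rw [sub_sq_comm, e3, mul_pow, hk] at hρρ
      linarith
    exact (pow_left_inj₀ (by linarith) (by positivity) two_ne_zero).1 this
  have e5 : c.tx + k * (1 + c.ty) / l = x := by
    rw [show 1 + c.ty = -(l * ρ) by linarith]
    field_simp
    linarith
  have e6 : -1 + x / k = b₂ := by
    rw [e2]; field_simp; ring
  have hform : c.len [pt 0 b₁, pt 0 b₂, pt x (-1)] = k * c.sx + 1 + k * x + ρ := by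
    rw [hlen, hlc, ← e1, e2]
    linear_combination (-(b₂ + 1)) * hk
  refine ⟨?_, ?_⟩
  · rw [IsFormula, hform, ← hkdef, ← hldef, show 1 + c.ty = -(l * ρ) by linarith,
      show c.tx = x + k * ρ by linarith]
    linear_combination (-ρ) * hk - ρ * hll
  · rw [vertices, ← hkdef, ← hldef, e5, e6]
    set b := if c.sx = 0 then b₂ / 2 else -(c.sx / k) with hbdef
    obtain ⟨i1, i2, i3⟩ : b₂ < b ∧ b < 0 ∧ (c.sx = 0 ∨ b = -(c.sx / k)) := by
      by_cases e : c.sx = 0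
      · rw [hbdef, if_pos e]; exact ⟨by linarith, by linarith, Or.inl e⟩
      · rw [hbdef, if_neg e, ← hc.resolve_left e]
        exact ⟨hb12, hb1, Or.inr rfl⟩
    refine ⟨⟨hα, hty, b, b₂, x, hb2, i1, i2, hx, hxW, rfl⟩, ?_⟩
    rw [hlen, len_p8 h hα.le hty hb2 i1.le i2 hx hxW, leftCost_crit hα hs i3, hlc]
    linarith

lemma determined_p11 (h : c.Admissible) {vs : List Plane} (hT : HasType c vs .p11)
    (hS : c.IsShortest vs) : c.Determined vs .p11 := by
  obtain ⟨hα, ht, b, hb, hbs, rfl⟩ := hT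
  have hα0 := h.pos
  have hk := crit_sq hα
  have hk0 := crit_pos hα
  obtain ⟨t1, t2, t3, t4⟩ := mem_rect_pt.1 ht
  rcases eq_or_lt_of_le t4 with hty | hty
  -- For a target on the top side, the comparison path goes straight there and then stands still. It
  -- shows that `b` does not overshoot the target; otherwise `b` is free.
  · have h1 := hS.len_le [pt c.tx 0]
    rw [len_p11_top h hα.le hty, len_p11_top h hα.le hty, sub_self, abs_zero, add_zero,
      abs_of_nonneg (show 0 ≤ c.sx - b by linarith)] at h1
    have htb : c.tx ≤ b := by
      by_contra! hlt
      rw [abs_of_neg (show b - c.tx < 0 by linarith)] at h1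
      rcases abs_cases (c.sx - c.tx) with ⟨e, -⟩ | ⟨e, -⟩ <;> linarith
    have e : c.len [pt b 0] = c.sx - c.tx := by
      rw [len_p11_top h hα.le hty, abs_of_nonneg, abs_of_nonneg] <;> linarith
    refine ⟨?_, ?_⟩
    · rw [IsFormula, e, hty]; ring
    · rw [vertices, if_pos hty, e, len_p11_top h hα.le hty, abs_of_nonneg (by linarith),
        abs_of_nonneg (by linarith)]
      exact ⟨⟨hα, ht, _, by linarith, by linarith, rfl⟩, by linarith⟩
  · have hty2 : 0 < c.ty ^ 2 := by nlinarith
    have hd : HasDerivAt (fun x => (c.sx - x) + c.α * √((x - c.tx) ^ 2 + c.ty ^ 2))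
        (-1 + c.α * ((b - c.tx) / √((b - c.tx) ^ 2 + c.ty ^ 2))) b :=
      ((hasDerivAt_id b).const_sub c.sx).add
        ((hasDerivAt_dist _ _ (by positivity)).const_mul c.α)
    have h0 := deriv_eq_zero_of_min_on hd hb hbs fun x i1 i2 => by
      have := hS.len_le [pt x 0]
      rwa [len_p11 h hα.le ht hty hb hbs, len_p11 h hα.le ht hty i1 i2] at this
    have hlen := len_p11 h hα.le ht hty hb hbs
    have hr : 0 < √((b - c.tx) ^ 2 + c.ty ^ 2) := Real.sqrt_pos.2 (by positivity)
    have hrr : √((b - c.tx) ^ 2 + c.ty ^ 2) ^ 2 = (b - c.tx) ^ 2 + c.ty ^ 2 :=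
      Real.sq_sqrt (by positivity)
    set r := √((b - c.tx) ^ 2 + c.ty ^ 2)
    set k := √(c.α ^ 2 - 1) with hkdef
    have e1 : c.α * (b - c.tx) = r := by
      rw [← div_eq_one_iff_eq hr.ne', mul_div_assoc]; linarith
    have hbt : 0 < b - c.tx := by
      rw [← e1] at hr; exact pos_of_mul_pos_right hr hα0.le
    have e2 : -c.ty = k * (b - c.tx) := by
      have : (-c.ty) ^ 2 = (k * (b - c.tx)) ^ 2 := by rw [mul_pow, hk]; rw [← e1] at hrr; linarith
      exact (pow_left_inj₀ (by linarith) (by positivity) two_ne_zero).1 this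
    refine Determined.of_eq ⟨hα, ht, b, hb, hbs, rfl⟩ ?_ ?_
    · rw [vertices, if_neg hty.ne, ← hkdef, show c.ty = -(k * (b - c.tx)) by linarith, neg_div,
        mul_div_cancel_left₀ _ hk0.ne']
      simp
    · rw [IsFormula, hlen, ← e1, ← hkdef, show c.ty = -(k * (b - c.tx)) by linarith]
      linear_combination (-(b - c.tx)) * hk

lemma determined_p13 (h : c.Admissible) {vs : List Plane} (hT : HasType c vs .p13)
    (hS : c.IsShortest vs) : c.Determined vs .p13 := by
  obtain ⟨hα, ht, b₁, b₂, hb2, hb12, hb1, rfl⟩ := hT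
  have hs := h.sx_nonneg
  have hα0 := h.pos
  have hk := crit_sq hα
  have hk0 := crit_pos hα
  obtain ⟨t1, t2, t3, t4⟩ := mem_rect_pt.1 ht
  have hlen := len_p13 h hα.le ht hb2 (by linarith) (by linarith) hb1
  rw [abs_of_pos (by linarith)] at hlen
  have hc := eq_of_leftCost_min (C := -b₂ +
      (if c.tx = 0 then |b₂ - c.ty| else c.α * √(c.tx ^ 2 + (b₂ - c.ty) ^ 2))) hα hs hb1 hb12
      fun z i1 i2 => by
    have := hS.len_le [pt 0 z, pt 0 b₂]
    rw [hlen, len_p13 h hα.le ht hb2 (by linarith) (by linarith) i2,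
      abs_of_pos (show 0 < z - b₂ by linarith)] at this
    linarith
  have hmin : ∀ y, -1 < y → y < b₁ →
      -b₂ + (if c.tx = 0 then |b₂ - c.ty| else c.α * √(c.tx ^ 2 + (b₂ - c.ty) ^ 2)) ≤
      -y + (if c.tx = 0 then |y - c.ty| else c.α * √(c.tx ^ 2 + (y - c.ty) ^ 2)) := by
    intro y i1 i2
    have := hS.len_le [pt 0 b₁, pt 0 y]
    rw [hlen, len_p13 h hα.le ht i1 (by linarith) (by linarith) hb1,
      abs_of_pos (show 0 < b₁ - y by linarith)] at this
    linarith
  have hright : (if c.tx = 0 then |b₂ - c.ty| else c.α * √(c.tx ^ 2 + (b₂ - c.ty) ^ 2)) =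
      b₂ - c.ty + √(c.α ^ 2 - 1) * c.tx ∧ c.ty + c.tx / √(c.α ^ 2 - 1) ≤ b₂ := by
    by_cases e : c.tx = 0
    · simp only [if_pos e] at hmin ⊢
      -- If the path went below a target on the left side, raising the vertex would shorten the
      -- detour.
      have : c.ty ≤ b₂ := by
        by_contra! hlt
        obtain ⟨y, y1, y2⟩ := exists_between (lt_min hlt hb12)
        rw [lt_min_iff] at y2
        have := hmin y (by linarith) y2.2
        rw [abs_of_neg (by linarith), abs_of_neg (by linarith)] at this
        linarith
      rw [abs_of_nonneg (by linarith), e]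
      simpa using this
    · simp only [if_neg e] at hmin ⊢
      have e0 : 0 < c.tx := lt_of_le_of_ne t1 (Ne.symm e)
      have hd : HasDerivAt (fun y => -y + c.α * √(c.tx ^ 2 + (y - c.ty) ^ 2))
          (-1 + c.α * ((b₂ - c.ty) / √(c.tx ^ 2 + (b₂ - c.ty) ^ 2))) b₂ :=
        (hasDerivAt_neg b₂).add ((hasDerivAt_dist' _ _ (by positivity)).const_mul c.α)
      have h0 := deriv_eq_zero_of_min_on hd hb2 hb12 hmin
      have hr : 0 < √(c.tx ^ 2 + (b₂ - c.ty) ^ 2) := Real.sqrt_pos.2 (by positivity)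
      have hrr : √(c.tx ^ 2 + (b₂ - c.ty) ^ 2) ^ 2 = c.tx ^ 2 + (b₂ - c.ty) ^ 2 :=
        Real.sq_sqrt (by positivity)
      set r := √(c.tx ^ 2 + (b₂ - c.ty) ^ 2)
      set k := √(c.α ^ 2 - 1) with hkdef
      have e1 : c.α * (b₂ - c.ty) = r := by
        rw [← div_eq_one_iff_eq hr.ne', mul_div_assoc]; linarith
      have hbt : 0 < b₂ - c.ty := by
        rw [← e1] at hr; exact pos_of_mul_pos_right hr hα0.le
      have e2 : c.tx = k * (b₂ - c.ty) := by
        have : c.tx ^ 2 = (k * (b₂ - c.ty)) ^ 2 := by rw [mul_pow, hk]; rw [← e1] at hrr; linarith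
        exact (pow_left_inj₀ t1 (by positivity) two_ne_zero).1 this
      constructor
      · rw [← e1, e2]; linear_combination (-(b₂ - c.ty)) * hk
      · rw [e2, mul_div_cancel_left₀ _ hk0.ne']; linarith
  obtain ⟨r1, r2⟩ := hright
  have hform : c.len [pt 0 b₁, pt 0 b₂] = √(c.α ^ 2 - 1) * (c.sx + c.tx) - c.ty := by
    rw [hlen, r1, leftCost_crit hα hs hc]; ring
  have hlt : c.sx + c.tx < √(c.α ^ 2 - 1) * -c.ty := by
    have h1 : b₁ ≤ -(c.sx / √(c.α ^ 2 - 1)) := by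
      rcases hc with e | e
      · rw [e]; simpa using hb1.le
      · exact e.le
    have h2 : c.sx / √(c.α ^ 2 - 1) + c.tx / √(c.α ^ 2 - 1) < -c.ty := by linarith
    rw [← add_div, div_lt_iff₀ hk0] at h2
    linarith
  obtain ⟨h1, h2⟩ := vertices₁₃_spec h hα ht hlt
  exact ⟨hform, h1, (h2.trans hform.symm).le⟩

/-- The vertices and the length of a shortest path of a given type. -/
theorem determined (h : c.Admissible) {vs : List Plane} {i : PathType} (hT : HasType c vs i)
    (hS : c.IsShortest vs) : c.Determined vs i := by
  cases i with
  | p1 =>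
    refine Determined.of_eq hT hT.1 ?_
    rw [hT.1, IsFormula, len_p1 h hT.2, sub_sq_comm]
  | p2 => exact determined_p2 h hT hS
  | p3 =>
    obtain ⟨h1, h2, h3, h4⟩ := hT
    refine Determined.of_eq ⟨h1, h2, h3, h4⟩ h4 ?_
    rw [h4, IsFormula, len_p3 h h1.le h2]
  | p4 =>
    obtain ⟨h1, h2, h3, h4⟩ := hT
    refine Determined.of_eq ⟨h1, h2, h3, h4⟩ h4 ?_
    rw [h4, IsFormula, len_p4 h h1 h2]
  | p5 => exact determined_p5 h hT hS
  | p6 => exact determined_p6 h hT hS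
  | p7 => exact determined_p7 h hT hS
  | p8 => exact determined_p8 h hT hS
  | p9 =>
    obtain ⟨h1, h2, h3, h4, h5⟩ := hT
    refine Determined.of_eq ⟨h1, h2, h3, h4, h5⟩ h5 ?_
    -- The corner itself is in the rectangle, so the last segment is not degenerate.
    have hne : c.tx < 0 ∨ c.ty < -1 := by
      by_contra! hcon
      apply h4
      exact mem_rect_pt.2 ⟨hcon.1, h2.trans h.width_pos.le, hcon.2, by linarith⟩
    rw [h5, IsFormula, len_p9 h h1 h2 h3 hne]
  | p10 => exact determined_p10 h hT hS
  | p11 => exact determined_p11 h hT hS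
  | p12 =>
    obtain ⟨h1, h2, h3⟩ := hT
    refine Determined.of_eq ⟨h1, h2, h3⟩ h2 ?_
    rw [h2, IsFormula, len_p12 h h1 h3]
  | p13 => exact determined_p13 h hT hS

end Instance

end WeightedRectangle
end

noncomputable section

namespace WeightedRectangle

/-! ### The program -/

lemma pt_inj {x y x' y' : ℝ} : pt x y = pt x' y' ↔ x = x' ∧ y = y' := by
  refine ⟨fun h => ⟨?_, ?_⟩, fun ⟨h1, h2⟩ => by rw [h1, h2]⟩
  · simpa using congrArg (· 0) h
  · simpa using congrArg (· 1) h

lemma AlgP.mem_rect : AlgP fun c => c.t ∈ rect c.W :=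
  (((AlgP.le .zero .tx).and (AlgP.le .tx .W)).and
    ((AlgP.le RAlg.one.neg .ty).and (AlgP.le .ty .zero))).congr
      fun _ => by rw [Instance.t, Instance.mem_rect_pt, and_assoc]

lemma RAlg.crit : RAlg fun c => √(c.α ^ 2 - 1) := ((RAlg.α.pow 2).sub .one).sqrt

lemma RAlg.leftCost {f : Instance → ℝ} (hf : RAlg f) : RAlg fun c => leftCost c.α c.sx (f c) :=
  RAlg.ite (AlgP.eq .sx .zero) hf.neg (RAlg.α.mul ((RAlg.sx.pow 2).add (hf.pow 2)).sqrt)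

/-- The vertices of the canonical path of the given type are computable, so is its length if the
path is of this type, and the latter is decidable. -/
def IsComputable (i : PathType) : Prop :=
  ∃ (L : List ((Instance → ℝ) × (Instance → ℝ))) (p : Instance → Prop) (f : Instance → ℝ),
    (∀ x ∈ L, RAlg x.1 ∧ RAlg x.2) ∧ AlgP p ∧ RAlg f ∧ ∀ c, c.Admissible →
      c.vertices i = L.map (fun x => pt (x.1 c) (x.2 c)) ∧
      (HasType c (c.vertices i) i ↔ p c) ∧ (p c → c.len (c.vertices i) = f c)

open Instance

/-! ### Computability of the canonical path of each type -/

lemma isComputable_p2 : IsComputable .p2 := by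
  obtain ⟨b, hb, hv⟩ : ∃ b, RAlg b ∧ ∀ c, c.vertices .p2 = [pt (b c) 0] :=
    ⟨_, RAlg.tx.add ((RAlg.α.mul .ty).div (RAlg.one.sub (RAlg.α.pow 2)).sqrt), fun _ => rfl⟩
  refine ⟨[(b, fun _ => 0)], fun c => (c.α < 1 ∧ 0 < c.ty) ∧ 0 < b c ∧ b c < c.sx, _,
    by simpa using ⟨hb, RAlg.zero⟩,
    ((AlgP.lt .α .one).and (AlgP.lt .zero .ty)).and ((AlgP.lt .zero hb).and (AlgP.lt hb .sx)),
    (RAlg.α.mul (RAlg.sx.sub hb)).add (((hb.sub .tx).pow 2).add (RAlg.ty.pow 2)).sqrt,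
    fun c h => ⟨hv c, ?_, fun ⟨⟨h1, h2⟩, h3, h4⟩ => ?_⟩⟩
  · simp [hv, HasType, pt_inj, and_assoc]
  · rw [hv, len_p2 h h1.le h2 h3.le h4.le]

lemma isComputable_p5 : IsComputable .p5 := by
  have hb := RAlg.ty.sub ((RAlg.crit.mul .tx).div ((RAlg.ofNat 2).sub (RAlg.α.pow 2)).sqrt)
  obtain ⟨b₁, b₂, h₁, h₂, hv⟩ : ∃ b₁ b₂, RAlg b₁ ∧ RAlg b₂ ∧
      ∀ c, c.vertices .p5 = [pt (b₁ c) 0, pt 0 (b₂ c)] :=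
    ⟨_, _, hb.neg.div .crit, hb, fun _ => rfl⟩
  refine ⟨[(b₁, fun _ => 0), (fun _ => 0, b₂)], fun c => (1 < c.α ∧ c.tx < 0) ∧
    (0 < b₁ c ∧ b₁ c < c.sx) ∧ -1 < b₂ c ∧ b₂ c < 0, _, by simpa using ⟨⟨h₁, RAlg.zero⟩, RAlg.zero, h₂⟩,
    ((AlgP.lt .one .α).and (AlgP.lt .tx .zero)).and (((AlgP.lt .zero h₁).and (AlgP.lt h₁ .sx)).and
      ((AlgP.lt RAlg.one.neg h₂).and (AlgP.lt h₂ .zero))),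
    ((RAlg.sx.sub h₁).add (RAlg.α.mul ((h₁.pow 2).add (h₂.pow 2)).sqrt)).add
      ((RAlg.tx.pow 2).add ((h₂.sub .ty).pow 2)).sqrt,
    fun c h => ⟨hv c, ?_, fun ⟨⟨i1, i2⟩, ⟨i3, i4⟩, i5, i6⟩ => ?_⟩⟩
  · simp only [hv, HasType, List.cons.injEq, pt_inj, and_true, true_and]
    constructor
    · rintro ⟨i1, i2, _, _, i3, i4, i5, i6, rfl, rfl⟩
      exact ⟨⟨i1, i2⟩, ⟨i3, i4⟩, i5, i6⟩
    · rintro ⟨⟨i1, i2⟩, ⟨i3, i4⟩, i5, i6⟩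
      exact ⟨i1, i2, _, _, i3, i4, i5, i6, rfl, rfl⟩
  · rw [hv, len_p5 h i1.le i2 i3 i4.le i5 i6]

lemma isComputable_p6 : IsComputable .p6 := by
  obtain ⟨b, hb, hv⟩ : ∃ b, RAlg b ∧ ∀ c, c.vertices .p6 = [pt 0 (b c)] :=
    ⟨_, RAlg.zero₁, fun _ => rfl⟩
  refine ⟨[(fun _ => 0, b)], fun c => c.tx < 0 ∧ -1 < b c ∧ b c < 0, _,
    by simpa using ⟨RAlg.zero, hb⟩,
    (AlgP.lt .tx .zero).and ((AlgP.lt RAlg.one.neg hb).and (AlgP.lt hb .zero)),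
    (RAlg.α.mul ((RAlg.sx.pow 2).add (hb.pow 2)).sqrt).add
      ((RAlg.tx.pow 2).add ((hb.sub .ty).pow 2)).sqrt,
    fun c h => ⟨hv c, ?_, fun ⟨h1, h2, h3⟩ => ?_⟩⟩
  · simp [hv, HasType, pt_inj]
  · rw [hv, len_p6 h h1 h2.le h3]

lemma isComputable_p7 : IsComputable .p7 := by
  obtain ⟨b, hb, hv⟩ : ∃ b, RAlg b ∧ ∀ c, c.vertices .p7 = [pt 0 (b c), pt 0 (-1)] :=
    ⟨_, RAlg.ite (AlgP.eq .sx .zero) (RAlg.one.neg.div (RAlg.ofNat 2)) (RAlg.sx.div .crit).neg,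
      fun _ => rfl⟩
  refine ⟨[(fun _ => 0, b), (fun _ => 0, fun _ => -1)],
    fun c => (1 < c.α ∧ 0 ≤ c.tx ∧ c.ty < -1) ∧ -1 < b c ∧ b c < 0, _,
    by simpa using ⟨⟨RAlg.zero, hb⟩, RAlg.zero, RAlg.one.neg⟩,
    ((AlgP.lt .one .α).and ((AlgP.le .zero .tx).and (AlgP.lt .ty RAlg.one.neg))).and
      ((AlgP.lt RAlg.one.neg hb).and (AlgP.lt hb .zero)),
    (hb.leftCost.add (hb.add .one)).add ((RAlg.tx.pow 2).add ((RAlg.ty.add .one).pow 2)).sqrt,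
    fun c h => ⟨hv c, ?_, fun ⟨⟨h1, h2, h3⟩, h4, h5⟩ => ?_⟩⟩
  · simp [hv, HasType, pt_inj, and_assoc]
  · rw [hv, len_p7 h h1.le h3 h4.le h5]

lemma isComputable_p8 : IsComputable .p8 := by
  have hx := RAlg.tx.add ((RAlg.crit.mul (RAlg.one.add .ty)).div
    ((RAlg.ofNat 2).sub (RAlg.α.pow 2)).sqrt)
  have hb := RAlg.one.neg.add (hx.div .crit)
  obtain ⟨b₁, b₂, b₃, h₁, h₂, h₃, hv⟩ : ∃ b₁ b₂ b₃, RAlg b₁ ∧ RAlg b₂ ∧ RAlg b₃ ∧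
      ∀ c, c.vertices .p8 = [pt 0 (b₁ c), pt 0 (b₂ c), pt (b₃ c) (-1)] :=
    ⟨_, _, _, RAlg.ite (AlgP.eq .sx .zero) (hb.div (RAlg.ofNat 2)) (RAlg.sx.div .crit).neg, hb, hx,
      fun _ => rfl⟩
  refine ⟨[(fun _ => 0, b₁), (fun _ => 0, b₂), (b₃, fun _ => -1)], fun c => (1 < c.α ∧ c.ty < -1) ∧
    (-1 < b₂ c ∧ b₂ c < b₁ c ∧ b₁ c < 0) ∧ 0 < b₃ c ∧ b₃ c < c.W, _,
    by simpa using ⟨⟨RAlg.zero, h₁⟩, ⟨RAlg.zero, h₂⟩, h₃, RAlg.one.neg⟩,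
    ((AlgP.lt .one .α).and (AlgP.lt .ty RAlg.one.neg)).and
      (((AlgP.lt RAlg.one.neg h₂).and ((AlgP.lt h₂ h₁).and (AlgP.lt h₁ .zero))).and
      ((AlgP.lt .zero h₃).and (AlgP.lt h₃ .W))),
    ((h₁.leftCost.add (h₁.sub h₂)).add
      (RAlg.α.mul ((h₃.pow 2).add ((h₂.add .one).pow 2)).sqrt)).add
      (((h₃.sub .tx).pow 2).add ((RAlg.ty.add .one).pow 2)).sqrt,
    fun c h => ⟨hv c, ?_, fun ⟨⟨i1, i2⟩, ⟨i3, i4, i5⟩, i6, i7⟩ => ?_⟩⟩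
  · simp only [hv, HasType, List.cons.injEq, pt_inj, and_true, true_and]
    constructor
    · rintro ⟨i1, i2, _, _, _, i3, i4, i5, i6, i7, rfl, rfl, rfl⟩
      exact ⟨⟨i1, i2⟩, ⟨i3, i4, i5⟩, i6, i7⟩
    · rintro ⟨⟨i1, i2⟩, ⟨i3, i4, i5⟩, i6, i7⟩
      exact ⟨i1, i2, _, _, _, i3, i4, i5, i6, i7, rfl, rfl, rfl⟩
  · rw [hv, len_p8 h i1.le i2 i3 i4.le i5 i6 i7]

lemma isComputable_p9 : IsComputable .p9 := by
  refine ⟨[(fun _ => 0, fun _ => -1)],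
    fun c => (c.α ≤ 1 ∧ c.tx ≤ 0 ∧ c.ty ≤ -1) ∧ ¬ c.t ∈ rect c.W, _,
    by simpa using ⟨RAlg.zero, RAlg.one.neg⟩,
    ((AlgP.le .α .one).and ((AlgP.le .tx .zero).and (AlgP.le .ty RAlg.one.neg))).and
      AlgP.mem_rect.not,
    (RAlg.α.mul ((RAlg.sx.pow 2).add .one).sqrt).add
      ((RAlg.tx.pow 2).add ((RAlg.ty.add .one).pow 2)).sqrt,
    fun c h => ⟨rfl, ?_, fun ⟨⟨h1, h2, h3⟩, h4⟩ => ?_⟩⟩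
  · simp [vertices, HasType, and_assoc]
  · refine len_p9 h h1 h2 h3 ?_
    by_contra! hcon
    exact h4 (mem_rect_pt.2 ⟨hcon.1, h2.trans h.width_pos.le, hcon.2, by linarith⟩)

lemma isComputable_p10 : IsComputable .p10 := by
  obtain ⟨b, hb, hv⟩ : ∃ b, RAlg b ∧ ∀ c, c.vertices .p10 = [pt (b c) (-1)] :=
    ⟨_, RAlg.ite (AlgP.eq .tx .sx) .sx RAlg.zero₂, fun _ => rfl⟩
  refine ⟨[(b, fun _ => -1)], fun c => (c.tx ≤ c.sx ∧ c.ty < -1) ∧ 0 < b c ∧ b c < c.W, _,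
    by simpa using ⟨hb, RAlg.one.neg⟩,
    ((AlgP.le .tx .sx).and (AlgP.lt .ty RAlg.one.neg)).and ((AlgP.lt .zero hb).and (AlgP.lt hb .W)),
    (RAlg.α.mul (((hb.sub .sx).pow 2).add .one).sqrt).add
      (((hb.sub .tx).pow 2).add ((RAlg.ty.add .one).pow 2)).sqrt,
    fun c h => ⟨hv c, ?_, fun ⟨⟨_, h2⟩, h3, h4⟩ => ?_⟩⟩
  · simp [hv, HasType, pt_inj, and_assoc]
  · rw [hv, len_p10 h h2 h3 h4]

lemma isComputable_p11 : IsComputable .p11 := by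
  obtain ⟨b, hb, hv⟩ : ∃ b, RAlg b ∧ ∀ c, c.vertices .p11 = [pt (b c) 0] :=
    ⟨_, RAlg.ite (AlgP.eq .ty .zero) ((RAlg.tx.add .sx).div (RAlg.ofNat 2))
      (RAlg.tx.sub (RAlg.ty.div .crit)), fun _ => rfl⟩
  refine ⟨[(b, fun _ => 0)], fun c => (1 < c.α ∧ c.t ∈ rect c.W) ∧ 0 < b c ∧ b c < c.sx, _,
    by simpa using ⟨hb, RAlg.zero⟩,
    ((AlgP.lt .one .α).and .mem_rect).and ((AlgP.lt .zero hb).and (AlgP.lt hb .sx)),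
    RAlg.ite (AlgP.eq .ty .zero) ((RAlg.sx.sub hb).abs.add (hb.sub .tx).abs)
      ((RAlg.sx.sub hb).add (RAlg.α.mul (((hb.sub .tx).pow 2).add (RAlg.ty.pow 2)).sqrt)),
    fun c h => ⟨hv c, ?_, fun ⟨⟨h1, h2⟩, h3, h4⟩ => ?_⟩⟩
  · simp [hv, HasType, pt_inj, and_assoc]
  · rw [hv]
    split_ifs with e
    · exact len_p11_top h h1.le e _
    · exact len_p11 h h1.le h2 (lt_of_le_of_ne (mem_rect_pt.1 h2).2.2.2 e) h3 h4

/-- Inclusion of a segment in the open rectangle is not directly testable; the inequalities for its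
midpoint are. -/
lemma isComputable_p12 : IsComputable .p12 := by
  refine ⟨[], fun c => c.t ∈ rect c.W ∧ (c.α ≤ 1 ∨ (c.tx = c.sx ∧ c.ty = 0) ∨
      (c.ty < 0 ∧ 0 < c.sx + c.tx ∧ c.sx + c.tx < 2 * c.W)), _, by simp,
    AlgP.mem_rect.and ((AlgP.le .α .one).or (((AlgP.eq .tx .sx).and (AlgP.eq .ty .zero)).or
      ((AlgP.lt .ty .zero).and ((AlgP.lt .zero (RAlg.sx.add .tx)).and
        (AlgP.lt (RAlg.sx.add .tx) ((RAlg.ofNat 2).mul .W)))))),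
    RAlg.α.mul (((RAlg.sx.sub .tx).pow 2).add (RAlg.ty.pow 2)).sqrt, fun c h => ?_⟩
  have key : HasType c (c.vertices .p12) .p12 ↔ c.t ∈ rect c.W ∧ (c.α ≤ 1 ∨
      (c.tx = c.sx ∧ c.ty = 0) ∨ (c.ty < 0 ∧ 0 < c.sx + c.tx ∧ c.sx + c.tx < 2 * c.W)) := by
    simp only [HasType, vertices, true_and]
    refine and_congr_right fun ht => ?_
    rw [openSegment_subset_openRect_iff h ht, t, s, pt_inj]
  refine ⟨rfl, key, fun hp => ?_⟩
  obtain ⟨h1, -, h2⟩ := key.2 hp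
  exact len_p12 h h1 h2

lemma isComputable_p13 : IsComputable .p13 := by
  have hp := (RAlg.sx.div .crit).neg
  have hq := RAlg.ty.add (RAlg.tx.div .crit)
  have h2 := RAlg.ofNat 2
  have h3 := RAlg.ofNat 3
  obtain ⟨b₁, b₂, h₁, h₂, hv⟩ : ∃ b₁ b₂, RAlg b₁ ∧ RAlg b₂ ∧
      ∀ c, c.vertices .p13 = [pt 0 (b₁ c), pt 0 (b₂ c)] :=
    ⟨_, _, RAlg.ite (AlgP.eq .sx .zero) (((h2.mul hp).add hq).div h3) hp,
      RAlg.ite (AlgP.eq .tx .zero) ((hp.add (h2.mul hq)).div h3) hq, fun _ => rfl⟩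
  refine ⟨[(fun _ => 0, b₁), (fun _ => 0, b₂)], fun c => (1 < c.α ∧ c.t ∈ rect c.W) ∧
    -1 < b₂ c ∧ b₂ c < b₁ c ∧ b₁ c < 0, _, by simpa using ⟨⟨RAlg.zero, h₁⟩, RAlg.zero, h₂⟩,
    ((AlgP.lt .one .α).and .mem_rect).and
      ((AlgP.lt RAlg.one.neg h₂).and ((AlgP.lt h₂ h₁).and (AlgP.lt h₁ .zero))),
    (h₁.leftCost.add (h₁.sub h₂).abs).add (RAlg.ite (AlgP.eq .tx .zero) (h₂.sub .ty).abs
      (RAlg.α.mul ((RAlg.tx.pow 2).add ((h₂.sub .ty).pow 2)).sqrt)),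
    fun c h => ⟨hv c, ?_, fun ⟨⟨i1, i2⟩, i3, i4, i5⟩ => ?_⟩⟩
  · simp only [hv, HasType, List.cons.injEq, pt_inj, and_true, true_and]
    constructor
    · rintro ⟨i1, i2, _, _, i3, i4, i5, rfl, rfl⟩
      exact ⟨⟨i1, i2⟩, i3, i4, i5⟩
    · rintro ⟨⟨i1, i2⟩, i3, i4, i5⟩
      exact ⟨i1, i2, _, _, i3, i4, i5, rfl, rfl⟩
  · rw [hv, len_p13 h i1.le i2 i3 (by linarith) (by linarith) i5]

lemma isComputable (i : PathType) : IsComputable i := by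
  have hr := ((RAlg.tx.pow 2).add (RAlg.ty.pow 2)).sqrt
  cases i with
  | p1 =>
    refine ⟨[], fun c => 0 < c.ty, _, by simp, AlgP.lt .zero .ty,
      (((RAlg.tx.sub .sx).pow 2).add (RAlg.ty.pow 2)).sqrt,
      fun c h => ⟨rfl, by simp [HasType, vertices], fun h1 => len_p1 h h1⟩⟩
  | p2 => exact isComputable_p2
  | p3 =>
    refine ⟨[(fun _ => 0, fun _ => 0)], fun c => c.α < 1 ∧ c.tx < 0 ∧ 0 ≤ c.ty, _,
      by simpa using RAlg.zero,
      (AlgP.lt .α .one).and ((AlgP.lt .tx .zero).and (AlgP.le .zero .ty)),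
      (RAlg.α.mul .sx).add hr,
      fun c h => ⟨rfl, by simp [HasType, vertices], fun ⟨h1, h2, _⟩ => len_p3 h h1.le h2⟩⟩
  | p4 =>
    refine ⟨[(fun _ => 0, fun _ => 0)], fun c => 1 ≤ c.α ∧ c.tx < 0 ∧ c.ty ≤ 0, _,
      by simpa using RAlg.zero,
      (AlgP.le .one .α).and ((AlgP.lt .tx .zero).and (AlgP.le .ty .zero)), RAlg.sx.add hr,
      fun c h => ⟨rfl, by simp [HasType, vertices], fun ⟨h1, h2, _⟩ => len_p4 h h1 h2⟩⟩
  | p5 => exact isComputable_p5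
  | p6 => exact isComputable_p6
  | p7 => exact isComputable_p7
  | p8 => exact isComputable_p8
  | p9 => exact isComputable_p9
  | p10 => exact isComputable_p10
  | p11 => exact isComputable_p11
  | p12 => exact isComputable_p12
  | p13 => exact isComputable_p13

/-- The types, up to the mirror symmetry. -/
def allTypes : List (PathType × Bool) :=
  [.p1, .p2, .p3, .p4, .p5, .p6, .p7, .p8, .p9, .p10, .p11, .p12, .p13] ×ˢ [false, true]

lemma mem_allTypes (x : PathType × Bool) : x ∈ allTypes := by
  rw [allTypes, List.mem_product]
  obtain ⟨i, m⟩ := x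
  constructor
  · cases i <;> simp
  · cases m <;> simp

lemma exists_mirrorPt_eq (m : Bool) {x y : Instance → ℝ} (hx : RAlg x) (hy : RAlg y) :
    ∃ x' y', RAlg x' ∧ RAlg y' ∧
      ∀ c : Instance, c.mirrorPt m (pt (x (c.mirror m)) (y (c.mirror m))) = pt (x' c) (y' c) := by
  cases m
  · exact ⟨x, y, hx, hy, fun _ => rfl⟩
  · exact ⟨_, _, RAlg.W.sub (hx.mirror true), hy.mirror true, fun _ => by simp [mirrorPt]⟩

lemma exists_encode_eq (m : Bool) (L : List ((Instance → ℝ) × (Instance → ℝ)))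
    (hL : ∀ x ∈ L, RAlg x.1 ∧ RAlg x.2) {d : Instance → ℝ} (hd : RAlg d) :
    ∃ fs : List (Instance → ℂ), (∀ f ∈ fs, Alg f) ∧ ∀ c : Instance, encode
      ((L.map fun x => pt (x.1 (c.mirror m)) (x.2 (c.mirror m))).map (c.mirrorPt m)) (d c) =
        fs.map fun f => f c := by
  induction L with
  | nil => exact ⟨[_], fun f hf => List.mem_singleton.1 hf ▸ hd, fun c => by simp [encode]⟩
  | cons x L ih =>
    obtain ⟨fs, h1, h2⟩ := ih fun y hy => hL y (List.mem_cons_of_mem _ hy)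
    obtain ⟨h3, h4⟩ := hL x List.mem_cons_self
    obtain ⟨x', y', h5, h6, h7⟩ := exists_mirrorPt_eq m h3 h4
    refine ⟨(fun c => (x' c : ℂ)) :: (fun c => (y' c : ℂ)) :: fs, ?_, fun c => ?_⟩
    · simp only [List.mem_cons, forall_eq_or_imp]
      exact ⟨h5, h6, h1⟩
    · have := h2 c
      simp only [List.map_cons, h7, encode, List.flatMap_cons, List.cons_append, List.nil_append,
        pt_zero, pt_one] at this ⊢
      rw [this]

/-- A shortest path and its length can be computed. -/
theorem exists_program :
    ∃ (P : Program (PathType × Bool)) (C : ℕ), ∀ c : Instance, c.Admissible →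
      ∃ (i : PathType) (m : Bool) (vs : List Plane) (n : ℕ),
        P.run c.input = some (((i, m), encode vs (c.len vs)), n) ∧ n ≤ C ∧
        HasType (c.mirror m) (vs.map (c.mirrorPt m)) i ∧ c.IsShortest vs := by
  choose L p f hL hp hf hspec using isComputable
  -- A candidate is selected if it is of its type and no other such candidate is shorter; candidates
  -- that are not of their type have meaningless lengths and are ignored.
  let cond : PathType × Bool → Instance → Prop := fun x c => p x.1 (c.mirror x.2) ∧
    ∀ y ∈ allTypes, p y.1 (c.mirror y.2) → f x.1 (c.mirror x.2) ≤ f y.1 (c.mirror y.2)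
  have hcond : ∀ x, AlgP (cond x) := fun x => ((hp _).mirror x.2).and <|
    AlgP.forall_mem _ fun y _ => ((hp _).mirror y.2).imp (AlgP.le ((hf _).mirror _) ((hf _).mirror _))
  have hout := fun x : PathType × Bool => exists_encode_eq x.2 (L x.1) (hL x.1) ((hf x.1).mirror x.2)
  choose out hout hout' using hout
  let Q : Instance → (PathType × Bool) × List ℂ → Prop := fun c o => ∃ vs,
    o.2 = encode vs (c.len vs) ∧ HasType (c.mirror o.1.2) (vs.map (c.mirrorPt o.1.2)) o.1.1 ∧
      c.IsShortest vs
  -- The canonical path of the type of some shortest path is itself of this type and not longer, so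
  -- any path at most as long as that candidate is a shortest path.
  have hbest : ∀ c : Instance, c.Admissible → ∃ x : PathType × Bool, p x.1 (c.mirror x.2) ∧
      ∀ vs, c.len vs ≤ f x.1 (c.mirror x.2) → c.IsShortest vs := by
    intro c hc
    obtain ⟨i, m, vs, h1, h2⟩ := exists_isShortest hc
    obtain ⟨-, h3, h4⟩ := determined (hc.mirror m) h1 (h2.mirror m)
    obtain ⟨-, h5, h6⟩ := hspec i _ (hc.mirror m)
    refine ⟨(i, m), h5.1 h3, fun vs' h7 => h2.of_len_le (h7.trans ?_)⟩
    rw [len_mirror] at h4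
    exact (h6 (h5.1 h3)).symm.le.trans h4
  have hsolves : Solves Admissible input Q := by
    have : Inhabited (PathType × Bool) := ⟨(.p1, false)⟩
    refine solves_cases allTypes id cond out (fun x _ => hcond x) (fun x _ => hout x) ?_ ?_ ?_
    · refine ⟨⟨5, fun c _ => rfl⟩, fun g hg => ?_⟩
      simp only [inputs, List.mem_cons, List.not_mem_nil, or_false] at hg
      rcases hg with rfl | rfl | rfl | rfl | rfl
      exacts [⟨0, fun _ _ => rfl⟩, ⟨1, fun _ _ => rfl⟩, ⟨2, fun _ _ => rfl⟩, ⟨3, fun _ _ => rfl⟩,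
        ⟨4, fun _ _ => rfl⟩]
    · intro c hc
      obtain ⟨x, hx, -⟩ := hbest c hc
      obtain ⟨y, ⟨-, hy⟩, hy'⟩ := Set.exists_min_image
        {x : PathType × Bool | x ∈ allTypes ∧ p x.1 (c.mirror x.2)}
        (fun x => f x.1 (c.mirror x.2)) ((List.finite_toSet allTypes).subset fun x hx => hx.1)
        ⟨x, mem_allTypes x, hx⟩
      exact ⟨y, mem_allTypes y, hy, fun z hz hz' => hy' z ⟨hz, hz'⟩⟩
    · rintro ⟨i, m⟩ - c hc ⟨h1, h2⟩
      obtain ⟨h3, h4, h5⟩ := hspec i _ (hc.mirror m)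
      have h6 : c.len (((c.mirror m).vertices i).map (c.mirrorPt m)) = f i (c.mirror m) := by
        rw [← h5 h1, ← c.len_mirror m, map_mirrorPt_map_mirrorPt]
      refine ⟨((c.mirror m).vertices i).map (c.mirrorPt m), ?_, ?_, ?_⟩
      · rw [h6, h3]
        exact (hout' (i, m) c).symm
      · rw [id, map_mirrorPt_map_mirrorPt]
        exact h4.2 h1
      · obtain ⟨x, hx, hx'⟩ := hbest c hc
        exact hx' _ (h6.le.trans (h2 x (mem_allTypes x) hx))
  obtain ⟨P, C, hP⟩ := hsolves
  refine ⟨P, C, fun c hc => ?_⟩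
  obtain ⟨⟨⟨i, m⟩, o⟩, n, h1, h2, vs, rfl, h3, h4⟩ := hP c hc
  exact ⟨i, m, vs, n, h1, h2, h3, h4⟩

end WeightedRectangle
end

theorem theorem1 :
    -- every target is reached by a shortest path of one of the types, up to the mirror symmetry
    (∀ c : WeightedRectangle.Instance, c.Admissible →
      ∃ (i : WeightedRectangle.PathType) (m : Bool) (vs : List WeightedRectangle.Plane),
        WeightedRectangle.HasType (c.mirror m) (vs.map (c.mirrorPt m)) i ∧ c.IsShortest vs) ∧
    -- the length of a shortest path of each type
    (∀ c : WeightedRectangle.Instance, c.Admissible →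
      ∀ (i : WeightedRectangle.PathType) (m : Bool) (vs : List WeightedRectangle.Plane),
        WeightedRectangle.HasType (c.mirror m) (vs.map (c.mirrorPt m)) i → c.IsShortest vs →
          WeightedRectangle.IsFormula (c.mirror m) (c.len vs) i) ∧
    -- one program computes a shortest path and its length in a bounded number of steps
    (∃ (P : WeightedRectangle.Program (WeightedRectangle.PathType × Bool)) (C : ℕ),
      ∀ c : WeightedRectangle.Instance, c.Admissible →
        ∃ (i : WeightedRectangle.PathType) (m : Bool) (vs : List WeightedRectangle.Plane) (n : ℕ),
          P.run c.input = some (((i, m), WeightedRectangle.encode vs (c.len vs)), n) ∧ n ≤ C ∧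
          WeightedRectangle.HasType (c.mirror m) (vs.map (c.mirrorPt m)) i ∧
          c.IsShortest vs) :=
  ⟨fun _ h => WeightedRectangle.Instance.exists_isShortest h,
    fun c h i m vs hT hS => by
      have := (WeightedRectangle.Instance.determined (h.mirror m) hT (hS.mirror m)).1
      rwa [c.len_mirror] at this,
    WeightedRectangle.exists_program⟩
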